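/- **Definitions.** A Lorentzian pre-length space $(X,d,\ll,\le,\tau)$ is a (possibly extended) metric space $(X,d)$ with a reflexive and transitive relation $\le$, a transitive relation $\ll$ contained in $\le$, and a function $\tau:X\times X\to[0,\infty]$ that is lower semicontinuous with respect to $d$, satisfies $\tau(a,c)\ge\tau(a,b)+\tau(b,c)$ whenever $a\le b\le c$, and satisfies $\tau(a,b)>0\iff a\ll b$. A causal curve is a locally Lipschitz curve $\gamma:[s_0,s_1]\to X$ with $\gamma(s)\le\gamma(t)$ for $s<t$. Its length $L_\tau(\gamma)$ is the infimum of $\sum_i\tau(\gamma(t_i),\gamma(t_{i+1}))$ over all partitions $s_0=t_0<\dots<t_n=s_1$. If $L_\tau(\gamma)$ equals the time separation $\tau$ of the endpoints of $\gamma$, then $\gamma$ is called $\tau$-realizing and its image is called a geodesic segment. A timelike triangle $\Delta(x,y,z)$ in $U\subseteq X$ consists of points $x\ll y\ll z$ and geodesic segments $[x,y],[y,z],[x,z]$ contained in $U$. For $K\in\mathbb R$ let $M_K$ be the two-dimensional simply connected Lorentzian model space of constant curvature $K$ (the Minkowski plane if $K=0$, the universal cover of suitably scaled de Sitter space if $K>0$,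 and of suitably scaled anti-de Sitter space if $K<0$), with time separation $\bar\tau$. A timelike triangle $\Delta(x,y,z)$ satisfies the size bounds for $M_K$ if $K\ge 0$, or if $K<0$ and $\tau(x,z)<\pi/\sqrt{-K}$. A comparison triangle for $\Delta(x,y,z)$ is a timelike geodesic triangle $\Delta(\bar x,\bar y,\bar z)$ in $M_K$ with the same side lengths. A comparison point for a point $a$ on a side $[u,v]$ (where $u\ll v$) is the point $\bar a$ of the side $[\bar u,\bar v]$ with $\bar\tau(\bar u,\bar a)=\tau(u,a)$. The triangle satisfies the timelike curvature bound from above by $K$ if $\tau(a,b)\ge\bar\tau(\bar a,\bar b)$ for all points $a,b$ of the triangle and corresponding comparison points $\bar a,\bar b$ in its comparison triangle in $M_K$, which is unique up to isometry. **Lemma (Gluing lemma for timelike triangles, case I).** Let $X$ be a Lorentzian pre-length space and let $U\subseteq X$ be such that $\tau|_{U\times U}$ is finite and continuous and any $x,y\in U$ with $x\ll y$ are joined by a $\tau$-realizing causal curve contained in $U$. Let $K\in\mathbb R$ and let $T_3=\Delta(x,y,z)$ be a timelike triangle in $U$ that satisfies the size bounds for $M_K$. Let $p\in[x,z]$ be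 such that $x\ll p\ll z$ and either $p\ll y$ or $y\ll p$, and choose a geodesic segment in $U$ between $p$ and $y$. Let $T_1$ and $T_2$ be the two resulting timelike triangles sharing this segment, that is, $T_1=\Delta(x,p,y)$ and $T_2=\Delta(p,y,z)$ if $p\ll y$, and $T_1=\Delta(x,y,p)$ and $T_2=\Delta(y,p,z)$ if $y\ll p$; their other sides are $[x,y]$, $[y,z]$ and the two parts $[x,p]$, $[p,z]$ of $[x,z]$. If $T_1$ and $T_2$ satisfy the timelike curvature bound from above by $K$, then $T_3$ has a comparison triangle in $M_K$ and satisfies the timelike curvature bound from above by $K$. -/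

import Mathlib

open scoped ENNReal

/-- A Lorentzian pre-length space `(X, d, ≪, ≤, τ)`. The metric `d` is the ambient extended metric
of `X`, `ll` is the timelike relation `≪`, `le` is the causal relation `≤`, and `τ` is the time
separation function with values in `[0, ∞]`. -/
structure LorentzianPreLengthSpace (X : Type*) [EMetricSpace X] where
  ll : X → X → Prop
  le : X → X → Prop
  τ : X → X → ℝ≥0∞
  le_refl : ∀ x, le x x
  le_trans : ∀ x y z, le x y → le y z → le x z
  ll_trans : ∀ x y z, ll x y → ll y z → ll x z
  le_of_ll : ∀ x y, ll x y → le x y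
  lowerSemicontinuous_τ : LowerSemicontinuous (fun q : X × X => τ q.1 q.2)
  reverse_triangle : ∀ x y z, le x y → le y z → τ x y + τ y z ≤ τ x z
  τ_pos_iff : ∀ x y, 0 < τ x y ↔ ll x y

/-- Three vertices together with three sets of points, the sides: `s₁₂` belongs to the pair
`v₁, v₂`, and so on. -/
structure Triangle (X : Type*) where
  v₁ : X
  v₂ : X
  v₃ : X
  s₁₂ : Set X
  s₂₃ : Set X
  s₁₃ : Set X

/-! ### The model spaces -/

/-- The underlying set of the two-dimensional, simply connected Lorentzian model space `M_K` of
constant curvature `K`, in global conformal coordinates `(t, x)`, `t` being the time coordinate: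
* `K = 0`: the Minkowski plane, all of `ℝ²` with the metric `-dt² + dx²`;
* `K > 0`: (the universal cover of) de Sitter space, the strip `|t| < π/2` with the metric
  `(1 / K) (cos t)⁻² (-dt² + dx²)`;
* `K < 0`: the universal cover of anti-de Sitter space, the strip `|x| < π/2` with the metric
  `(1 / (-K)) (cos x)⁻² (-dt² + dx²)`. -/
@[ext]
structure ModelSpace (K : ℝ) where
  t : ℝ
  x : ℝ
  abs_t_lt : 0 < K → |t| < Real.pi / 2
  abs_x_lt : K < 0 → |x| < Real.pi / 2

namespace ModelSpace

variable {K : ℝ}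

/-- The timelike relation of `M_K`. The metric is conformal to `-dt² + dx²` on a convex domain, so
this is the timelike relation of the Minkowski plane, restricted to the domain. -/
def ll (u v : ModelSpace K) : Prop := |v.x - u.x| < v.t - u.t

/-- The causal relation of `M_K`. -/
def le (u v : ModelSpace K) : Prop := |v.x - u.x| ≤ v.t - u.t

/-- The (covering) map from the coordinates of de Sitter space to the quadric
`-X₀² + X₁² + X₂² = 1` in `ℝ³`. -/
noncomputable def deSitterPos (u : ModelSpace K) : Fin 3 → ℝ :=
  ![Real.tan u.t, Real.cos u.x / Real.cos u.t, Real.sin u.x / Real.cos u.t]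

/-- The bilinear form `-X₀Y₀ + X₁Y₁ + X₂Y₂`. -/
def deSitterForm (X Y : Fin 3 → ℝ) : ℝ := -(X 0 * Y 0) + X 1 * Y 1 + X 2 * Y 2

/-- The covering map from the coordinates of anti-de Sitter space to the quadric
`-X₀² - X₁² + X₂² = -1` in `ℝ³`. -/
noncomputable def antiDeSitterPos (u : ModelSpace K) : Fin 3 → ℝ :=
  ![Real.cos u.t / Real.cos u.x, Real.sin u.t / Real.cos u.x, Real.tan u.x]

/-- The bilinear form `-X₀Y₀ - X₁Y₁ + X₂Y₂`. -/
def antiDeSitterForm (X Y : Fin 3 → ℝ) : ℝ := -(X 0 * Y 0) - X 1 * Y 1 + X 2 * Y 2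

open Classical in
/-- The time separation of `M_K`. It vanishes on pairs of points that are not timelike related;
for `u ≪ v` it is
* `K = 0`: `√(Δt² - Δx²)`;
* `K > 0`: `(1 / √K) arcosh ⟨X, Y⟩`, with `X`, `Y` the positions on the de Sitter quadric;
* `K < 0`: `(1 / √(-K)) arccos (-⟨X, Y⟩)`, with `X`, `Y` the positions on the anti-de Sitter
  quadric, as long as `v` lies in the closure of the set of those points in the future of `u`
  that are reached from `u` by timelike geodesics of length less than `π / √(-K)`, that is, as
  long as `Δt + |x(u) + x(v)| ≤ π`. For all later `v` there are timelike curves of arbitrarily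
  large length from `u` to `v` (running close to the conformal boundary), so the value is `∞`. -/
noncomputable def τ (u v : ModelSpace K) : ℝ≥0∞ :=
  if ¬ ll u v then 0
  else if K = 0 then
    ENNReal.ofReal (Real.sqrt ((v.t - u.t) ^ 2 - (v.x - u.x) ^ 2))
  else if 0 < K then
    ENNReal.ofReal (Real.arcosh (deSitterForm u.deSitterPos v.deSitterPos) / Real.sqrt K)
  else if v.t - u.t + |u.x + v.x| ≤ Real.pi then
    ENNReal.ofReal
      (Real.arccos (-antiDeSitterForm u.antiDeSitterPos v.antiDeSitterPos) / Real.sqrt (-K))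
  else ⊤

/-- The geodesic segment `[u, v]` in `M_K` between timelike related points: the points causally
between `u` and `v` at which the reverse triangle inequality is an equality. -/
def segment (u v : ModelSpace K) : Set (ModelSpace K) :=
  {w | le u w ∧ le w v ∧ τ u w + τ w v = τ u v}

end ModelSpace

/-- The vertices of a triangle in `M_K`; its sides are the geodesic segments between them. -/
structure ModelTriangle (K : ℝ) where
  v₁ : ModelSpace K
  v₂ : ModelSpace K
  v₃ : ModelSpace K

/-! ### Curves and triangles in a Lorentzian pre-length space -/

namespace LorentzianPreLengthSpace

variable {X : Type*} [EMetricSpace X] (L : LorentzianPreLengthSpace X)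

/-- `γ` is a future-directed causal curve on `[a, b]`. -/
def IsCausalCurve (γ : ℝ → X) (a b : ℝ) : Prop :=
  LocallyLipschitzOn (Set.Icc a b) γ ∧
    ∀ s ∈ Set.Icc a b, ∀ t ∈ Set.Icc a b, s < t → L.le (γ s) (γ t)

/-- The `τ`-length of `γ` on `[a, b]`: the infimum of `∑ τ (γ tᵢ) (γ tᵢ₊₁)` over all partitions
`a = t₀ < t₁ < ⋯ < tₙ₊₁ = b`. -/
noncomputable def length (γ : ℝ → X) (a b : ℝ) : ℝ≥0∞ :=
  ⨅ (n : ℕ) (t : Fin (n + 2) → ℝ) (_ : StrictMono t) (_ : t 0 = a)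
    (_ : t (Fin.last (n + 1)) = b),
    ∑ i : Fin (n + 1), L.τ (γ (t i.castSucc)) (γ (t i.succ))

/-- `γ`, on `[a, b]`, is a `τ`-realizing causal curve from `x` to `y` that is contained in `U`. -/
def IsRealizing (U : Set X) (x y : X) (γ : ℝ → X) (a b : ℝ) : Prop :=
  a < b ∧ L.IsCausalCurve γ a b ∧ γ a = x ∧ γ b = y ∧ L.length γ a b = L.τ x y ∧
    ∀ s ∈ Set.Icc a b, γ s ∈ U

/-- `S` is a geodesic segment from `x` to `y` in `U`: the image of a `τ`-realizing causal curve
from `x` to `y` that is contained in `U`. -/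
def IsSegment (U : Set X) (x y : X) (S : Set X) : Prop :=
  ∃ (γ : ℝ → X) (a b : ℝ), L.IsRealizing U x y γ a b ∧ S = γ '' Set.Icc a b

/-- `τ` is finite and continuous on `U × U`. -/
def FiniteContinuousOn (U : Set X) : Prop :=
  (∀ x ∈ U, ∀ y ∈ U, L.τ x y ≠ ⊤) ∧ ContinuousOn (fun q : X × X => L.τ q.1 q.2) (U ×ˢ U)

/-- Any two points `x ≪ y` of `U` are joined by a `τ`-realizing causal curve contained in `U`. -/
def HasRealizingCurves (U : Set X) : Prop :=
  ∀ x ∈ U, ∀ y ∈ U, L.ll x y → ∃ (γ : ℝ → X) (a b : ℝ), L.IsRealizing U x y γ a b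

/-- `T` is a timelike triangle in `U`: `v₁ ≪ v₂ ≪ v₃`, and the sides are geodesic segments in
`U`. -/
def IsTimelikeTriangle (U : Set X) (T : Triangle X) : Prop :=
  L.ll T.v₁ T.v₂ ∧ L.ll T.v₂ T.v₃ ∧
    L.IsSegment U T.v₁ T.v₂ T.s₁₂ ∧ L.IsSegment U T.v₂ T.v₃ T.s₂₃ ∧ L.IsSegment U T.v₁ T.v₃ T.s₁₃

/-- The size bounds for `M_K`: for `K < 0`, the longest side of a timelike triangle is shorter
than `π / √(-K)`; for `K ≥ 0` there is no restriction. -/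
def SatisfiesSizeBounds (K : ℝ) (T : Triangle X) : Prop :=
  K < 0 → L.τ T.v₁ T.v₃ < ENNReal.ofReal (Real.pi / Real.sqrt (-K))

/-- `M` is a comparison triangle of `T` in `M_K`: the side lengths agree. -/
def IsComparisonTriangle {K : ℝ} (T : Triangle X) (M : ModelTriangle K) : Prop :=
  M.v₁.τ M.v₂ = L.τ T.v₁ T.v₂ ∧ M.v₂.τ M.v₃ = L.τ T.v₂ T.v₃ ∧ M.v₁.τ M.v₃ = L.τ T.v₁ T.v₃

/-- `w` is a comparison point in `M` for the point `a` of `T`: it lies on the side of `M` that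
corresponds to a side of `T` containing `a`, at the same time separation from the earlier endpoint
of that side (hence also from the later one). -/
def IsComparisonPoint {K : ℝ} (T : Triangle X) (M : ModelTriangle K) (a : X) (w : ModelSpace K) :
    Prop :=
  (a ∈ T.s₁₂ ∧ w ∈ M.v₁.segment M.v₂ ∧ M.v₁.τ w = L.τ T.v₁ a) ∨
  (a ∈ T.s₂₃ ∧ w ∈ M.v₂.segment M.v₃ ∧ M.v₂.τ w = L.τ T.v₂ a) ∨
  (a ∈ T.s₁₃ ∧ w ∈ M.v₁.segment M.v₃ ∧ M.v₁.τ w = L.τ T.v₁ a)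

/-- The upper timelike curvature bound for the triangle `T` with comparison triangle `M`:
`τ(a, b) ≥ τ(a', b')` for all points `a, b` of `T` and comparison points `a', b'` of theirs. -/
def UpperBound {K : ℝ} (T : Triangle X) (M : ModelTriangle K) : Prop :=
  ∀ (a b : X) (a' b' : ModelSpace K), L.IsComparisonPoint T M a a' → L.IsComparisonPoint T M b b' →
    a'.τ b' ≤ L.τ a b

/-- `T₁` and `T₂` are the two timelike triangles in `U` into which `T = Δ(x, y, z)` is divided by
the point `p` of its longest side `[x, z]`, where `x ≪ p ≪ z`, and a geodesic segment `S` in `U`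
between `p` and `y`:
either `p ≪ y`, `T₁ = Δ(x, p, y)` and `T₂ = Δ(p, y, z)`,
or `y ≪ p`, `T₁ = Δ(x, y, p)` and `T₂ = Δ(y, p, z)`.
The side `[x, z]` is cut at `p` into the sides `[x, p]` and `[p, z]`, the sides `[x, y]` and
`[y, z]` are kept, and the side `S` is common to `T₁` and `T₂`. -/
def IsSubdivision (U : Set X) (T : Triangle X) (p : X) (T₁ T₂ : Triangle X) : Prop :=
  ∃ (γ : ℝ → X) (a b s : ℝ) (S : Set X),
    L.IsRealizing U T.v₁ T.v₃ γ a b ∧ T.s₁₃ = γ '' Set.Icc a b ∧ s ∈ Set.Icc a b ∧ γ s = p ∧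
    L.ll T.v₁ p ∧ L.ll p T.v₃ ∧
    ((L.ll p T.v₂ ∧ L.IsSegment U p T.v₂ S ∧
        T₁ = { v₁ := T.v₁, v₂ := p, v₃ := T.v₂,
               s₁₂ := γ '' Set.Icc a s, s₂₃ := S, s₁₃ := T.s₁₂ } ∧
        T₂ = { v₁ := p, v₂ := T.v₂, v₃ := T.v₃,
               s₁₂ := S, s₂₃ := T.s₂₃, s₁₃ := γ '' Set.Icc s b }) ∨
      (L.ll T.v₂ p ∧ L.IsSegment U T.v₂ p S ∧
        T₁ = { v₁ := T.v₁, v₂ := T.v₂, v₃ := p,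
               s₁₂ := T.s₁₂, s₂₃ := S, s₁₃ := γ '' Set.Icc a s } ∧
        T₂ = { v₁ := T.v₂, v₂ := p, v₃ := T.v₃,
               s₁₂ := S, s₂₃ := γ '' Set.Icc s b, s₁₃ := T.s₂₃ }))

end LorentzianPreLengthSpace

/-! Let `md K` be the modified distance, the primitive of the generalized sine `sn K`. On pairs of
points of `M_K` there is an analytic function `F` equal to `md K` of the time separation on timelike
pairs (below the diameter). Along a timelike geodesic parametrized by length, `F` from a fixed point
solves `f'' = K f + 1`, so its values are given by Stewart's formula `stew`, which is monotone in
the two boundary values. The comparison value for two points on different sides of a triangle is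
therefore `stew` applied twice to the side lengths, and the curvature bound becomes the purely
numerical `TimeSep.TriBound`: if `md K d` is at most this value, then `d` is at most the time
separation of the two points. `Comparison.triBound` and `Comparison.upperBound` translate between
the two forms; the size bounds exclude winding around the model space.

Suppose `p ≪ y`. For `c` on `[p, y]` near `p`, the two curvature bounds estimate the time
separations from `x` to `c` and from `c` to `z` from below, to first order by the comparison angles
at `p`. Since their sum is at most that from `x` to `z`, the angle of `T₁` (between `[p, y]` and the
continuation of `[x, p]`) is at most the angle of `T₂` (`Glue.angle`). By Alexandrov's lemma, in the
form `Sizes.long_le_side`, the comparison value of `p, y` in `T₃` is then at most the true one. So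
comparison values only grow on passing from `T₃` to `T₁` or `T₂` (`Sizes.long_le_first`,
`Sizes.long_le_last`), which settles pairs of points on sides of the same small triangle.

For the other pairs a planar figure is built in which the far point lies beyond the small triangle
(`QPt.exists_hinge`, `QPt.exists_overlay`; the angle hypotheses come from `Sizes.hinge_first` and
`Sizes.hinge_last`). The model segment of length `d` between the two points then crosses the common
side or the adjacent part of the long side, and is cut into pieces `u` and `d - u`. The
corresponding point `c` of `X` satisfies the lower bounds `u` and `d - u`, and the reverse triangle
inequality adds them. If a piece has length zero, the bounds give no causal relation with `c`, and a
limit of neighbouring points takes over (`TimeSep.Side.add_le_of_stew`).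

The case `y ≪ p` is the time reversal of the case `p ≪ y` (`triBound_of_ll`). -/

namespace LorentzModel

/-! ### Generalized trigonometry and Stewart's formula. -/

/-- The generalized sine: the solution of `s'' = K s`, `s 0 = 0`, `s' 0 = 1`. -/
noncomputable def sn (K s : ℝ) : ℝ :=
  if K = 0 then s else if 0 < K then Real.sinh (√K * s) / √K else Real.sin (√(-K) * s) / √(-K)

/-- The modified distance function: the primitive of `sn K` that vanishes at `0`. -/
noncomputable def md (K s : ℝ) : ℝ :=
  if K = 0 then s ^ 2 / 2 else if 0 < K then (Real.cosh (√K * s) - 1) / K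
  else (1 - Real.cos (√(-K) * s)) / (-K)

/-- The lengths that are shorter than the diameter of `M_K`. -/
def Good (K s : ℝ) : Prop := K < 0 → s < Real.pi / √(-K)

variable {K : ℝ}

lemma curvature_cases (K : ℝ) : K = 0 ∨ (∃ k, 0 < k ∧ K = k ^ 2) ∨ ∃ k, 0 < k ∧ K = -k ^ 2 := by
  rcases lt_trichotomy K 0 with h | h | h
  · exact Or.inr (Or.inr ⟨√(-K), Real.sqrt_pos.2 (by linarith), by
      rw [Real.sq_sqrt (by linarith)]; ring⟩)
  · exact Or.inl h
  · exact Or.inr (Or.inl ⟨√K, Real.sqrt_pos.2 h, by rw [Real.sq_sqrt h.le]⟩)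

lemma sn_zero_left (s : ℝ) : sn 0 s = s := by simp [sn]

lemma md_zero_left (s : ℝ) : md 0 s = s ^ 2 / 2 := by simp [md]

lemma sn_sq_left {k : ℝ} (hk : 0 < k) (s : ℝ) : sn (k ^ 2) s = Real.sinh (k * s) / k := by
  have h : 0 < k ^ 2 := by positivity
  rw [sn, if_neg h.ne', if_pos h, Real.sqrt_sq hk.le]

lemma md_sq_left {k : ℝ} (hk : 0 < k) (s : ℝ) : md (k ^ 2) s = (Real.cosh (k * s) - 1) / k ^ 2 := by
  have h : 0 < k ^ 2 := by positivity
  rw [md, if_neg h.ne', if_pos h, Real.sqrt_sq hk.le]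

lemma sn_neg_sq_left {k : ℝ} (hk : 0 < k) (s : ℝ) : sn (-k ^ 2) s = Real.sin (k * s) / k := by
  have h : 0 < k ^ 2 := by positivity
  rw [sn, if_neg (by linarith), if_neg (by linarith), neg_neg, Real.sqrt_sq hk.le]

lemma md_neg_sq_left {k : ℝ} (hk : 0 < k) (s : ℝ) :
    md (-k ^ 2) s = (1 - Real.cos (k * s)) / k ^ 2 := by
  have h : 0 < k ^ 2 := by positivity
  rw [md, if_neg (by linarith), if_neg (by linarith), neg_neg, Real.sqrt_sq hk.le]

lemma good_neg_sq {k : ℝ} (hk : 0 < k) {s : ℝ} : Good (-k ^ 2) s ↔ k * s < Real.pi := by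
  have h : 0 < k ^ 2 := by positivity
  rw [Good, neg_neg, Real.sqrt_sq hk.le, lt_div_iff₀ hk, mul_comm]
  exact ⟨fun H => H (by linarith), fun H _ => H⟩

lemma Good.mono {s t : ℝ} (h : Good K t) (hst : s ≤ t) : Good K s :=
  fun hK => hst.trans_lt (h hK)

@[simp] lemma sn_zero (K : ℝ) : sn K 0 = 0 := by simp [sn]

@[simp] lemma md_zero (K : ℝ) : md K 0 = 0 := by simp [md]

lemma sn_neg (K s : ℝ) : sn K (-s) = -sn K s := by
  unfold sn; split_ifs <;> simp [neg_div]

lemma md_neg (K s : ℝ) : md K (-s) = md K s := by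
  unfold md; split_ifs <;> simp

lemma md_abs (K s : ℝ) : md K |s| = md K s := by
  rcases abs_cases s with ⟨h, -⟩ | ⟨h, -⟩ <;> rw [h]
  exact md_neg K s

lemma md_sub_comm (K s t : ℝ) : md K (s - t) = md K (t - s) := by
  rw [← md_neg, neg_sub]

/-- `1 + K * md K s` is the derivative of `sn K`, the generalized cosine. Writing it through `md`
lets all curvatures share one set of addition theorems, and everything after them is polynomial
algebra. -/
lemma sn_add (K s t : ℝ) :
    sn K (s + t) = sn K s * (1 + K * md K t) + (1 + K * md K s) * sn K t := by
  rcases curvature_cases K with rfl | ⟨k, hk, rfl⟩ | ⟨k, hk, rfl⟩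
  · simp [sn_zero_left]
  · simp only [sn_sq_left hk, md_sq_left hk, mul_add, Real.sinh_add]
    field_simp; ring
  · simp only [sn_neg_sq_left hk, md_neg_sq_left hk, mul_add, Real.sin_add]
    field_simp; ring

lemma md_add (K s t : ℝ) :
    md K (s + t) = md K s + md K t + K * md K s * md K t + sn K s * sn K t := by
  rcases curvature_cases K with rfl | ⟨k, hk, rfl⟩ | ⟨k, hk, rfl⟩
  · simp only [sn_zero_left, md_zero_left]; ring
  · simp only [sn_sq_left hk, md_sq_left hk, mul_add, Real.cosh_add]
    field_simp; ring
  · simp only [sn_neg_sq_left hk, md_neg_sq_left hk, mul_add, Real.cos_add]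
    field_simp; ring

lemma sn_sub (K s t : ℝ) :
    sn K (s - t) = sn K s * (1 + K * md K t) - (1 + K * md K s) * sn K t := by
  rw [sub_eq_add_neg, sn_add, md_neg, sn_neg]; ring

lemma md_sub (K s t : ℝ) :
    md K (s - t) = md K s + md K t + K * md K s * md K t - sn K s * sn K t := by
  rw [sub_eq_add_neg, md_add, md_neg, sn_neg]; ring

lemma sn_sq (K s : ℝ) : sn K s ^ 2 = 2 * md K s + K * md K s ^ 2 := by
  have := md_sub K s s
  rw [sub_self, md_zero] at this
  linear_combination this

lemma sn_pos {s : ℝ} (hs : 0 < s) (hg : Good K s) : 0 < sn K s := by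
  rcases curvature_cases K with rfl | ⟨k, hk, rfl⟩ | ⟨k, hk, rfl⟩
  · simpa [sn_zero_left]
  · rw [sn_sq_left hk]; exact div_pos (Real.sinh_pos_iff.2 (by positivity)) hk
  · rw [sn_neg_sq_left hk]
    exact div_pos (Real.sin_pos_of_pos_of_lt_pi (by positivity) ((good_neg_sq hk).1 hg)) hk

lemma sn_nonneg {s : ℝ} (hs : 0 ≤ s) (hg : Good K s) : 0 ≤ sn K s := by
  rcases hs.eq_or_lt with rfl | h
  · simp
  · exact (sn_pos h hg).le

lemma hasDerivAt_md (K s : ℝ) : HasDerivAt (md K) (sn K s) s := by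
  have hid (k : ℝ) : HasDerivAt (fun s => k * s) k s := by
    simpa using (hasDerivAt_id' s).const_mul k
  rcases curvature_cases K with rfl | ⟨k, hk, rfl⟩ | ⟨k, hk, rfl⟩
  · have : md 0 = fun s => s ^ 2 / 2 := funext md_zero_left
    rw [this, sn_zero_left]
    exact ((hasDerivAt_pow 2 s).div_const 2).congr_deriv (by simp)
  · have : md (k ^ 2) = fun s => (Real.cosh (k * s) - 1) / k ^ 2 := funext (md_sq_left hk)
    rw [this, sn_sq_left hk]
    exact (((hid k).cosh.sub_const 1).div_const (k ^ 2)).congr_deriv (by field_simp)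
  · have : md (-k ^ 2) = fun s => (1 - Real.cos (k * s)) / k ^ 2 := funext (md_neg_sq_left hk)
    rw [this, sn_neg_sq_left hk]
    exact (((hid k).cos.const_sub 1).div_const (k ^ 2)).congr_deriv (by field_simp)

lemma hasDerivAt_sn (K s : ℝ) : HasDerivAt (sn K) (1 + K * md K s) s := by
  have hid (k : ℝ) : HasDerivAt (fun s => k * s) k s := by
    simpa using (hasDerivAt_id' s).const_mul k
  rcases curvature_cases K with rfl | ⟨k, hk, rfl⟩ | ⟨k, hk, rfl⟩
  · have : sn 0 = fun s => s := funext sn_zero_left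
    rw [this]; simpa using hasDerivAt_id' s
  · have : sn (k ^ 2) = fun s => Real.sinh (k * s) / k := funext (sn_sq_left hk)
    rw [this, md_sq_left hk]
    exact ((hid k).sinh.div_const k).congr_deriv (by field_simp; ring)
  · have : sn (-k ^ 2) = fun s => Real.sin (k * s) / k := funext (sn_neg_sq_left hk)
    rw [this, md_neg_sq_left hk]
    exact ((hid k).sin.div_const k).congr_deriv (by field_simp; ring)

lemma continuous_md (K : ℝ) : Continuous (md K) :=
  continuous_iff_continuousAt.2 fun s => (hasDerivAt_md K s).continuousAt

lemma continuous_sn (K : ℝ) : Continuous (sn K) :=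
  continuous_iff_continuousAt.2 fun s => (hasDerivAt_sn K s).continuousAt

lemma md_lt_md {s t : ℝ} (hs : 0 ≤ s) (hst : s < t) (ht : Good K t) : md K s < md K t := by
  have : StrictMonoOn (md K) (Set.Icc 0 t) := by
    refine strictMonoOn_of_deriv_pos (convex_Icc 0 t) (continuous_md K).continuousOn fun x hx => ?_
    rw [interior_Icc] at hx
    rw [(hasDerivAt_md K x).deriv]
    exact sn_pos hx.1 (ht.mono hx.2.le)
  exact this ⟨hs, hst.le⟩ ⟨hs.trans hst.le, le_rfl⟩ hst

lemma md_le_md {s t : ℝ} (hs : 0 ≤ s) (hst : s ≤ t) (ht : Good K t) : md K s ≤ md K t := by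
  rcases hst.eq_or_lt with rfl | h
  · rfl
  · exact (md_lt_md hs h ht).le

lemma le_of_md_le {s t : ℝ} (ht : 0 ≤ t) (hs : Good K s) (h : md K s ≤ md K t) : s ≤ t := by
  by_contra! hc
  exact absurd h (not_le.2 (md_lt_md ht hc hs))

lemma eq_of_md_eq {s t : ℝ} (hs : 0 ≤ s) (ht : 0 ≤ t) (hgs : Good K s) (hgt : Good K t)
    (h : md K s = md K t) : s = t :=
  le_antisymm (le_of_md_le ht hgs h.le) (le_of_md_le hs hgt h.ge)

lemma md_nonneg (K s : ℝ) : 0 ≤ md K s := by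
  rcases curvature_cases K with rfl | ⟨k, hk, rfl⟩ | ⟨k, hk, rfl⟩
  · rw [md_zero_left]; positivity
  · rw [md_sq_left hk]; exact div_nonneg (by linarith [Real.one_le_cosh (k * s)]) (by positivity)
  · rw [md_neg_sq_left hk]; exact div_nonneg (by linarith [Real.cos_le_one (k * s)]) (by positivity)

lemma md_pos {s : ℝ} (hs : 0 < s) (hg : Good K s) : 0 < md K s := by
  simpa using md_lt_md le_rfl hs hg

lemma exists_md_eq {f s : ℝ} (hs : 0 ≤ s) (hf : 0 ≤ f) (hfs : f ≤ md K s) :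
    ∃ d, 0 ≤ d ∧ d ≤ s ∧ md K d = f := by
  obtain ⟨d, hd, h⟩ := intermediate_value_Icc hs (continuous_md K).continuousOn
    (show f ∈ Set.Icc (md K 0) (md K s) from ⟨by simpa using hf, hfs⟩)
  exact ⟨d, hd.1, hd.2, h⟩

/-- Stewart's formula: the value at `s ∈ [0, l]` of the solution of `f'' = K f + 1` with boundary
values `f` and `g`. -/
noncomputable def stew (K l s f g : ℝ) : ℝ :=
  (sn K (l - s) * f + sn K s * g - (sn K (l - s) * md K s + sn K s * md K (l - s))) / sn K l

/-- Below the diameter the weights `sn K (l - s)` and `sn K s` are nonnegative. This monotonicity,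
played against the exact values of `stew_line`, is the source of nearly all model-space inequalities
below. -/
lemma stew_le_stew {l s f g f' g' : ℝ} (hs : 0 ≤ s) (hsl : s ≤ l) (hg : Good K l)
    (hf : f ≤ f') (hg' : g ≤ g') : stew K l s f g ≤ stew K l s f' g' := by
  have h1 := sn_nonneg hs (hg.mono hsl)
  have h2 := sn_nonneg (sub_nonneg.2 hsl) (hg.mono (by linarith))
  have h3 := sn_nonneg (hs.trans hsl) hg
  unfold stew
  gcongr

lemma stew_add_add (K l s f g f' g' : ℝ) :
    stew K l s (f + f') (g + g') =
      stew K l s f g + (sn K (l - s) * f' + sn K s * g') / sn K l := by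
  unfold stew; ring

/-- The function `s ↦ md K (c - s)` solves the same equation: it is the modified distance from a
point of the line itself. It represents degenerate triangles. -/
lemma stew_line {l : ℝ} (hl : 0 < l) (hg : Good K l) (c s : ℝ) :
    stew K l s (md K c) (md K (c - l)) = md K (c - s) := by
  have h := (sn_pos hl hg).ne'
  unfold stew
  rw [div_eq_iff h]
  simp only [md_sub, sn_sub]
  linear_combination sn K l * sn_sq K s

end LorentzModel

namespace LorentzModel

variable {K : ℝ}

@[simp] lemma stew_zero {l : ℝ} (hl : 0 < l) (hg : Good K l) (f g : ℝ) : stew K l 0 f g = f := by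
  have := (sn_pos hl hg).ne'
  simp [stew, this]

@[simp] lemma stew_self {l : ℝ} (hl : 0 < l) (hg : Good K l) (f g : ℝ) : stew K l l f g = g := by
  have := (sn_pos hl hg).ne'
  simp [stew, this]

lemma stew_rev (K l s f g : ℝ) : stew K l (l - s) f g = stew K l s g f := by
  simp only [stew, sub_sub_cancel]; ring

/-- The bracket on the left is the correction term in `stew`. This identity and `sn_md_add_mul` are
what is needed to see that a Stewart combination of two points of the quadric lies on the quadric
again. -/
lemma sn_mul_add_md (K s t : ℝ) :
    K * (sn K t * md K s + sn K s * md K t) = sn K (s + t) - sn K t - sn K s := by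
  rw [sn_add]; ring

lemma sn_md_add_mul (K s t : ℝ) :
    (sn K t * md K s + sn K s * md K t) * (sn K (s + t) + sn K t + sn K s) =
      2 * sn K s * sn K t * md K (s + t) := by
  rw [sn_add, md_add]
  linear_combination -sn K s ^ 2 * sn_sq K t - sn K t ^ 2 * sn_sq K s

/-! ### Points, geodesics and polar coordinates on the quadric. -/

/-- A point of the quadric `A² - B² = 2 w + K w²`; it contains `M_K` for every `K`, with `w` the
modified distance from the base point. -/
@[ext] structure QPt (K : ℝ) where
  w : ℝ
  A : ℝ
  B : ℝ
  eq : A ^ 2 - B ^ 2 = 2 * w + K * w ^ 2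

namespace QPt

/-- The modified (signed, squared) distance of two points of the quadric. -/
def F (a b : QPt K) : ℝ := a.w + b.w + K * a.w * b.w - a.A * b.A + a.B * b.B

lemma F_comm (a b : QPt K) : F a b = F b a := by unfold F; ring

lemma F_self (a : QPt K) : F a a = 0 := by unfold F; linear_combination -a.eq

/-- `c` is the point at distance `s` from `a` on the geodesic of length `l` from `a` to `b`. -/
def IsPt (a b : QPt K) (l s : ℝ) (c : QPt K) : Prop :=
  ∀ x : QPt K, F x c = stew K l s (F x a) (F x b)

section IsPt

variable {a b c : QPt K} {l s : ℝ}

lemma IsPt.F_left (h : IsPt a b l s c) (hl : 0 < l) (hg : Good K l) (hab : F a b = md K l) :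
    F a c = md K s := by
  rw [h, F_self, hab]
  have := stew_line hl hg 0 s
  rwa [md_zero, zero_sub, md_neg, zero_sub, md_neg] at this

lemma IsPt.F_right (h : IsPt a b l s c) (hl : 0 < l) (hg : Good K l) (hab : F a b = md K l) :
    F b c = md K (l - s) := by
  rw [h, F_self, F_comm, hab]
  have := stew_line hl hg l s
  rwa [sub_self, md_zero] at this

/-- In the homogeneous coordinates `(1 + K w, A, B)` the point is a linear combination of the
endpoints with weights `sn K (l - s) / sn K l` and `sn K s / sn K l`. The coordinate `w` alone also
carries the Stewart correction, which keeps the construction meaningful for `K = 0`. -/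
lemma exists_isPt (hl : 0 < l) (hg : Good K l) (hab : F a b = md K l) (s : ℝ) :
    ∃ c : QPt K, IsPt a b l s c ∧
      1 + K * c.w = (sn K (l - s) * (1 + K * a.w) + sn K s * (1 + K * b.w)) / sn K l ∧
      c.A = (sn K (l - s) * a.A + sn K s * b.A) / sn K l ∧
      c.B = (sn K (l - s) * a.B + sn K s * b.B) / sn K l := by
  have hn := (sn_pos hl hg).ne'
  have h1 := sn_mul_add_md K s (l - s)
  have h2 := sn_md_add_mul K s (l - s)
  rw [add_sub_cancel] at h1 h2
  rw [← hab] at h2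
  obtain ⟨C, hC⟩ : ∃ C, C = sn K (l - s) * md K s + sn K s * md K (l - s) := ⟨_, rfl⟩
  rw [← hC] at h1 h2
  refine ⟨⟨(sn K (l - s) * a.w + sn K s * b.w - C) / sn K l,
    (sn K (l - s) * a.A + sn K s * b.A) / sn K l,
    (sn K (l - s) * a.B + sn K s * b.B) / sn K l, ?_⟩, fun x => ?_, ?_, rfl, rfl⟩
  · field_simp
    unfold F at h2
    linear_combination sn K (l - s) ^ 2 * a.eq + sn K s ^ 2 * b.eq + h2 +
      (2 * (sn K (l - s) * a.w + sn K s * b.w) - C) * h1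
  · simp only [F, stew, ← hC]
    rw [eq_div_iff hn]
    field_simp
    linear_combination (-x.w) * h1
  · field_simp
    linear_combination - h1

/-- A point is determined by the values of `F` with respect to the endpoints of a geodesic. -/
lemma eq_of_F_eq (hl : 0 < l) (hg : Good K l) (hab : F a b = md K l) {c c' : QPt K}
    (h1 : F a c = F a c') (h2 : F b c = F b c') (h3 : F c c' = 0) : c = c' := by
  have hn := pow_pos (sn_pos hl hg) 2
  rw [sn_sq, ← hab] at hn
  obtain ⟨x, hx⟩ : ∃ x, x = c.w - c'.w := ⟨_, rfl⟩
  obtain ⟨y, hy⟩ : ∃ y, y = c.A - c'.A := ⟨_, rfl⟩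
  obtain ⟨z, hz⟩ : ∃ z, z = c.B - c'.B := ⟨_, rfl⟩
  have e1 : (1 + K * a.w) * x - a.A * y + a.B * z = 0 := by
    unfold F at h1; rw [hx, hy, hz]; linear_combination h1
  have e2 : (1 + K * b.w) * x - b.A * y + b.B * z = 0 := by
    unfold F at h2; rw [hx, hy, hz]; linear_combination h2
  have e3 : y ^ 2 - z ^ 2 - K * x ^ 2 = 0 := by
    unfold F at h3; rw [hx, hy, hz]; linear_combination 2 * h3 + c.eq + c'.eq
  -- `(m0, m1, m2)` is the cross product of the homogeneous vectors of `a` and `b`. The difference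
  -- `(x, y, z)` is orthogonal to both, hence parallel to it; it is null by `e3`, while the cross
  -- product has norm `-(sn K l)²`, which is nonzero. So the difference vanishes.
  obtain ⟨m0, hm0⟩ : ∃ m, m = -(a.A * b.B) + a.B * b.A := ⟨_, rfl⟩
  obtain ⟨m1, hm1⟩ : ∃ m, m = a.B * (1 + K * b.w) - (1 + K * a.w) * b.B := ⟨_, rfl⟩
  obtain ⟨m2, hm2⟩ : ∃ m, m = -((1 + K * a.w) * b.A) + a.A * (1 + K * b.w) := ⟨_, rfl⟩
  have hM : m1 ^ 2 - m2 ^ 2 - K * m0 ^ 2 = -(2 * F a b + K * F a b ^ 2) := by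
    rw [hm0, hm1, hm2]; unfold F
    linear_combination (-(1 + K * b.w) ^ 2 + K * (b.A ^ 2 - b.B ^ 2)) * a.eq +
      (-(1 + K * a.w) ^ 2 + K * (2 * a.w + K * a.w ^ 2)) * b.eq
  have h4 : m0 * y = m1 * x := by rw [hm0, hm1]; linear_combination b.B * e1 - a.B * e2
  have h5 : m0 * z = m2 * x := by rw [hm0, hm2]; linear_combination b.A * e1 - a.A * e2
  have h6 : m1 * z = m2 * y := by
    rw [hm1, hm2]; linear_combination (1 + K * b.w) * e1 - (1 + K * a.w) * e2
  have key : ∀ t : ℝ, t ^ 2 * (2 * F a b + K * F a b ^ 2) = 0 → t = 0 := fun t ht => by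
    rcases mul_eq_zero.1 ht with h | h
    · simpa using h
    · exact absurd h hn.ne'
  have hx0 : x = 0 := key x (by
    linear_combination x ^ 2 * hM - m0 ^ 2 * e3 + (m1 * x + m0 * y) * h4 - (m2 * x + m0 * z) * h5)
  have hy0 : y = 0 := key y (by
    linear_combination y ^ 2 * hM - m1 ^ 2 * e3 + K * (m1 * x + m0 * y) * h4 -
      (m1 * z + m2 * y) * h6)
  have hz0 : z = 0 := key z (by
    linear_combination z ^ 2 * hM - m2 ^ 2 * e3 + K * (m2 * x + m0 * z) * h5 -
      (m1 * z + m2 * y) * h6)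
  ext <;> linarith

/-- Rigidity in the reverse triangle inequality: the Stewart point has the same values from both
endpoints, and its formula gives `F = md K 0 = 0` against `c`, so `eq_of_F_eq` identifies the two.
-/
lemma isPt_of_F (hl : 0 < l) (hg : Good K l) (hab : F a b = md K l)
    (h1 : F a c = md K s) (h2 : F b c = md K (l - s)) : IsPt a b l s c := by
  obtain ⟨c', hc', -⟩ := exists_isPt hl hg hab s
  have : c = c' := by
    refine eq_of_F_eq hl hg hab (by rw [h1, hc'.F_left hl hg hab])
      (by rw [h2, hc'.F_right hl hg hab]) ?_
    rw [hc', F_comm, h1, F_comm, h2, md_sub_comm]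
    have := stew_line hl hg s s
    simpa using this
  rwa [this]

end IsPt

/-- The vector identity `x a + y b = z c + t d` for points in homogeneous coordinates. -/
def Rel (x : ℝ) (a : QPt K) (y : ℝ) (b : QPt K) (z : ℝ) (c : QPt K) (t : ℝ) (d : QPt K) : Prop :=
  x * (1 + K * a.w) + y * (1 + K * b.w) = z * (1 + K * c.w) + t * (1 + K * d.w) ∧
    x * a.A + y * b.A = z * c.A + t * d.A ∧ x * a.B + y * b.B = z * c.B + t * d.B

/-- By the intermediate value theorem, any nonnegative weights that do not both vanish are, up to a
positive factor, those of a point of the segment. -/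
lemma exists_coeff {x y d : ℝ} (hx : 0 ≤ x) (hy : 0 ≤ y) (hxy : 0 < x + y) (hd : 0 < d)
    (hg : Good K d) : ∃ u t, 0 ≤ u ∧ u ≤ d ∧ 0 < t ∧ sn K (d - u) = t * x ∧ sn K u = t * y := by
  have hn := sn_pos hd hg
  have hc : Continuous fun u => x * sn K u - y * sn K (d - u) := by
    have := continuous_sn K
    fun_prop
  obtain ⟨u, hu, h0⟩ := intermediate_value_Icc hd.le hc.continuousOn
    (show (0 : ℝ) ∈ Set.Icc _ _ from ⟨by simp; positivity, by simp; positivity⟩)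
  simp only at h0
  have h1 : 0 ≤ sn K u := sn_nonneg hu.1 (hg.mono hu.2)
  have h2 : 0 ≤ sn K (d - u) := sn_nonneg (by linarith [hu.2]) (hg.mono (by linarith [hu.1]))
  have h3 : 0 < sn K u + sn K (d - u) := by
    rcases hu.1.eq_or_lt with h | h
    · rw [← h]; simpa using hn
    · linarith [sn_pos h (hg.mono hu.2)]
  refine ⟨u, (sn K u + sn K (d - u)) / (x + y), hu.1, hu.2, by positivity, ?_, ?_⟩
  · field_simp; linear_combination - h0
  · field_simp; linear_combination h0

/-- Homogeneous vectors are normalized, so positively proportional ones agree; this turns a relation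
between cones into an intersection point. -/
lemma norm_eq (c : QPt K) : (1 + K * c.w) ^ 2 - K * (c.A ^ 2 - c.B ^ 2) = 1 := by
  rw [c.eq]; ring

/-- Two geodesics whose cones meet intersect. -/
lemma exists_crossing {a b c d : QPt K} {x y z t l m : ℝ} (hl : 0 < l) (hgl : Good K l)
    (hab : F a b = md K l) (hm : 0 < m) (hgm : Good K m) (hcd : F c d = md K m)
    (hx : 0 ≤ x) (hy : 0 ≤ y) (hxy : 0 < x + y) (hz : 0 ≤ z) (ht : 0 ≤ t)
    (h : Rel x a y b z c t d) :
    ∃ u v e, 0 ≤ u ∧ u ≤ l ∧ 0 ≤ v ∧ v ≤ m ∧ IsPt a b l u e ∧ IsPt c d m v e := by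
  obtain ⟨u, k, hu0, hu1, hk, hk1, hk2⟩ := exists_coeff hx hy hxy hl hgl
  obtain ⟨e, he, he1, he2, he3⟩ := exists_isPt hl hgl hab u
  have hn := sn_pos hl hgl
  rw [hk1, hk2, eq_div_iff hn.ne'] at he1 he2 he3
  obtain ⟨r1, r2, r3⟩ := h
  have hzt : 0 < z + t := by
    by_contra! hc
    have hz0 : z = 0 := by linarith
    have ht0 : t = 0 := by linarith
    subst hz0 ht0
    have q1 : 1 + K * e.w = 0 :=
      (mul_eq_zero.1 (by linear_combination he1 + k * r1)).resolve_right hn.ne'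
    have q2 : e.A = 0 := (mul_eq_zero.1 (by linear_combination he2 + k * r2)).resolve_right hn.ne'
    have q3 : e.B = 0 := (mul_eq_zero.1 (by linear_combination he3 + k * r3)).resolve_right hn.ne'
    have := e.norm_eq
    rw [q1, q2, q3] at this
    norm_num at this
  obtain ⟨v, j, hv0, hv1, hj, hj1, hj2⟩ := exists_coeff hz ht hzt hm hgm
  obtain ⟨f, hf, hf1, hf2, hf3⟩ := exists_isPt hm hgm hcd v
  have hn' := sn_pos hm hgm
  rw [hj1, hj2, eq_div_iff hn'.ne'] at hf1 hf2 hf3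
  have g1 : (j * sn K l) * (1 + K * e.w) = (k * sn K m) * (1 + K * f.w) := by
    linear_combination j * he1 - k * hf1 + j * k * r1
  have g2 : (j * sn K l) * e.A = (k * sn K m) * f.A := by
    linear_combination j * he2 - k * hf2 + j * k * r2
  have g3 : (j * sn K l) * e.B = (k * sn K m) * f.B := by
    linear_combination j * he3 - k * hf3 + j * k * r3
  have hp : 0 < j * sn K l := mul_pos hj hn
  have hp' : 0 < k * sn K m := mul_pos hk hn'
  have hs1 : j * sn K l = k * sn K m := by
    generalize j * sn K l = p at *
    generalize k * sn K m = p' at *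
    have : p ^ 2 = p' ^ 2 := by
      linear_combination (-p ^ 2) * e.norm_eq + p' ^ 2 * f.norm_eq +
        (p * (1 + K * e.w) + p' * (1 + K * f.w)) * g1 - K * (p * e.A + p' * f.A) * g2 +
        K * (p * e.B + p' * f.B) * g3
    exact (sq_eq_sq₀ hp.le hp'.le).1 this
  rw [hs1] at g1 g2 g3
  replace g1 := mul_left_cancel₀ hp'.ne' g1
  replace g2 := mul_left_cancel₀ hp'.ne' g2
  replace g3 := mul_left_cancel₀ hp'.ne' g3
  have : e = f := by
    ext
    -- For `K = 0` the first homogeneous coordinate is constant, and `w` is recovered from the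
    -- equation of the quadric.
    · rcases eq_or_ne K 0 with rfl | hK
      · have q1 := e.eq
        have q2 := f.eq
        rw [g2, g3] at q1
        linarith
      · exact mul_left_cancel₀ hK (by linarith)
    · exact g2
    · exact g3
  exact ⟨u, v, e, hu0, hu1, hv0, hv1, he, this ▸ hf⟩

/-- The point with polar coordinates `(s, θ)` around the base point. -/
noncomputable def polar (K s θ : ℝ) : QPt K where
  w := md K s
  A := sn K s * Real.cosh θ
  B := sn K s * Real.sinh θ
  eq := by linear_combination sn_sq K s + sn K s ^ 2 * Real.cosh_sq θ

/-- The law of cosines for a hinge with both legs directed away from the base point, `θ - η` being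
the hyperbolic angle. -/
lemma F_polar (s t θ η : ℝ) :
    F (polar K s θ) (polar K t η) =
      md K (s - t) - sn K s * sn K t * (Real.cosh (θ - η) - 1) := by
  simp only [F, polar, md_sub, Real.cosh_sub]; ring

lemma F_polar_zero (t θ η : ℝ) : F (polar K 0 θ) (polar K t η) = md K t := by
  rw [F_polar]; simp [md_neg]

lemma F_polar_le {s t : ℝ} (θ η : ℝ) (hs : 0 ≤ sn K s) (ht : 0 ≤ sn K t) :
    F (polar K s θ) (polar K t η) ≤ md K (s - t) := by
  rw [F_polar]
  have := mul_nonneg (mul_nonneg hs ht) (sub_nonneg.2 (Real.one_le_cosh (θ - η)))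
  linarith

lemma isPt_polar {l : ℝ} (hl : 0 < l) (hg : Good K l) (s θ : ℝ) :
    IsPt (polar K 0 0) (polar K l θ) l s (polar K s θ) := by
  apply isPt_of_F hl hg (F_polar_zero _ _ _) (F_polar_zero _ _ _)
  simp [F_polar]

end QPt
end LorentzModel

/-! ### Planar configurations: how a segment leaves a triangle. -/

namespace LorentzModel
namespace QPt

variable {K : ℝ}

/-- A segment from a point `a` of the side `[o, y]` of a triangle `o, p, y` that leaves the triangle
across the line `o p` meets one of the other two sides. -/
lemma exists_exit {o p y a q : QPt K} {α β x t ρ ν r D d : ℝ}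
    (hr : 0 < r) (hgr : Good K r) (hop : F o p = md K r)
    (hD : 0 < D) (hgD : Good K D) (hpy : F p y = md K D)
    (hd : 0 < d) (hgd : Good K d) (haq : F a q = md K d)
    (hα : 0 ≤ α) (hβ : 0 ≤ β) (ha : Rel 1 a 0 a α o β y)
    (hx : 0 ≤ x) (ht : 0 ≤ t) (hxt : 0 < x + t) (hρ : 0 ≤ ρ) (h : Rel x a t q ρ p ν o) :
    ∃ u c, 0 ≤ u ∧ u ≤ d ∧ IsPt a q d u c ∧
      ((∃ σ, 0 ≤ σ ∧ σ ≤ D ∧ IsPt p y D σ c) ∨ ∃ s, 0 ≤ s ∧ s ≤ r ∧ IsPt o p r s c) := by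
  rcases le_or_gt 0 ν with hν | hν
  · obtain ⟨u, s, c, hu0, hu1, hs0, hs1, h1, h2⟩ :=
      exists_crossing (z := ν) (t := ρ) hd hgd haq hr hgr hop hx ht hxt hν hρ (by
        obtain ⟨h1, h2, h3⟩ := h
        exact ⟨by linarith, by linarith, by linarith⟩)
    exact ⟨u, c, hu0, hu1, h1, Or.inr ⟨s, hs0, hs1, h2⟩⟩
  -- For `ν < 0`, multiply the relation by `α` and replace `α o` by `a - β y`: all coefficients
  -- become nonnegative, and a point of `[a, q]` lies in the cone of `p` and `y`.
  · obtain ⟨a1, a2, a3⟩ := ha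
    obtain ⟨h1, h2, h3⟩ := h
    obtain ⟨u, σ, c, hu0, hu1, hs0, hs1, g1, g2⟩ :=
      exists_crossing (x := α * x - ν) (y := α * t) (z := α * ρ) (t := -ν * β)
        hd hgd haq hD hgD hpy (by nlinarith) (by positivity) (by nlinarith [mul_nonneg hα hx, mul_nonneg hα ht])
        (by positivity) (mul_nonneg (by linarith) hβ) (by
          refine ⟨?_, ?_, ?_⟩
          · linear_combination α * h1 - ν * a1
          · linear_combination α * h2 - ν * a2
          · linear_combination α * h3 - ν * a3)
    exact ⟨u, c, hu0, hu1, g1, Or.inl ⟨σ, hs0, hs1, g2⟩⟩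

lemma rel_polar {l s : ℝ} (hl : 0 < l) (hg : Good K l) (θ : ℝ) :
    Rel 1 (polar K s θ) 0 (polar K s θ) (sn K (l - s) / sn K l) (polar K 0 0)
      (sn K s / sn K l) (polar K l θ) := by
  have := (sn_pos hl hg).ne'
  refine ⟨?_, ?_, ?_⟩ <;> simp only [polar, sn_zero, md_zero, sn_sub] <;> field_simp <;> ring

/-- Coefficients of the intersection of the line through points in the directions `0` and `Θ` with
the ray in direction `θ`. -/
lemma exists_rel_polar {r sa sq θ Θ : ℝ} (hr : 0 < r) (hgr : Good K r) (hsa : 0 ≤ sa)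
    (hga : Good K sa) (hsq : 0 < sq) (hgq : Good K sq) (hθ : 0 ≤ θ) (hθΘ : θ ≤ Θ) :
    ∃ x t ρ ν, 0 ≤ x ∧ 0 ≤ t ∧ 0 < x + t ∧ 0 ≤ ρ ∧
      Rel x (polar K sa 0) t (polar K sq Θ) ρ (polar K r θ) ν (polar K 0 0) := by
  have hnr := sn_pos hr hgr
  have hna := sn_nonneg hsa hga
  have hnq := sn_pos hsq hgq
  have hsθ : 0 ≤ Real.sinh θ := Real.sinh_nonneg_iff.2 hθ
  have hsΘ : 0 ≤ Real.sinh Θ := Real.sinh_nonneg_iff.2 (hθ.trans hθΘ)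
  have hsd : 0 ≤ Real.sinh (Θ - θ) := Real.sinh_nonneg_iff.2 (by linarith)
  -- The weights cancel the component of the combination transverse to the direction `θ`. Both
  -- vanish only if `a` already lies on the line through `o` in that direction, and then `a` alone
  -- serves as the combination.
  by_cases htr : 0 < sn K sq * Real.sinh (Θ - θ) + sn K sa * Real.sinh θ
  · refine ⟨sn K sq * Real.sinh (Θ - θ), sn K sa * Real.sinh θ,
      sn K sa * sn K sq * Real.sinh Θ / sn K r, sn K sq * Real.sinh (Θ - θ) * (1 + K * md K sa) +
        sn K sa * Real.sinh θ * (1 + K * md K sq) -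
        sn K sa * sn K sq * Real.sinh Θ / sn K r * (1 + K * md K r), by positivity, by positivity,
      htr, by positivity, ⟨?_, ?_, ?_⟩⟩
    · simp [polar]
    · simp only [polar, sn_zero, Real.cosh_zero, Real.sinh_sub]; field_simp
      ring
    · simp only [polar, sn_zero, Real.sinh_zero, Real.sinh_sub]; field_simp
      ring
  · have h1 : sn K sq * Real.sinh (Θ - θ) = 0 := by
      linarith [mul_nonneg hnq.le hsd, mul_nonneg hna hsθ]
    have h2 : sn K sa * Real.sinh θ = 0 := by
      linarith [mul_nonneg hnq.le hsd, mul_nonneg hna hsθ]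
    refine ⟨1, 0, sn K sa / sn K r, 1 + K * md K sa - sn K sa / sn K r * (1 + K * md K r), by simp,
      le_rfl, by simp, by positivity, ⟨?_, ?_, ?_⟩⟩
    · simp [polar]
    · rcases mul_eq_zero.1 h2 with h | h
      · simp [polar, h]
      · rw [Real.sinh_eq_zero] at h
        simp [polar, h]; field_simp
    · rcases mul_eq_zero.1 h2 with h | h <;> simp [polar, h]

/-- The hinge with vertex `o`, sides `sy` and `r`, and opposite side of modified length `f`. -/
lemma exists_angle {sy r f : ℝ} (hy : 0 < sy) (hgy : Good K sy) (hr : 0 < r) (hgr : Good K r)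
    (hf : f ≤ md K (sy - r)) :
    ∃ θ, 0 ≤ θ ∧ F (polar K r θ) (polar K sy 0) = f ∧
      sn K sy * sn K r * (Real.cosh θ - 1) = md K (sy - r) - f := by
  have h1 := sn_pos hy hgy
  have h2 := sn_pos hr hgr
  have h3 : 0 ≤ (md K (sy - r) - f) / (sn K sy * sn K r) :=
    div_nonneg (by linarith) (by positivity)
  have h4 : sn K sy * sn K r * (Real.cosh (Real.arcosh (1 + (md K (sy - r) - f) / (sn K sy * sn K r))) - 1)
      = md K (sy - r) - f := by
    rw [Real.cosh_arcosh (by linarith)]; field_simp; ring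
  refine ⟨_, Real.arcosh_nonneg (by linarith), ?_, h4⟩
  rw [F_polar, sub_zero, md_sub_comm]; linear_combination -h4

lemma le_angle {θ Θ : ℝ} (hΘ : 0 ≤ Θ) (hθ : 0 ≤ θ) (h : Real.cosh θ - 1 ≤ Real.cosh Θ - 1) : θ ≤ Θ := by
  have := Real.cosh_le_cosh.1 (by linarith : Real.cosh θ ≤ Real.cosh Θ)
  rwa [abs_of_nonneg hθ, abs_of_nonneg hΘ] at this

/-- The hinge with vertex `o`, in which `q` lies beyond the triangle `o, p, y`: a segment from a
point `a` of `[o, y]` to `q` meets `[p, y]` or `[o, p]`. -/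
theorem exists_hinge {sy r D sq g sa d : ℝ} (hy : 0 < sy) (hgy : Good K sy)
    (hr : 0 < r) (hgr : Good K r) (hD : 0 < D) (hgD : Good K D) (hDle : md K D ≤ md K (sy - r))
    (hrq : r ≤ sq) (hgq : Good K sq) (hg : g ≤ md K (sy - sq))
    (hang : (md K (sy - r) - md K D) * sn K sq ≤ (md K (sy - sq) - g) * sn K r)
    (hsa : 0 ≤ sa) (hsay : sa ≤ sy) (hd : 0 < d) (hgd : Good K d)
    (hdeq : md K d = stew K sy sa (md K sq) g) :
    ∃ o y p q a c : QPt K, ∃ u, F o y = md K sy ∧ F o p = md K r ∧ F p y = md K D ∧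
      F o q = md K sq ∧ F q y = g ∧ F p q ≤ md K (sq - r) ∧ IsPt o y sy sa a ∧ F a q = md K d ∧
      0 ≤ u ∧ u ≤ d ∧ IsPt a q d u c ∧
      ((∃ σ, 0 ≤ σ ∧ σ ≤ D ∧ IsPt p y D σ c) ∨ ∃ s, 0 ≤ s ∧ s ≤ r ∧ IsPt o p r s c) := by
  have hsq : 0 < sq := hr.trans_le hrq
  have hny := sn_pos hy hgy
  have hnr := sn_pos hr hgr
  have hnq := sn_pos hsq hgq
  obtain ⟨θ, hθ, hpy, hθ'⟩ := exists_angle hy hgy hr hgr hDle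
  obtain ⟨Θ, hΘ, hqy, hΘ'⟩ := exists_angle hy hgy hsq hgq hg
  -- By the law of cosines `hang` compares `cosh θ - 1` with `cosh Θ - 1`, up to the common factor
  -- `sn K sy * sn K r * sn K sq`.
  have hle : θ ≤ Θ := by
    apply le_angle hΘ hθ
    rw [← hθ', ← hΘ'] at hang
    have : (sn K sy * sn K r * sn K sq) * (Real.cosh θ - 1) ≤
      (sn K sy * sn K r * sn K sq) * (Real.cosh Θ - 1) := by linarith
    exact le_of_mul_le_mul_left this (by positivity)
  have ha := isPt_polar hy hgy sa 0
  have haq : F (polar K sa 0) (polar K sq Θ) = md K d := by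
    rw [F_comm, ha, F_comm, F_polar_zero, hqy, hdeq]
  have hga : Good K sa := hgy.mono hsay
  obtain ⟨x, t, ρ, ν, hx, ht, hxt, hρ, hrel⟩ := exists_rel_polar hr hgr hsa hga hsq hgq hθ hle
  obtain ⟨u, c, hu0, hu1, hc, h⟩ := exists_exit hr hgr (F_polar_zero r 0 θ) hD hgD hpy hd hgd haq
    (div_nonneg (sn_nonneg (by linarith) (hgy.mono (by linarith))) hny.le)
    (div_nonneg (sn_nonneg hsa hga) hny.le) (rel_polar hy hgy 0) hx ht hxt hρ hrel
  refine ⟨_, _, _, _, _, c, u, F_polar_zero _ _ _, F_polar_zero _ _ _, hpy, F_polar_zero _ _ _, hqy,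
    ?_, ha, haq, hu0, hu1, hc, h⟩
  rw [md_sub_comm]
  exact F_polar_le _ _ hnr.le hnq.le

/-- A variant of `exists_exit` for a point `b` of a segment `[y, z]`. -/
lemma exists_exit_opposite {o p y z a b : QPt K} {α β α' β' x m ρ ν r D d : ℝ}
    (hr : 0 < r) (hgr : Good K r) (hop : F o p = md K r)
    (hD : 0 < D) (hgD : Good K D) (hpy : F p y = md K D)
    (hd : 0 < d) (hgd : Good K d) (hab : F a b = md K d)
    (hα : 0 ≤ α) (hβ : 0 ≤ β) (hα' : 0 < α') (ha : Rel 1 a 0 a α o β y)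
    (hb : Rel 1 b 0 b β' y α' z) (hm : 0 ≤ m) (hρ : 0 ≤ ρ) (hν : ν < 0)
    (h : Rel x y m z ρ p ν o) :
    ∃ u c, 0 ≤ u ∧ u ≤ d ∧ IsPt a b d u c ∧
      ((∃ σ, 0 ≤ σ ∧ σ ≤ D ∧ IsPt p y D σ c) ∨ ∃ s, 0 ≤ s ∧ s ≤ r ∧ IsPt o p r s c) := by
  obtain ⟨a1, a2, a3⟩ := ha
  obtain ⟨b1, b2, b3⟩ := hb
  obtain ⟨h1, h2, h3⟩ := h
  have hαν : 0 < -α' * ν := mul_pos_of_neg_of_neg (by linarith) hν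
  have hαm : 0 ≤ α * m := mul_nonneg hα hm
  have hβm : 0 ≤ β * m := mul_nonneg hβ hm
  have hαβ : 0 ≤ -α' * ν * β := mul_nonneg hαν.le hβ
  -- Eliminating `o` and `z` from the three relations leaves `p` and `y`, the coefficient of `y`
  -- being this number; eliminating `y` and `z` leaves `p` and `o`, with the opposite number as
  -- coefficient of `o`. Its sign decides which side is crossed.
  rcases le_or_gt 0 (-α' * ν * β + α * (β' * m - α' * x)) with hZ | hZ
  · obtain ⟨u, σ, c, hu0, hu1, hs0, hs1, g1, g2⟩ :=
      exists_crossing (x := -α' * ν) (y := α * m) (z := α * α' * ρ)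
        (t := -α' * ν * β + α * (β' * m - α' * x))
        hd hgd hab hD hgD hpy hαν.le hαm (by linarith) (by positivity) hZ (by
          refine ⟨?_, ?_, ?_⟩
          · linear_combination (-α' * ν) * a1 + α * m * b1 + α * α' * h1
          · linear_combination (-α' * ν) * a2 + α * m * b2 + α * α' * h2
          · linear_combination (-α' * ν) * a3 + α * m * b3 + α * α' * h3)
    exact ⟨u, c, hu0, hu1, g1, Or.inl ⟨σ, hs0, hs1, g2⟩⟩
  · have hx' : 0 < α' * x - β' * m := pos_of_mul_pos_right (by linarith) hα
    obtain ⟨u, s, c, hu0, hu1, hs0, hs1, g1, g2⟩ :=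
      exists_crossing (x := α' * x - β' * m) (y := β * m)
        (z := -(-α' * ν * β + α * (β' * m - α' * x))) (t := β * α' * ρ)
        hd hgd hab hr hgr hop hx'.le hβm (by linarith) (by linarith) (by positivity) (by
          refine ⟨?_, ?_, ?_⟩
          · linear_combination (α' * x - β' * m) * a1 + β * m * b1 + β * α' * h1
          · linear_combination (α' * x - β' * m) * a2 + β * m * b2 + β * α' * h2
          · linear_combination (α' * x - β' * m) * a3 + β * m * b3 + β * α' * h3)
    exact ⟨u, c, hu0, hu1, g1, Or.inr ⟨s, hs0, hs1, g2⟩⟩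

/-- In a triangle `o, y, z` with a triangle `o, p, y` inside, a segment from a point `a` of `[o, y]`
to a point `b` of `[y, z]` meets `[p, y]` or `[o, p]`. -/
theorem exists_overlay {A B r l D sa t d : ℝ} (hA : 0 < A) (hB : 0 < B)
    (hr : 0 < r) (hrA : r < A) (hD : 0 < D) (hgD : Good K D) (hDle : md K D ≤ md K (A - r))
    (hl : A + B ≤ l) (hgl : Good K l)
    (hang : (md K (A - r) - md K D) * sn K l ≤ (md K (l - A) - md K B) * sn K r)
    (hsa : 0 ≤ sa) (hsay : sa ≤ A) (ht : 0 < t) (htB : t ≤ B) (hd : 0 < d) (hgd : Good K d)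
    (hdeq : md K d = stew K A sa (stew K B t (md K A) (md K l)) (md K t)) :
    ∃ o y p z a b c : QPt K, ∃ u, F o y = md K A ∧ F o p = md K r ∧ F p y = md K D ∧
      F o z = md K l ∧ F y z = md K B ∧ F p z ≤ md K (l - r) ∧ IsPt o y A sa a ∧
      IsPt y z B t b ∧ F a b = md K d ∧ 0 ≤ u ∧ u ≤ d ∧ IsPt a b d u c ∧
      ((∃ σ, 0 ≤ σ ∧ σ ≤ D ∧ IsPt p y D σ c) ∨ ∃ s, 0 ≤ s ∧ s ≤ r ∧ IsPt o p r s c) := by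
  have hl0 : 0 < l := by linarith
  have hgA : Good K A := hgl.mono (by linarith)
  have hgB : Good K B := hgl.mono (by linarith)
  have hgr : Good K r := hgA.mono hrA.le
  have hnA := sn_pos hA hgA
  have hnr := sn_pos hr hgr
  have hnl := sn_pos hl0 hgl
  have hnB := sn_pos hB hgB
  obtain ⟨θ, hθ, hpy, hθ'⟩ := exists_angle hA hgA hr hgr hDle
  obtain ⟨Θ, hΘ, hzy, hΘ'⟩ := exists_angle (f := md K B) hA hgA hl0 hgl
    (by rw [md_sub_comm]; exact md_le_md hB.le (by linarith) (hgl.mono (by linarith)))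
  have hle : θ ≤ Θ := by
    apply le_angle hΘ hθ
    rw [md_sub_comm K l, ← hθ', ← hΘ'] at hang
    have : (sn K A * sn K r * sn K l) * (Real.cosh θ - 1) ≤
      (sn K A * sn K r * sn K l) * (Real.cosh Θ - 1) := by linarith
    exact le_of_mul_le_mul_left this (by positivity)
  have ha := isPt_polar hA hgA sa 0
  rw [F_comm] at hzy
  obtain ⟨b, hb, b1, b2, b3⟩ := exists_isPt hB hgB hzy t
  have hop : F (polar K 0 0) (polar K r θ) = md K r := F_polar_zero _ _ _
  have hoy : F (polar K 0 0) (polar K A 0) = md K A := F_polar_zero _ _ _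
  have hoz : F (polar K 0 0) (polar K l Θ) = md K l := F_polar_zero _ _ _
  have hab : F (polar K sa 0) b = md K d := by
    rw [F_comm, ha, F_comm, hb, hoy, hoz, F_comm, hb.F_left hB hgB hzy, hdeq]
  obtain ⟨x, m, ρ, ν, hx, hm, hxm, hρ, hrel⟩ := exists_rel_polar hr hgr hA.le hgA hl0 hgl hθ hle
  -- `p` lies on the near side of `[y, z]`: otherwise `[y, z]` and `[o, p]` would meet at a point
  -- with `F` from `o` equal to `md K s`, `s ≤ r < A`, although points of `[y, z]` have `F` from `o`
  -- at least `md K (A + u)`.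
  have hν : ν < 0 := by
    by_contra! hν
    obtain ⟨u, s, c, hu0, hu1, hs0, hs1, h1, h2⟩ :=
      exists_crossing (z := ν) (t := ρ) hB hgB hzy hr hgr hop hx hm hxm hν hρ (by
        obtain ⟨h1, h2, h3⟩ := hrel
        exact ⟨by linarith, by linarith, by linarith⟩)
    have e1 := h2.F_left hr hgr hop
    rw [h1, hoy, hoz] at e1
    have e2 : stew K B u (md K A) (md K (A + B)) ≤ stew K B u (md K A) (md K l) :=
      stew_le_stew hu0 hu1 hgB le_rfl (md_le_md (by linarith) hl hgl)
    have e3 := stew_line hB hgB (-A) u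
    rw [md_neg, show -A - B = -(A + B) by ring, md_neg, show -A - u = -(A + u) by ring,
      md_neg] at e3
    rw [e1, e3] at e2
    have e4 : md K s < md K (A + u) :=
      md_lt_md hs0 (by linarith) (hgl.mono (by linarith))
    linarith
  obtain ⟨α, hα⟩ : ∃ α, α = sn K (A - sa) / sn K A := ⟨_, rfl⟩
  obtain ⟨β, hβ⟩ : ∃ β, β = sn K sa / sn K A := ⟨_, rfl⟩
  have hα0 : 0 ≤ α := hα ▸ div_nonneg (sn_nonneg (by linarith) (hgA.mono (by linarith))) hnA.le
  have hβ0 : 0 ≤ β := hβ ▸ div_nonneg (sn_nonneg hsa (hgA.mono hsay)) hnA.le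
  obtain ⟨a1, a2, a3⟩ := rel_polar (s := sa) hA hgA 0
  rw [← hα, ← hβ] at a1 a2 a3
  obtain ⟨α', hα'⟩ : ∃ α, α = sn K t / sn K B := ⟨_, rfl⟩
  obtain ⟨β', hβ'⟩ : ∃ β, β = sn K (B - t) / sn K B := ⟨_, rfl⟩
  have hα'0 : 0 < α' := hα' ▸ div_pos (sn_pos ht (hgB.mono htB)) hnB
  replace b1 : 1 + K * b.w = β' * (1 + K * (polar K A 0).w) + α' * (1 + K * (polar K l Θ).w) := by
    rw [b1, hα', hβ']; ring
  replace b2 : b.A = β' * (polar K A 0).A + α' * (polar K l Θ).A := by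
    rw [b2, hα', hβ']; ring
  replace b3 : b.B = β' * (polar K A 0).B + α' * (polar K l Θ).B := by
    rw [b3, hα', hβ']; ring
  have hpz : F (polar K r θ) (polar K l Θ) ≤ md K (l - r) := by
    rw [md_sub_comm]; exact F_polar_le _ _ hnr.le hnl.le
  obtain ⟨u, c, hu0, hu1, hc, h⟩ := exists_exit_opposite hr hgr hop hD hgD hpy hd hgd hab hα0 hβ0
    hα'0 ⟨a1, a2, a3⟩ ⟨by simpa using b1, by simpa using b2, by simpa using b3⟩ hm hρ hν hrel
  exact ⟨_, _, _, _, _, b, c, u, hoy, hop, hpy, hoz, hzy, hpz, ha, hb, hab, hu0, hu1, hc, h⟩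

end QPt
end LorentzModel

/-! ### The model spaces inside the quadric: signs of `F` and causal relations. -/

namespace ModelSpace

open LorentzModel

variable {K : ℝ}

/-- The embedding of `M_K` (modulo deck transformations) into the quadric. -/
noncomputable def emb (u : ModelSpace K) : QPt K where
  w := if K = 0 then (u.t ^ 2 - u.x ^ 2) / 2 else
    if 0 < K then (Real.cos u.x / Real.cos u.t - 1) / K else (Real.cos u.t / Real.cos u.x - 1) / K
  A := if K = 0 then u.t else
    if 0 < K then Real.tan u.t / √K else Real.sin u.t / Real.cos u.x / √(-K)
  B := if K = 0 then u.x else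
    if 0 < K then Real.sin u.x / Real.cos u.t / √K else Real.tan u.x / √(-K)
  eq := by
    rcases curvature_cases K with rfl | ⟨k, hk, rfl⟩ | ⟨k, hk, rfl⟩
    · simp; ring
    · have h : 0 < k ^ 2 := by positivity
      have hc := (Real.cos_pos_of_mem_Ioo (abs_lt.1 (u.abs_t_lt h))).ne'
      simp only [h, h.ne', if_true, if_false, Real.sqrt_sq hk.le, Real.tan_eq_sin_div_cos]
      field_simp
      linear_combination Real.sin_sq_add_cos_sq u.t - Real.sin_sq_add_cos_sq u.x
    · have h : 0 < k ^ 2 := by positivity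
      have h1 : ¬ (-k ^ 2 = 0) := by linarith
      have h2 : ¬ (0 < -k ^ 2) := by linarith
      have hc := (Real.cos_pos_of_mem_Ioo (abs_lt.1 (u.abs_x_lt (by linarith)))).ne'
      simp only [h1, h2, if_false, neg_neg, Real.sqrt_sq hk.le, Real.tan_eq_sin_div_cos]
      field_simp
      linear_combination Real.sin_sq_add_cos_sq u.t - Real.sin_sq_add_cos_sq u.x

/-- The modified signed distance in `M_K`. -/
noncomputable def F (u v : ModelSpace K) : ℝ := QPt.F u.emb v.emb

lemma F_comm (u v : ModelSpace K) : F u v = F v u := QPt.F_comm _ _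

lemma F_zero (u v : ModelSpace 0) : F u v = ((v.t - u.t) ^ 2 - (v.x - u.x) ^ 2) / 2 := by
  simp [F, QPt.F, emb]; ring

lemma cos_t_pos {k : ℝ} (hk : 0 < k) (u : ModelSpace (k ^ 2)) : 0 < Real.cos u.t :=
  Real.cos_pos_of_mem_Ioo (abs_lt.1 (u.abs_t_lt (by positivity)))

lemma cos_x_pos {k : ℝ} (hk : 0 < k) (u : ModelSpace (-k ^ 2)) : 0 < Real.cos u.x :=
  Real.cos_pos_of_mem_Ioo (abs_lt.1 (u.abs_x_lt (by
    have : 0 < k ^ 2 := by positivity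
    linarith)))

lemma F_pos {k : ℝ} (hk : 0 < k) (u v : ModelSpace (k ^ 2)) :
    F u v = (Real.cos (v.x - u.x) - Real.cos (v.t - u.t)) /
      (k ^ 2 * (Real.cos u.t * Real.cos v.t)) := by
  have h : 0 < k ^ 2 := by positivity
  have hu := (cos_t_pos hk u).ne'
  have hv := (cos_t_pos hk v).ne'
  simp only [F, QPt.F, emb, h, h.ne', if_true, if_false, Real.sqrt_sq hk.le,
    Real.tan_eq_sin_div_cos, Real.cos_sub]
  field_simp
  ring

lemma F_neg {k : ℝ} (hk : 0 < k) (u v : ModelSpace (-k ^ 2)) :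
    F u v = (Real.cos (v.x - u.x) - Real.cos (v.t - u.t)) /
      (k ^ 2 * (Real.cos u.x * Real.cos v.x)) := by
  have h : 0 < k ^ 2 := by positivity
  have h1 : ¬ (-k ^ 2 = 0) := by linarith
  have h2 : ¬ (0 < -k ^ 2) := by linarith
  have hu := (cos_x_pos hk u).ne'
  have hv := (cos_x_pos hk v).ne'
  simp only [F, QPt.F, emb, h1, h2, if_false, neg_neg, Real.sqrt_sq hk.le,
    Real.tan_eq_sin_div_cos, Real.cos_sub]
  field_simp
  ring

/-- For `K < 0`: the pairs whose connecting geodesic is shorter than `π / √(-K)`. -/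
def Near (u v : ModelSpace K) : Prop := K < 0 → v.t - u.t + |u.x + v.x| < Real.pi

/-- A bound on coordinate differences that rules out winding. -/
def Close (u v : ModelSpace K) : Prop :=
  K ≠ 0 → |v.t - u.t| < Real.pi ∧ |v.x - u.x| < Real.pi

lemma abs_lt_abs_of_cos {x y : ℝ} (hx : |x| < Real.pi)
    (h : Real.cos y < Real.cos x) : |x| < |y| := by
  by_contra! hc
  have := Real.cos_le_cos_of_nonneg_of_le_pi (abs_nonneg y) hx.le hc
  rw [Real.cos_abs, Real.cos_abs] at this
  linarith

/-- For `K ≠ 0` the sign of `F` is that of `cos Δx - cos Δt`, and on `(-π, π)` the cosine orders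
arguments by absolute value. Without the bound on differences, `F` sees points only modulo the deck
transformations. -/
lemma Close.abs_lt {u v : ModelSpace K} (h : Close u v) (hF : 0 < F u v) :
    |v.x - u.x| < |v.t - u.t| := by
  rcases curvature_cases K with rfl | ⟨k, hk, rfl⟩ | ⟨k, hk, rfl⟩
  · rw [F_zero] at hF; exact sq_lt_sq.1 (by linarith)
  · obtain ⟨h1, h2⟩ := h (by positivity)
    have hu := cos_t_pos hk u
    have hv := cos_t_pos hk v
    rw [F_pos hk, lt_div_iff₀ (by positivity)] at hF
    exact abs_lt_abs_of_cos h2 (by linarith)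
  · obtain ⟨h1, h2⟩ := h (neg_ne_zero.2 (by positivity))
    have hu := cos_x_pos hk u
    have hv := cos_x_pos hk v
    rw [F_neg hk, lt_div_iff₀ (by positivity)] at hF
    exact abs_lt_abs_of_cos h2 (by linarith)

lemma abs_le_abs_of_cos {x y : ℝ} (hx : |x| < Real.pi)
    (h : Real.cos y ≤ Real.cos x) : |x| ≤ |y| := by
  by_contra! hc
  have := Real.cos_lt_cos_of_nonneg_of_le_pi (abs_nonneg y) hx.le hc
  rw [Real.cos_abs, Real.cos_abs] at this
  linarith

lemma Close.abs_le {u v : ModelSpace K} (h : Close u v) (hF : 0 ≤ F u v) :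
    |v.x - u.x| ≤ |v.t - u.t| := by
  rcases curvature_cases K with rfl | ⟨k, hk, rfl⟩ | ⟨k, hk, rfl⟩
  · rw [F_zero] at hF; exact sq_le_sq.1 (by linarith)
  · obtain ⟨h1, h2⟩ := h (by positivity)
    have hu := cos_t_pos hk u
    have hv := cos_t_pos hk v
    rw [F_pos hk, le_div_iff₀ (by positivity)] at hF
    exact abs_le_abs_of_cos h2 (by linarith)
  · obtain ⟨h1, h2⟩ := h (neg_ne_zero.2 (by positivity))
    have hu := cos_x_pos hk u
    have hv := cos_x_pos hk v
    rw [F_neg hk, le_div_iff₀ (by positivity)] at hF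
    exact abs_le_abs_of_cos h2 (by linarith)

lemma Close.ll_or_ll {u v : ModelSpace K} (h : Close u v) (hF : 0 < F u v) : ll u v ∨ ll v u := by
  have := h.abs_lt hF
  unfold ll
  rcases abs_cases (v.t - u.t) with ⟨h1, -⟩ | ⟨h1, -⟩
  · left; linarith
  · right; rw [abs_sub_comm]; linarith

lemma Close.le_or_le {u v : ModelSpace K} (h : Close u v) (hF : 0 ≤ F u v) : le u v ∨ le v u := by
  have := h.abs_le hF
  unfold le
  rcases abs_cases (v.t - u.t) with ⟨h1, -⟩ | ⟨h1, -⟩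
  · left; linarith
  · right; rw [abs_sub_comm]; linarith

lemma le_of_ll {u v : ModelSpace K} (h : ll u v) : le u v := le_of_lt h

lemma le_trans {u v w : ModelSpace K} (h : le u v) (h' : le v w) : le u w := by
  unfold le at *
  have := abs_sub_le w.x v.x u.x
  linarith

lemma t_le {u v : ModelSpace K} (h : le u v) : u.t ≤ v.t := by
  have := abs_nonneg (v.x - u.x)
  unfold le at h; linarith

lemma not_ll_of_le {u v : ModelSpace K} (h : le u v) : ¬ ll v u := fun h' => by
  have := t_le h
  have := abs_nonneg (u.x - v.x)
  unfold ll at h'; linarith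

lemma Near.mono {u v a b : ModelSpace K} (h : Near u v) (hua : le u a) (hbv : le b v) : Near a b := by
  intro hK
  have := h hK
  unfold le at *
  have h1 : |a.x + b.x| ≤ |u.x + v.x| + |a.x - u.x| + |v.x - b.x| := by
    rw [show a.x + b.x = (u.x + v.x) + (a.x - u.x) - (v.x - b.x) by ring]
    exact (abs_sub _ _).trans (by gcongr; exact abs_add_le _ _)
  linarith

lemma le_refl (u : ModelSpace K) : le u u := by simp [le]

lemma Near.t_lt {u v : ModelSpace K} (h : Near u v) (hK : K < 0) : v.t - u.t < Real.pi := by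
  have := h hK
  have := abs_nonneg (u.x + v.x)
  linarith

/-- Points of the same causal diamond are close. -/
lemma Near.close {u v a b : ModelSpace K} (h : Near u v) (hua : le u a) (hav : le a v)
    (hub : le u b) (hbv : le b v) : Close a b := by
  intro hK
  have ht : v.t - u.t < Real.pi := by
    rcases lt_or_gt_of_ne hK with hK | hK
    · exact h.t_lt hK
    · have := abs_lt.1 (u.abs_t_lt hK)
      have := abs_lt.1 (v.abs_t_lt hK)
      linarith
  have := t_le hua
  have := t_le hub
  have := t_le hav
  have := t_le hbv
  refine ⟨abs_lt.2 ⟨by linarith, by linarith⟩, ?_⟩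
  unfold le at *
  have h1 := abs_sub_le b.x u.x a.x
  have h2 := abs_sub_le b.x v.x a.x
  rw [abs_sub_comm u.x] at h1
  rw [abs_sub_comm b.x v.x] at h2
  linarith

lemma F_self (u : ModelSpace K) : F u u = 0 := QPt.F_self _

lemma cos_sub_cos_half (x t : ℝ) : Real.cos x - Real.cos t =
    2 * (Real.sin ((t + x) / 2) * Real.sin ((t - x) / 2)) := by
  rw [Real.cos_sub_cos, show (x + t) / 2 = (t + x) / 2 by ring,
    show (x - t) / 2 = -((t - x) / 2) by ring, Real.sin_neg]
  ring

lemma F_eq_zero_of_null {u v : ModelSpace K} (h : |v.x - u.x| = v.t - u.t) : F u v = 0 := by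
  rcases curvature_cases K with rfl | ⟨k, hk, rfl⟩ | ⟨k, hk, rfl⟩
  · rw [F_zero, ← h, sq_abs]; ring
  · rw [F_pos hk, ← h, Real.cos_abs]; simp
  · rw [F_neg hk, ← h, Real.cos_abs]; simp

lemma two_div_sub_F {k : ℝ} (hk : 0 < k) (u v : ModelSpace (-k ^ 2)) :
    2 / k ^ 2 - F u v = (Real.cos (u.x + v.x) + Real.cos (v.t - u.t)) /
      (k ^ 2 * (Real.cos u.x * Real.cos v.x)) := by
  have hu := (cos_x_pos hk u).ne'
  have hv := (cos_x_pos hk v).ne'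
  rw [F_neg hk, Real.cos_add, Real.cos_sub v.x]
  field_simp
  ring

/-- `2 / k ^ 2` is the value of `md` at the diameter `π / k`, so the inequality says that `cos (x(u)
+ x(v)) + cos Δt` is positive. -/
lemma F_lt_iff_near {k : ℝ} (hk : 0 < k) {u v : ModelSpace (-k ^ 2)} (h0 : 0 ≤ v.t - u.t)
    (h1 : v.t - u.t ≤ Real.pi) : F u v < 2 / k ^ 2 ↔ Near u v := by
  have hu := cos_x_pos hk u
  have hv := cos_x_pos hk v
  have hK : -k ^ 2 < 0 := by have : 0 < k ^ 2 := by positivity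
                             linarith
  rw [← sub_pos, two_div_sub_F hk, div_pos_iff_of_pos_right (by positivity), Near]
  have e : Real.cos (u.x + v.x) = -Real.cos (Real.pi - |u.x + v.x|) := by
    rw [Real.cos_pi_sub, Real.cos_abs, neg_neg]
  have h2 : |u.x + v.x| ≤ Real.pi := by
    have := abs_lt.1 (u.abs_x_lt hK)
    have := abs_lt.1 (v.abs_x_lt hK)
    exact abs_le.2 ⟨by linarith, by linarith⟩
  have h3 := abs_nonneg (u.x + v.x)
  rw [e]
  constructor
  · intro h _
    by_contra! hc
    have := Real.cos_le_cos_of_nonneg_of_le_pi (by linarith : 0 ≤ Real.pi - |u.x + v.x|) h1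
      (by linarith)
    linarith
  · intro h
    have := Real.cos_lt_cos_of_nonneg_of_le_pi h0 (by linarith : Real.pi - |u.x + v.x| ≤ Real.pi)
      (by linarith [h hK])
    linarith

lemma md_lt_of_good {k s : ℝ} (hk : 0 < k) (h0 : 0 ≤ s) (hs : Good (-k ^ 2) s) :
    md (-k ^ 2) s < 2 / k ^ 2 := by
  have : Real.cos Real.pi < Real.cos (k * s) :=
    Real.cos_lt_cos_of_nonneg_of_le_pi (by positivity) _root_.le_rfl ((good_neg_sq hk).1 hs)
  rw [Real.cos_pi] at this
  rw [md_neg_sq_left hk, div_lt_div_iff_of_pos_right (by positivity)]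
  linarith

lemma near_of_F {u v : ModelSpace K} {s : ℝ} (hs : 0 ≤ s) (hg : Good K s) (hF : F u v = md K s)
    (hc : Close u v) (h : le u v) : Near u v := by
  rcases curvature_cases K with rfl | ⟨k, hk, rfl⟩ | ⟨k, hk, rfl⟩
  · intro h; simp at h
  · intro h; exact absurd h (not_lt.2 (by positivity))
  · obtain ⟨h1, -⟩ := hc (neg_ne_zero.2 (by positivity))
    rw [← F_lt_iff_near hk (sub_nonneg.2 (t_le h)) (abs_lt.1 h1).2.le, hF]
    exact md_lt_of_good hk hs hg

/-! ### The time separation -/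

lemma τ_of_not_ll {u v : ModelSpace K} (h : ¬ ll u v) : τ u v = 0 := by
  rw [τ, if_pos h]

lemma exists_τ_eq_of_ll {u v : ModelSpace K} (h : ll u v) (hn : Near u v) :
    ∃ d, 0 < d ∧ Good K d ∧ τ u v = ENNReal.ofReal d ∧ md K d = F u v := by
  have h0 := abs_nonneg (v.x - u.x)
  have h' := h
  unfold ll at h'
  rcases curvature_cases K with rfl | ⟨k, hk, rfl⟩ | ⟨k, hk, rfl⟩
  · have hp : 0 < (v.t - u.t) ^ 2 - (v.x - u.x) ^ 2 := by
      rw [← sq_abs (v.x - u.x)]; nlinarith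
    refine ⟨√((v.t - u.t) ^ 2 - (v.x - u.x) ^ 2), Real.sqrt_pos.2 hp, fun h => absurd h (by simp),
      by simp [τ, h], ?_⟩
    rw [md_zero_left, F_zero, Real.sq_sqrt hp.le]
  · have hK : 0 < k ^ 2 := by positivity
    have hu := cos_t_pos hk u
    have hv := cos_t_pos hk v
    have hut := abs_lt.1 (u.abs_t_lt hK)
    have hvt := abs_lt.1 (v.abs_t_lt hK)
    have hlt : Real.cos (v.t - u.t) < Real.cos (v.x - u.x) := by
      rw [← Real.cos_abs (v.x - u.x)]
      exact Real.cos_lt_cos_of_nonneg_of_le_pi h0 (by linarith) h'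
    have e : deSitterForm u.deSitterPos v.deSitterPos = 1 + k ^ 2 * F u v := by
      rw [F_pos hk, deSitterForm, deSitterPos, deSitterPos, Real.cos_sub, Real.cos_sub]
      simp only [Matrix.cons_val_zero, Matrix.cons_val_one, Matrix.cons_val, Real.tan_eq_sin_div_cos]
      field_simp
      ring
    have hF : 0 < F u v := by
      rw [F_pos hk]; exact div_pos (by linarith) (by positivity)
    have hQ : 1 < deSitterForm u.deSitterPos v.deSitterPos := by rw [e]; nlinarith
    refine ⟨Real.arcosh (deSitterForm u.deSitterPos v.deSitterPos) / k,
      div_pos (Real.arcosh_pos hQ) hk, fun h => absurd h (not_lt.2 hK.le), ?_, ?_⟩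
    · simp [τ, h, hk.ne', hk, Real.sqrt_sq hk.le]
    · rw [md_sq_left hk, mul_div_cancel₀ _ hk.ne', Real.cosh_arcosh hQ.le, e]
      field_simp; ring
  · have hK : 0 < k ^ 2 := by positivity
    have hK' : ¬ (-k ^ 2 = 0) := by linarith
    have hK'' : ¬ (0 < -k ^ 2) := by linarith
    have hu := cos_x_pos hk u
    have hv := cos_x_pos hk v
    have hnear := hn (by linarith)
    have htp := hn.t_lt (by linarith)
    have hlt : Real.cos (v.t - u.t) < Real.cos (v.x - u.x) := by
      rw [← Real.cos_abs (v.x - u.x)]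
      exact Real.cos_lt_cos_of_nonneg_of_le_pi h0 (by linarith) h'
    have hF : 0 < F u v := by
      rw [F_neg hk]; exact div_pos (by linarith) (by positivity)
    have hF2 : F u v < 2 / k ^ 2 := (F_lt_iff_near hk (by linarith) htp.le).2 hn
    have hF3 : k ^ 2 * F u v < 2 := by rwa [lt_div_iff₀ hK, mul_comm] at hF2
    have e : -antiDeSitterForm u.antiDeSitterPos v.antiDeSitterPos = 1 - k ^ 2 * F u v := by
      rw [F_neg hk, antiDeSitterForm, antiDeSitterPos, antiDeSitterPos, Real.cos_sub, Real.cos_sub]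
      simp only [Matrix.cons_val_zero, Matrix.cons_val_one, Matrix.cons_val, Real.tan_eq_sin_div_cos]
      field_simp
      ring
    have hpos : 0 < k ^ 2 * F u v := by positivity
    refine ⟨Real.arccos (1 - k ^ 2 * F u v) / k,
      div_pos (Real.arccos_pos.2 (by linarith)) hk, ?_, ?_, ?_⟩
    · rw [good_neg_sq hk, mul_div_cancel₀ _ hk.ne']
      exact lt_of_le_of_ne (Real.arccos_le_pi _) (fun h => by
        rw [Real.arccos_eq_pi] at h; linarith)
    · simp [τ, h, hk.ne', hK.le, Real.sqrt_sq hk.le, e, hnear.le]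
    · rw [md_neg_sq_left hk, mul_div_cancel₀ _ hk.ne',
        Real.cos_arccos (by linarith) (by linarith)]
      field_simp; ring

lemma exists_τ_eq {u v : ModelSpace K} (h : le u v) (hn : Near u v) :
    ∃ d, 0 ≤ d ∧ Good K d ∧ τ u v = ENNReal.ofReal d ∧ md K d = F u v := by
  by_cases h' : ll u v
  · obtain ⟨d, h1, h2⟩ := exists_τ_eq_of_ll h' hn
    exact ⟨d, h1.le, h2⟩
  · refine ⟨0, _root_.le_rfl, fun h => by
      have : 0 < -K := by linarith
      positivity, by simp [τ_of_not_ll h'], ?_⟩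
    rw [md_zero, F_eq_zero_of_null]
    unfold le ll at *
    linarith

/-- A positive value below the diameter determines everything: zero would mean not timelike related;
for `K < 0` the boundary case of `Near` gives `arccos (-1)`, that is exactly the diameter, and
beyond it the value is infinite. -/
lemma of_τ_eq {u v : ModelSpace K} {s : ℝ} (hs : 0 < s) (hg : Good K s)
    (h : τ u v = ENNReal.ofReal s) : ll u v ∧ Near u v ∧ F u v = md K s := by
  have hll : ll u v := by
    by_contra hc
    rw [τ_of_not_ll hc] at h
    exact absurd h.symm (by simpa using hs)
  have hn : Near u v := by
    intro hK
    rcases curvature_cases K with rfl | ⟨k, hk, rfl⟩ | ⟨k, hk, rfl⟩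
    · simp at hK
    · exact absurd hK (not_lt.2 (by positivity))
    · have hK : 0 < k ^ 2 := by positivity
      by_contra! hc
      rw [τ, if_neg (by simpa using hll), if_neg (by linarith), if_neg (by linarith)] at h
      split_ifs at h with h1
      · have hu := cos_x_pos hk u
        have hv := cos_x_pos hk v
        have e : -antiDeSitterForm u.antiDeSitterPos v.antiDeSitterPos = -1 := by
          have h2 : v.t - u.t = Real.pi - |u.x + v.x| := by linarith
          have h3 := two_div_sub_F hk u v
          rw [h2, Real.cos_pi_sub, Real.cos_abs, add_neg_cancel, zero_div] at h3
          have h4 : -antiDeSitterForm u.antiDeSitterPos v.antiDeSitterPos = 1 - k ^ 2 * F u v := by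
            rw [F_neg hk, antiDeSitterForm, antiDeSitterPos, antiDeSitterPos, Real.cos_sub,
              Real.cos_sub]
            simp only [Matrix.cons_val_zero, Matrix.cons_val_one, Matrix.cons_val,
              Real.tan_eq_sin_div_cos]
            field_simp
            ring
          rw [h4, show F u v = 2 / k ^ 2 by linarith]
          field_simp; norm_num
        rw [e, Real.arccos_neg_one, neg_neg, Real.sqrt_sq hk.le,
          ENNReal.ofReal_eq_ofReal_iff (by positivity) hs.le] at h
        have := hg (by linarith)
        rw [neg_neg, Real.sqrt_sq hk.le] at this
        linarith
      · exact ENNReal.ofReal_ne_top h.symm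
  obtain ⟨d, h1, h2, h3, h4⟩ := exists_τ_eq_of_ll hll hn
  rw [h, ENNReal.ofReal_eq_ofReal_iff hs.le h1.le] at h3
  exact ⟨hll, hn, by rw [← h4, h3]⟩

end ModelSpace

/-! ### Monotonicity of `F` along causal curves. -/

namespace ModelSpace

open LorentzModel

variable {K : ℝ}

/-- Cross-multiplied monotonicity of `p ↦ sin p / cos (c + p)`, whose derivative has numerator `cos
c`. -/
lemma sin_mul_cos_le {c p q : ℝ} (h0 : p ≤ q) (h1 : q - p ≤ Real.pi) (hc : 0 ≤ Real.cos c) :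
    Real.sin p * Real.cos (c + q) ≤ Real.sin q * Real.cos (c + p) := by
  have h := mul_nonneg (Real.sin_nonneg_of_nonneg_of_le_pi (sub_nonneg.2 h0) h1) hc
  have e : Real.sin (q - p) * Real.cos c =
      Real.sin q * Real.cos (c + p) - Real.sin p * Real.cos (c + q) := by
    rw [Real.sin_sub, Real.cos_add, Real.cos_add]; ring
  linarith

/-- The time separation from a point is monotone along causal curves. -/
lemma F_mono_right {u a b : ModelSpace K} (hua : le u a) (hab : le a b) (hn : Near u b) :
    F u a ≤ F u b := by
  have hna : Near u a := hn.mono (le_refl u) hab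
  unfold le at hua hab
  obtain ⟨ha1, ha2⟩ := abs_le.1 hua
  obtain ⟨hb1, hb2⟩ := abs_le.1 hab
  rcases curvature_cases K with rfl | ⟨k, hk, rfl⟩ | ⟨k, hk, rfl⟩
  · rw [F_zero, F_zero]
    have h1 : (a.t - u.t + (a.x - u.x)) * (a.t - u.t - (a.x - u.x)) ≤
        (b.t - u.t + (b.x - u.x)) * (b.t - u.t - (b.x - u.x)) :=
      mul_le_mul (by linarith) (by linarith) (by linarith) (by linarith)
    linarith
  · have hK : 0 < k ^ 2 := by positivity
    have hu := cos_t_pos hk u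
    have hca := cos_t_pos hk a
    have hcb := cos_t_pos hk b
    obtain ⟨hu1, hu2⟩ := abs_lt.1 (u.abs_t_lt hK)
    obtain ⟨hb3, hb4⟩ := abs_lt.1 (b.abs_t_lt hK)
    have sa := Real.sin_nonneg_of_nonneg_of_le_pi (x := (a.t - u.t + (a.x - u.x)) / 2)
      (by linarith) (by linarith)
    have sb := Real.sin_nonneg_of_nonneg_of_le_pi (x := (b.t - u.t - (b.x - u.x)) / 2)
      (by linarith) (by linarith)
    -- In the null coordinates `(Δt ± Δx) / 2` the numerator of `F` is a product of sines. `h1`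
    -- moves the plus coordinate from `a` to `b` while the other stays at `a`; `h2` then moves the
    -- other one.
    have h1 := sin_mul_cos_le (c := u.t + (a.t - u.t - (a.x - u.x)) / 2)
      (p := (a.t - u.t + (a.x - u.x)) / 2) (q := (b.t - u.t + (b.x - u.x)) / 2) (by linarith)
      (by linarith) (Real.cos_nonneg_of_mem_Icc ⟨by linarith, by linarith⟩)
    have h2 := sin_mul_cos_le (c := u.t + (b.t - u.t + (b.x - u.x)) / 2)
      (p := (a.t - u.t - (a.x - u.x)) / 2) (q := (b.t - u.t - (b.x - u.x)) / 2) (by linarith)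
      (by linarith) (Real.cos_nonneg_of_mem_Icc ⟨by linarith, by linarith⟩)
    rw [F_pos hk, F_pos hk, div_le_div_iff₀ (by positivity) (by positivity), cos_sub_cos_half,
      cos_sub_cos_half]
    rw [show u.t + (a.t - u.t - (a.x - u.x)) / 2 + (a.t - u.t + (a.x - u.x)) / 2 = a.t by ring] at h1
    rw [show u.t + (b.t - u.t + (b.x - u.x)) / 2 + (b.t - u.t - (b.x - u.x)) / 2 = b.t by ring,
      show u.t + (b.t - u.t + (b.x - u.x)) / 2 + (a.t - u.t - (a.x - u.x)) / 2 =
        u.t + (a.t - u.t - (a.x - u.x)) / 2 + (b.t - u.t + (b.x - u.x)) / 2 by ring] at h2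
    have h3 := mul_le_mul_of_nonneg_left h2 sa
    have h4 := mul_le_mul_of_nonneg_left h1 sb
    have h5 : 0 ≤ 2 * (k ^ 2 * Real.cos u.t) := by positivity
    have h6 := mul_le_mul_of_nonneg_left (h3.trans ((show _ = _ by ring).le.trans h4)) h5
    linarith
  · have hK : -k ^ 2 < 0 := by have : 0 < k ^ 2 := by positivity
                               linarith
    have hu := cos_x_pos hk u
    have hca := cos_x_pos hk a
    have hcb := cos_x_pos hk b
    obtain ⟨hu1, hu2⟩ := abs_lt.1 (u.abs_x_lt hK)
    obtain ⟨hb3, hb4⟩ := abs_lt.1 (b.abs_x_lt hK)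
    obtain ⟨n1, n2⟩ := abs_lt.1 (lt_sub_iff_add_lt'.2 (hn hK))
    obtain ⟨n3, n4⟩ := abs_lt.1 (lt_sub_iff_add_lt'.2 (hna hK))
    have sa := Real.sin_nonneg_of_nonneg_of_le_pi (x := (a.t - u.t + (a.x - u.x)) / 2)
      (by linarith) (by linarith)
    have sb := Real.sin_nonneg_of_nonneg_of_le_pi (x := (b.t - u.t - (b.x - u.x)) / 2)
      (by linarith) (by linarith)
    have h1 := sin_mul_cos_le (c := u.x - (a.t - u.t - (a.x - u.x)) / 2)
      (p := (a.t - u.t + (a.x - u.x)) / 2) (q := (b.t - u.t + (b.x - u.x)) / 2) (by linarith)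
      (by linarith) (Real.cos_nonneg_of_mem_Icc ⟨by linarith, by linarith⟩)
    -- The conformal factor now depends on `x`, in which the two null coordinates have opposite
    -- signs; hence the reflected base angle.
    have h2 := sin_mul_cos_le (c := -u.x - (b.t - u.t + (b.x - u.x)) / 2)
      (p := (a.t - u.t - (a.x - u.x)) / 2) (q := (b.t - u.t - (b.x - u.x)) / 2) (by linarith)
      (by linarith) (Real.cos_nonneg_of_mem_Icc ⟨by linarith, by linarith⟩)
    rw [F_neg hk, F_neg hk, div_le_div_iff₀ (by positivity) (by positivity), cos_sub_cos_half,
      cos_sub_cos_half]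
    rw [show u.x - (a.t - u.t - (a.x - u.x)) / 2 + (a.t - u.t + (a.x - u.x)) / 2 = a.x by ring] at h1
    rw [show -u.x - (b.t - u.t + (b.x - u.x)) / 2 + (b.t - u.t - (b.x - u.x)) / 2 = -b.x by ring,
      show -u.x - (b.t - u.t + (b.x - u.x)) / 2 + (a.t - u.t - (a.x - u.x)) / 2 =
        -(u.x - (a.t - u.t - (a.x - u.x)) / 2 + (b.t - u.t + (b.x - u.x)) / 2) by ring,
      Real.cos_neg, Real.cos_neg] at h2
    have h3 := mul_le_mul_of_nonneg_left h2 sa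
    have h4 := mul_le_mul_of_nonneg_left h1 sb
    have h5 : 0 ≤ 2 * (k ^ 2 * Real.cos u.x) := by positivity
    have h6 := mul_le_mul_of_nonneg_left (h3.trans ((show _ = _ by ring).le.trans h4)) h5
    linarith

/-- Time reversal. -/
def rev (u : ModelSpace K) : ModelSpace K where
  t := -u.t
  x := u.x
  abs_t_lt := by simpa using u.abs_t_lt
  abs_x_lt := u.abs_x_lt

lemma le_rev {u v : ModelSpace K} : le u.rev v.rev ↔ le v u := by
  simp only [le, rev]; rw [abs_sub_comm, show -v.t - -u.t = u.t - v.t by ring]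

lemma near_rev {u v : ModelSpace K} : Near u.rev v.rev ↔ Near v u := by
  simp only [Near, rev]; rw [add_comm u.x, show -v.t - -u.t = u.t - v.t by ring]

lemma F_rev (u v : ModelSpace K) : F u.rev v.rev = F u v := by
  have e : -v.t - -u.t = -(v.t - u.t) := by ring
  rcases curvature_cases K with rfl | ⟨k, hk, rfl⟩ | ⟨k, hk, rfl⟩
  · simp only [F_zero, rev]; ring
  · simp only [F_pos hk, rev, e, Real.cos_neg]
  · simp only [F_neg hk, rev, e, Real.cos_neg]

lemma F_mono_left {a b v : ModelSpace K} (hab : le a b) (hbv : le b v) (hn : Near a v) :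
    F b v ≤ F a v := by
  rw [F_comm b, F_comm a, ← F_rev v, ← F_rev v]
  exact F_mono_right (le_rev.2 hbv) (le_rev.2 hab) (near_rev.2 hn)

/-! ### Inverting the embedding -/

/-- The angle `m` selects the sheet of the covering: the longitude is taken within `π / 2` of `m`,
which the positivity of the component in direction `m` permits. -/
lemma exists_strip {W0 W1 W2 m : ℝ} (hW : W1 ^ 2 + W2 ^ 2 = 1 + W0 ^ 2)
    (hm : 0 < W1 * Real.cos m + W2 * Real.sin m) :
    ∃ σ l, |σ| < Real.pi / 2 ∧ |l - m| < Real.pi / 2 ∧ Real.tan σ = W0 ∧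
      Real.cos l / Real.cos σ = W1 ∧ Real.sin l / Real.cos σ = W2 := by
  obtain ⟨R, hR⟩ : ∃ R, R = W1 * Real.cos m + W2 * Real.sin m := ⟨_, rfl⟩
  obtain ⟨S, hS⟩ : ∃ S, S = W2 * Real.cos m - W1 * Real.sin m := ⟨_, rfl⟩
  rw [← hR] at hm
  have hsc := Real.sin_sq_add_cos_sq m
  have hRS : R ^ 2 + S ^ 2 = 1 + W0 ^ 2 := by
    rw [← hW, hR, hS]; linear_combination (W1 ^ 2 + W2 ^ 2) * hsc
  have e1 : Real.cos (Real.arctan (S / R)) = R / √(1 + W0 ^ 2) := by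
    rw [Real.cos_arctan, ← hRS, show 1 + (S / R) ^ 2 = (R ^ 2 + S ^ 2) / R ^ 2 by field_simp,
      Real.sqrt_div (by positivity), Real.sqrt_sq hm.le, one_div_div]
  have e2 : Real.sin (Real.arctan (S / R)) = S / √(1 + W0 ^ 2) := by
    have := Real.tan_mul_cos (Real.cos_arctan_pos (S / R)).ne'
    rw [← this, Real.tan_arctan, e1]; field_simp
  have e3 : 0 < √(1 + W0 ^ 2) := by positivity
  refine ⟨Real.arctan W0, m + Real.arctan (S / R), ?_, ?_, Real.tan_arctan _, ?_, ?_⟩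
  · exact abs_lt.2 ⟨by linarith [Real.neg_pi_div_two_lt_arctan W0], Real.arctan_lt_pi_div_two _⟩
  · rw [add_sub_cancel_left]
    exact abs_lt.2 ⟨by linarith [Real.neg_pi_div_two_lt_arctan (S / R)],
      Real.arctan_lt_pi_div_two _⟩
  · rw [Real.cos_add, e1, e2, Real.cos_arctan, hR, hS]; field_simp
    linear_combination W1 * hsc
  · rw [Real.sin_add, e1, e2, Real.cos_arctan, hR, hS]; field_simp
    linear_combination W2 * hsc

lemma exists_emb_eq_zero (c : QPt 0) : ∃ u : ModelSpace 0, u.emb = c ∧ u.t = c.A ∧ u.x = c.B := by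
  refine ⟨⟨c.A, c.B, by simp, by simp⟩, ?_, rfl, rfl⟩
  ext
  · simp only [emb, if_true]; linarith [c.eq]
  · simp [emb]
  · simp [emb]

lemma exists_emb_eq_pos {k : ℝ} (hk : 0 < k) (c : QPt (k ^ 2)) {m : ℝ}
    (hm : 0 < (1 + k ^ 2 * c.w) * Real.cos m + k * c.B * Real.sin m) :
    ∃ u : ModelSpace (k ^ 2), u.emb = c ∧ |u.x - m| < Real.pi / 2 ∧ Real.tan u.t = k * c.A := by
  have hK : 0 < k ^ 2 := by positivity
  obtain ⟨σ, l, h1, h2, h3, h4, h5⟩ := exists_strip (W0 := k * c.A)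
    (by linear_combination -k ^ 2 * c.eq) hm
  refine ⟨⟨σ, l, fun _ => h1, fun h => absurd h (not_lt.2 hK.le)⟩, ?_, h2, h3⟩
  ext <;> simp only [emb, hK, hK.ne', if_true, if_false, Real.sqrt_sq hk.le, h3, h4, h5] <;>
    field_simp
  ring

lemma exists_emb_eq_neg {k : ℝ} (hk : 0 < k) (c : QPt (-k ^ 2)) {m : ℝ}
    (hm : 0 < (1 + -k ^ 2 * c.w) * Real.cos m + k * c.A * Real.sin m) :
    ∃ u : ModelSpace (-k ^ 2), u.emb = c ∧ |u.t - m| < Real.pi / 2 := by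
  have hK : 0 < k ^ 2 := by positivity
  have hK' : ¬ (-k ^ 2 = 0) := by linarith
  have hK'' : ¬ (0 < -k ^ 2) := by linarith
  obtain ⟨σ, l, h1, h2, h3, h4, h5⟩ := exists_strip (W0 := k * c.B)
    (by linear_combination k ^ 2 * c.eq) hm
  refine ⟨⟨l, σ, fun h => absurd h hK'', fun _ => h1⟩, ?_, h2⟩
  ext <;> simp only [emb, hK', hK'', if_false, neg_neg, Real.sqrt_sq hk.le, h3, h4, h5] <;>
    field_simp
  ring

/-- Points on geodesic segments. -/
lemma exists_close_isPt {u v : ModelSpace K} {l s : ℝ} (hl : 0 < l) (hg : Good K l)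
    (hF : F u v = md K l) (hc : Close u v) (hs : 0 ≤ s) (hsl : s ≤ l) :
    ∃ w : ModelSpace K, F u w = md K s ∧ F v w = md K (l - s) ∧ Close u w ∧ Close w v := by
  obtain ⟨c, hc1, e1, e2, e3⟩ := QPt.exists_isPt hl hg hF s
  have hn := sn_pos hl hg
  have hn1 : 0 ≤ sn K s := sn_nonneg hs (hg.mono hsl)
  have hn2 : 0 ≤ sn K (l - s) := sn_nonneg (by linarith) (hg.mono (by linarith))
  have hn3 : 0 < sn K s + sn K (l - s) := by
    rcases hs.eq_or_lt with h | h
    · rw [← h]; simpa using hn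
    · linarith [sn_pos h (hg.mono hsl)]
  suffices ∃ w : ModelSpace K, w.emb = c ∧ Close u w ∧ Close w v by
    obtain ⟨w, hw, h⟩ := this
    exact ⟨w, by rw [F, hw]; exact hc1.F_left hl hg hF, by rw [F, hw]; exact hc1.F_right hl hg hF, h⟩
  rcases curvature_cases K with rfl | ⟨k, hk, rfl⟩ | ⟨k, hk, rfl⟩
  · obtain ⟨w, hw, -⟩ := exists_emb_eq_zero c
    exact ⟨w, hw, fun h => absurd rfl h, fun h => absurd rfl h⟩
  · have hK : 0 < k ^ 2 := by positivity
    obtain ⟨-, hx⟩ := hc hK.ne'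
    obtain ⟨hx1, hx2⟩ := abs_lt.1 hx
    have hu := cos_t_pos hk u
    have hv := cos_t_pos hk v
    have hch : 0 < Real.cos ((v.x - u.x) / 2) :=
      Real.cos_pos_of_mem_Ioo ⟨by linarith, by linarith⟩
    have key : ∀ y : ModelSpace (k ^ 2), (1 + k ^ 2 * y.emb.w) * Real.cos ((u.x + v.x) / 2) +
        k * y.emb.B * Real.sin ((u.x + v.x) / 2) =
          Real.cos (y.x - (u.x + v.x) / 2) / Real.cos y.t := fun y => by
      have := (cos_t_pos hk y).ne'
      simp only [emb, hK, hK.ne', if_true, if_false, Real.sqrt_sq hk.le, Real.cos_sub]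
      field_simp
      ring
    -- The sheet is centred at the mean longitude of `u` and `v`. Both are less than `π / 2` away
    -- from it, so both have positive component in that direction, and so has their combination `c`.
    obtain ⟨w, hw, hw1, -⟩ := exists_emb_eq_pos hk c (m := (u.x + v.x) / 2) (by
      have e : (1 + k ^ 2 * c.w) * Real.cos ((u.x + v.x) / 2) +
          k * c.B * Real.sin ((u.x + v.x) / 2) =
          (sn (k ^ 2) (l - s) / Real.cos u.t + sn (k ^ 2) s / Real.cos v.t) *
            Real.cos ((v.x - u.x) / 2) / sn (k ^ 2) l := by
        have ku := key u
        have kv := key v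
        rw [show u.x - (u.x + v.x) / 2 = -((v.x - u.x) / 2) by ring, Real.cos_neg] at ku
        rw [show v.x - (u.x + v.x) / 2 = (v.x - u.x) / 2 by ring] at kv
        rw [eq_div_iff hn.ne'] at e1 e3 ⊢
        linear_combination Real.cos ((u.x + v.x) / 2) * e1 + k * Real.sin ((u.x + v.x) / 2) * e3 +
          sn (k ^ 2) (l - s) * ku + sn (k ^ 2) s * kv
      rw [e]
      apply div_pos (mul_pos _ hch) hn
      rcases hn2.eq_or_lt with h | h
      · rw [← h, zero_div, zero_add]; exact div_pos (by linarith) hv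
      · have := div_nonneg hn1 hv.le
        have := div_pos h hu
        linarith)
    have ht1 := abs_lt.1 (u.abs_t_lt hK)
    have ht2 := abs_lt.1 (v.abs_t_lt hK)
    have ht3 := abs_lt.1 (w.abs_t_lt hK)
    obtain ⟨hw2, hw3⟩ := abs_lt.1 hw1
    refine ⟨w, hw, fun _ => ⟨abs_lt.2 ⟨by linarith, by linarith⟩, abs_lt.2 ⟨by linarith, by linarith⟩⟩,
      fun _ => ⟨abs_lt.2 ⟨by linarith, by linarith⟩, abs_lt.2 ⟨by linarith, by linarith⟩⟩⟩
  · have hK : -k ^ 2 < 0 := by have : 0 < k ^ 2 := by positivity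
                               linarith
    obtain ⟨ht, -⟩ := hc hK.ne
    obtain ⟨ht1, ht2⟩ := abs_lt.1 ht
    have hu := cos_x_pos hk u
    have hv := cos_x_pos hk v
    have hch : 0 < Real.cos ((v.t - u.t) / 2) :=
      Real.cos_pos_of_mem_Ioo ⟨by linarith, by linarith⟩
    have key : ∀ y : ModelSpace (-k ^ 2), (1 + -k ^ 2 * y.emb.w) * Real.cos ((u.t + v.t) / 2) +
        k * y.emb.A * Real.sin ((u.t + v.t) / 2) =
          Real.cos (y.t - (u.t + v.t) / 2) / Real.cos y.x := fun y => by
      have := (cos_x_pos hk y).ne'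
      simp only [emb, hK.ne, hK.not_gt, if_false, neg_neg, Real.sqrt_sq hk.le, Real.cos_sub]
      field_simp
      ring
    obtain ⟨w, hw, hw1⟩ := exists_emb_eq_neg hk c (m := (u.t + v.t) / 2) (by
      have e : (1 + -k ^ 2 * c.w) * Real.cos ((u.t + v.t) / 2) +
          k * c.A * Real.sin ((u.t + v.t) / 2) =
          (sn (-k ^ 2) (l - s) / Real.cos u.x + sn (-k ^ 2) s / Real.cos v.x) *
            Real.cos ((v.t - u.t) / 2) / sn (-k ^ 2) l := by
        have ku := key u
        have kv := key v
        rw [show u.t - (u.t + v.t) / 2 = -((v.t - u.t) / 2) by ring, Real.cos_neg] at ku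
        rw [show v.t - (u.t + v.t) / 2 = (v.t - u.t) / 2 by ring] at kv
        rw [eq_div_iff hn.ne'] at e1 e2 ⊢
        linear_combination Real.cos ((u.t + v.t) / 2) * e1 + k * Real.sin ((u.t + v.t) / 2) * e2 +
          sn (-k ^ 2) (l - s) * ku + sn (-k ^ 2) s * kv
      rw [e]
      apply div_pos (mul_pos _ hch) hn
      rcases hn2.eq_or_lt with h | h
      · rw [← h, zero_div, zero_add]; exact div_pos (by linarith) hv
      · have := div_nonneg hn1 hv.le
        have := div_pos h hu
        linarith)
    have hx1 := abs_lt.1 (u.abs_x_lt hK)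
    have hx2 := abs_lt.1 (v.abs_x_lt hK)
    have hx3 := abs_lt.1 (w.abs_x_lt hK)
    obtain ⟨hw2, hw3⟩ := abs_lt.1 hw1
    refine ⟨w, hw, fun _ => ⟨abs_lt.2 ⟨by linarith, by linarith⟩, abs_lt.2 ⟨by linarith, by linarith⟩⟩,
      fun _ => ⟨abs_lt.2 ⟨by linarith, by linarith⟩, abs_lt.2 ⟨by linarith, by linarith⟩⟩⟩

lemma exists_mem_segment {u v : ModelSpace K} {l s : ℝ} (hl : 0 < l) (hg : Good K l)
    (hτ : τ u v = ENNReal.ofReal l) (hs : 0 ≤ s) (hsl : s ≤ l) :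
    ∃ w ∈ segment u v, τ u w = ENNReal.ofReal s := by
  obtain ⟨hll, hn, hF⟩ := of_τ_eq hl hg hτ
  have huv := le_of_ll hll
  suffices ∃ w, le u w ∧ le w v ∧ F u w = md K s ∧ F v w = md K (l - s) by
    obtain ⟨w, h1, h2, h3, h4⟩ := this
    rw [F_comm] at h4
    obtain ⟨d, d0, dg, e1, e2⟩ := exists_τ_eq h1 (hn.mono (le_refl u) h2)
    obtain ⟨d', d0', dg', e1', e2'⟩ := exists_τ_eq h2 (hn.mono h1 (le_refl v))
    have q1 : d = s := eq_of_md_eq d0 hs dg (hg.mono hsl) (by rw [e2, h3])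
    have q2 : d' = l - s := eq_of_md_eq d0' (by linarith) dg' (hg.mono (by linarith)) (by rw [e2', h4])
    refine ⟨w, ⟨h1, h2, ?_⟩, by rw [e1, q1]⟩
    rw [e1, e1', hτ, ← ENNReal.ofReal_add d0 d0', q1, q2, add_sub_cancel]
  rcases hs.eq_or_lt with rfl | hs0
  · exact ⟨u, le_refl u, huv, by rw [F_self, md_zero], by rw [F_comm, hF, sub_zero]⟩
  rcases hsl.eq_or_lt with rfl | hsl0
  · exact ⟨v, huv, le_refl v, hF, by rw [F_self, sub_self, md_zero]⟩
  obtain ⟨w, h1, h2, h3, h4⟩ := exists_close_isPt hl hg hF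
    (hn.close (le_refl u) huv huv (le_refl v)) hs hsl
  have h2' := h2
  rw [F_comm] at h2'
  have gs := hg.mono hsl
  have gs' : Good K (l - s) := hg.mono (by linarith)
  -- Otherwise `w ≤ u ≤ v`, and monotonicity would make `F w v = md K (l - s)` at least `F u v = md
  -- K l`.
  have h5 : le u w := by
    rcases h3.le_or_le (by rw [h1]; exact md_nonneg _ _) with h | h
    · exact h
    · have hwv := le_trans h huv
      have hnw := near_of_F (by linarith) gs' h2' h4 hwv
      have := F_mono_left h huv hnw
      rw [hF, h2'] at this
      have := md_lt_md (K := K) (by linarith) (by linarith : l - s < l) hg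
      linarith
  have h6 : le w v := by
    rcases h4.le_or_le (by rw [h2']; exact md_nonneg _ _) with h | h
    · exact h
    · have hnw := near_of_F hs gs h1 h3 h5
      have := F_mono_right huv h hnw
      rw [hF, h1] at this
      have := md_lt_md (K := K) hs hsl0 hg
      linarith
  exact ⟨w, h5, h6, h1, h2⟩

/-- Points of a segment, by their distance from the endpoint. -/
lemma segment_isPt {u v w : ModelSpace K} {l s : ℝ} (hl : 0 < l) (hg : Good K l) (hs : 0 ≤ s)
    (hτ : τ u v = ENNReal.ofReal l) (hw : w ∈ segment u v) (hw' : τ u w = ENNReal.ofReal s) :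
    s ≤ l ∧ QPt.IsPt u.emb v.emb l s w.emb := by
  obtain ⟨hll, hn, hF⟩ := of_τ_eq hl hg hτ
  obtain ⟨h1, h2, h3⟩ := hw
  obtain ⟨d, d0, dg, e1, e2⟩ := exists_τ_eq h1 (hn.mono (le_refl u) h2)
  obtain ⟨d', d0', dg', e1', e2'⟩ := exists_τ_eq h2 (hn.mono h1 (le_refl v))
  have q : s = d := by rwa [e1, ENNReal.ofReal_eq_ofReal_iff d0 hs, eq_comm] at hw'
  subst q
  have q : s + d' = l := by
    rwa [e1, e1', hτ, ← ENNReal.ofReal_add hs d0', ENNReal.ofReal_eq_ofReal_iff (by positivity) hl.le]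
      at h3
  refine ⟨by linarith, QPt.isPt_of_F hl hg hF e2.symm ?_⟩
  rw [show l - s = d' by linarith, e2', F_comm]; rfl

/-- Existence of triangles with prescribed side lengths. -/
lemma exists_triangle {A B l : ℝ} (hA : 0 < A) (hB : 0 < B) (hl : A + B ≤ l) (hg : Good K l) :
    ∃ u v w : ModelSpace K, τ u v = ENNReal.ofReal A ∧ τ v w = ENNReal.ofReal B ∧
      τ u w = ENNReal.ofReal l := by
  have hl0 : 0 < l := by linarith
  have hgA : Good K A := hg.mono (by linarith)
  have hgB : Good K B := hg.mono (by linarith)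
  -- `u` is the base point, `w` lies at distance `l` in direction `0`, and `v` at distance `A` in
  -- the direction given by the law of cosines; this is possible since `B ≤ l - A`.
  obtain ⟨θ, hθ, hF, -⟩ := QPt.exists_angle (f := md K B) hl0 hg hA hgA
    (md_le_md hB.le (by linarith) (hg.mono (by linarith)))
  suffices H : ∃ u : ModelSpace K, u.emb = QPt.polar K 0 0 ∧ ∀ s η, 0 < s → Good K s →
      ∃ v : ModelSpace K, v.emb = QPt.polar K s η ∧ ll u v ∧ (K ≠ 0 → u.t < v.t ∧
        v.t < u.t + Real.pi ∧ |v.x - u.x| < Real.pi / 2) by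
    obtain ⟨u, hu, H⟩ := H
    obtain ⟨v, hv, hv1, hv2⟩ := H A θ hA hgA
    obtain ⟨w, hw, hw1, hw2⟩ := H l 0 hl0 hg
    have F1 : F u v = md K A := by rw [F, hu, hv, QPt.F_polar_zero]
    have F2 : F u w = md K l := by rw [F, hu, hw, QPt.F_polar_zero]
    have F3 : F v w = md K B := by rw [F, hv, hw, hF]
    have c1 : Close u v := fun hK => by
      obtain ⟨h1, h2, h3⟩ := hv2 hK
      exact ⟨abs_lt.2 ⟨by linarith, by linarith⟩, by linarith [Real.pi_pos]⟩
    have c2 : Close u w := fun hK => by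
      obtain ⟨h1, h2, h3⟩ := hw2 hK
      exact ⟨abs_lt.2 ⟨by linarith, by linarith⟩, by linarith [Real.pi_pos]⟩
    have c3 : Close v w := fun hK => by
      obtain ⟨h1, h2, h3⟩ := hv2 hK
      obtain ⟨h4, h5, h6⟩ := hw2 hK
      obtain ⟨h7, h8⟩ := abs_lt.1 h3
      obtain ⟨h9, h10⟩ := abs_lt.1 h6
      exact ⟨abs_lt.2 ⟨by linarith, by linarith⟩, abs_lt.2 ⟨by linarith, by linarith⟩⟩
    have n1 := near_of_F hA.le hgA F1 c1 (le_of_ll hv1)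
    have n2 := near_of_F hl0.le hg F2 c2 (le_of_ll hw1)
    -- `F` only gives a timelike relation in one order or the other; the wrong order would give `F u
    -- w ≤ F u v`, against `A < l`.
    have hvw : ll v w := by
      rcases c3.ll_or_ll (by rw [F3]; exact md_pos hB hgB) with h | h
      · exact h
      · have := F_mono_right (le_of_ll hw1) (le_of_ll h) n1
        rw [F1, F2] at this
        have := md_lt_md hA.le (by linarith : A < l) hg
        linarith
    have n3 := near_of_F hB.le hgB F3 c3 (le_of_ll hvw)
    have fin : ∀ {a b : ModelSpace K} {s : ℝ}, 0 < s → Good K s → ll a b → Near a b →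
        F a b = md K s → τ a b = ENNReal.ofReal s := fun hs hgs h hn hF => by
      obtain ⟨d, d0, dg, e1, e2⟩ := exists_τ_eq_of_ll h hn
      rw [e1, eq_of_md_eq d0.le hs.le dg hgs (by rw [e2, hF])]
    exact ⟨u, v, w, fin hA hgA hv1 n1 F1, fin hB hgB hvw n3 F3, fin hl0 hg hw1 n2 F2⟩
  have aux : ∀ {u v : ModelSpace K} {s η : ℝ}, 0 < s → Good K s → u.emb = QPt.polar K 0 0 →
      v.emb = QPt.polar K s η → Close u v → u.t < v.t → ll u v := fun hs hgs hu hv hc ht => by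
    rcases hc.ll_or_ll (by rw [F, hu, hv, QPt.F_polar_zero]; exact md_pos hs hgs) with h | h
    · exact h
    · exact absurd (t_le (le_of_ll h)) (not_le.2 ht)
  rcases curvature_cases K with rfl | ⟨k, hk, rfl⟩ | ⟨k, hk, rfl⟩
  · obtain ⟨u, hu, hu1, -⟩ := exists_emb_eq_zero (QPt.polar 0 0 0)
    refine ⟨u, hu, fun s η hs hgs => ?_⟩
    obtain ⟨v, hv, hv1, -⟩ := exists_emb_eq_zero (QPt.polar 0 s η)
    refine ⟨v, hv, aux hs hgs hu hv (fun h => absurd rfl h) ?_, fun h => absurd rfl h⟩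
    rw [hu1, hv1]
    simp only [QPt.polar, sn_zero, zero_mul]
    exact mul_pos (sn_pos hs hgs) (Real.cosh_pos η)
  · have hK : 0 < k ^ 2 := by positivity
    obtain ⟨u, hu⟩ : ∃ u : ModelSpace (k ^ 2), u.t = 0 ∧ u.x = 0 :=
      ⟨⟨0, 0, fun _ => by simp [Real.pi_pos], fun _ => by simp [Real.pi_pos]⟩, rfl, rfl⟩
    have hu' : u.emb = QPt.polar (k ^ 2) 0 0 := by
      ext <;> simp [emb, QPt.polar, hu]
    refine ⟨u, hu', fun s η hs hgs => ?_⟩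
    obtain ⟨v, hv, hv1, hv2⟩ := exists_emb_eq_pos hk (QPt.polar (k ^ 2) s η) (m := 0) (by
      simp only [Real.cos_zero, Real.sin_zero, mul_zero, mul_one, add_zero, QPt.polar]
      have := md_nonneg (k ^ 2) s
      positivity)
    have ht := abs_lt.1 (v.abs_t_lt hK)
    have ht0 : 0 < v.t := by
      by_contra! hc
      have : Real.tan v.t ≤ 0 := Real.tan_nonpos_of_nonpos_of_neg_pi_div_two_le hc ht.1.le
      rw [hv2] at this
      have : 0 < k * (QPt.polar (k ^ 2) s η).A :=
        mul_pos hk (mul_pos (sn_pos hs hgs) (Real.cosh_pos η))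
      linarith
    rw [sub_zero] at hv1
    refine ⟨v, hv, aux hs hgs hu' hv (fun _ => ⟨abs_lt.2 ⟨?_, ?_⟩, ?_⟩) ?_, fun _ => ⟨?_, ?_, ?_⟩⟩ <;>
      simp only [hu, sub_zero, zero_add] <;> linarith [Real.pi_pos]
  · have hK : -k ^ 2 < 0 := by have : 0 < k ^ 2 := by positivity
                               linarith
    obtain ⟨u, hu⟩ : ∃ u : ModelSpace (-k ^ 2), u.t = 0 ∧ u.x = 0 :=
      ⟨⟨0, 0, fun _ => by simp [Real.pi_pos], fun _ => by simp [Real.pi_pos]⟩, rfl, rfl⟩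
    have hu' : u.emb = QPt.polar (-k ^ 2) 0 0 := by
      ext <;> simp [emb, QPt.polar, hu]
    refine ⟨u, hu', fun s η hs hgs => ?_⟩
    obtain ⟨v, hv, hv1⟩ := exists_emb_eq_neg hk (QPt.polar (-k ^ 2) s η) (m := Real.pi / 2) (by
      simp only [Real.cos_pi_div_two, Real.sin_pi_div_two, mul_zero, mul_one, zero_add, QPt.polar]
      exact mul_pos hk (mul_pos (sn_pos hs hgs) (Real.cosh_pos η)))
    have hx := v.abs_x_lt hK
    obtain ⟨ht1, ht2⟩ := abs_lt.1 hv1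
    refine ⟨v, hv, aux hs hgs hu' hv (fun _ => ⟨abs_lt.2 ⟨?_, ?_⟩, ?_⟩) ?_, fun _ => ⟨?_, ?_, ?_⟩⟩ <;>
      simp only [hu, sub_zero, zero_add] <;> linarith [Real.pi_pos]

end ModelSpace

/-! ### Abstract time separations and the numerical curvature bound. -/

namespace LorentzModel

/-- A finite time separation on a set `U`, together with its causal relation. -/
structure TimeSep (X : Type*) where
  U : Set X
  le : X → X → Prop
  T : X → X → ℝ
  nonneg : ∀ a b, 0 ≤ T a b
  le_trans : ∀ {a b c}, le a b → le b c → le a c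
  le_of_pos : ∀ {a b}, 0 < T a b → le a b
  add_le : ∀ {a b c}, a ∈ U → b ∈ U → c ∈ U → le a b → le b c → T a b + T b c ≤ T a c

variable {X : Type*} {K : ℝ}

/-- Time reversal. -/
def TimeSep.op (P : TimeSep X) : TimeSep X where
  U := P.U
  le a b := P.le b a
  T a b := P.T b a
  nonneg a b := P.nonneg b a
  le_trans h h' := P.le_trans h' h
  le_of_pos h := P.le_of_pos h
  add_le ha hb hc h h' := by rw [add_comm]; exact P.add_le hc hb ha h' h

/-- `S` has the properties of the image of a distance realizer from `u` to `v`. -/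
structure TimeSep.Side (P : TimeSep X) (u v : X) (S : Set X) : Prop where
  sub : S ⊆ P.U
  left_mem : u ∈ S
  right_mem : v ∈ S
  le_left : ∀ a ∈ S, P.le u a
  le_right : ∀ a ∈ S, P.le a v
  add : ∀ a ∈ S, P.T u a + P.T a v = P.T u v
  diff : ∀ a ∈ S, ∀ b ∈ S, P.T u a < P.T u b → P.T u b - P.T u a ≤ P.T a b
  surj : ∀ s, 0 ≤ s → s ≤ P.T u v → ∃ a ∈ S, P.T u a = s

namespace TimeSep

variable {P : TimeSep X}

lemma Side.op {u v : X} {S : Set X} (h : P.Side u v S) : P.op.Side v u S where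
  sub := h.sub
  left_mem := h.right_mem
  right_mem := h.left_mem
  le_left := h.le_right
  le_right := h.le_left
  add a ha := by
    have := h.add a ha
    show P.T a v + P.T u a = P.T u v
    linarith
  diff a ha b hb hab := by
    have h1 := h.add a ha
    have h2 := h.add b hb
    have hab' : P.T a v < P.T b v := hab
    have := h.diff b hb a ha (by linarith)
    show P.T b v - P.T a v ≤ P.T b a
    linarith
  surj s hs hs' := by
    have hs'' : s ≤ P.T u v := hs'
    obtain ⟨a, ha, h1⟩ := h.surj (P.T u v - s) (by linarith) (by linarith)
    have := h.add a ha
    exact ⟨a, ha, show P.T a v = s by linarith⟩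

/-- The numerical form of the upper curvature bound for a triangle. -/
structure TriBound (K : ℝ) (P : TimeSep X) (v₁ v₂ v₃ : X) (S₁₂ S₂₃ S₁₃ : Set X) : Prop where
  b₁ : ∀ a ∈ S₁₂, ∀ b ∈ S₁₃, ∀ d, 0 < d → Good K d →
    md K d ≤ stew K (P.T v₁ v₂) (P.T v₁ a) (md K (P.T v₁ b))
      (stew K (P.T v₁ v₃) (P.T v₁ b) (md K (P.T v₁ v₂)) (md K (P.T v₂ v₃))) →
    (P.T v₁ a < P.T v₁ b → d ≤ P.T a b) ∧ (P.T v₁ b < P.T v₁ a → d ≤ P.T b a)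
  b₂ : ∀ a ∈ S₁₂, ∀ b ∈ S₂₃, ∀ d, 0 < d → Good K d →
    md K d ≤ stew K (P.T v₂ v₃) (P.T v₂ b) (md K (P.T a v₂))
      (stew K (P.T v₁ v₂) (P.T v₁ a) (md K (P.T v₁ v₃)) (md K (P.T v₂ v₃))) → d ≤ P.T a b
  b₃ : ∀ a ∈ S₁₃, ∀ b ∈ S₂₃, ∀ d, 0 < d → Good K d →
    md K d ≤ stew K (P.T v₂ v₃) (P.T v₂ b)
      (stew K (P.T v₁ v₃) (P.T v₁ a) (md K (P.T v₁ v₂)) (md K (P.T v₂ v₃)))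
      (md K (P.T a v₃)) →
    (P.T b v₃ < P.T a v₃ → d ≤ P.T a b) ∧ (P.T a v₃ < P.T b v₃ → d ≤ P.T b a)

end TimeSep

/-- Interpolating bilinear data along two geodesics does not depend on the order, and the Stewart
corrections are compatible by `sn_mul_add_md`. The two lemmas `stew_comm_middle` and
`stew_comm_first` are its forms for geodesics that share a vertex. -/
lemma stew_comm {l m : ℝ} (hl : 0 < l) (hgl : Good K l) (hm : 0 < m) (hgm : Good K m)
    (s t f₀₀ f₀₁ f₁₀ f₁₁ : ℝ) :
    stew K m t (stew K l s f₀₀ f₁₀) (stew K l s f₀₁ f₁₁) =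
      stew K l s (stew K m t f₀₀ f₀₁) (stew K m t f₁₀ f₁₁) := by
  have h1 := sn_mul_add_md K s (l - s)
  have h2 := sn_mul_add_md K t (m - t)
  rw [add_sub_cancel] at h1 h2
  have hn := (sn_pos hl hgl).ne'
  have hn' := (sn_pos hm hgm).ne'
  unfold stew
  generalize sn K (l - s) * md K s + sn K s * md K (l - s) = C at *
  generalize sn K (m - t) * md K t + sn K t * md K (m - t) = C' at *
  field_simp
  linear_combination C' * h1 - C * h2

lemma stew_zero_left {l : ℝ} (hl : 0 < l) (hg : Good K l) (s : ℝ) :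
    stew K l s 0 (md K l) = md K s := by
  have := stew_line hl hg 0 s
  rwa [md_zero, zero_sub, md_neg, zero_sub, md_neg] at this

lemma stew_zero_right {l : ℝ} (hl : 0 < l) (hg : Good K l) (s : ℝ) :
    stew K l s (md K l) 0 = md K (l - s) := by
  have := stew_line hl hg l s
  rwa [sub_self, md_zero] at this

lemma stew_comm_middle {l m f s t : ℝ} (hl : 0 < l) (hgl : Good K l) (hm : 0 < m)
    (hgm : Good K m) :
    stew K m t (md K (l - s)) (stew K l s f (md K m)) =
      stew K l s (stew K m t (md K l) f) (md K t) := by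
  have := stew_comm hl hgl hm hgm s t (md K l) f 0 (md K m)
  rwa [stew_zero_right hl hgl, stew_zero_left hm hgm] at this

lemma stew_comm_first {l m f s t : ℝ} (hl : 0 < l) (hgl : Good K l) (hm : 0 < m)
    (hgm : Good K m) :
    stew K l s (md K t) (stew K m t (md K l) f) = stew K m t (md K s) (stew K l s (md K m) f) := by
  have := stew_comm hl hgl hm hgm s t 0 (md K m) (md K l) f
  rw [stew_zero_left hl hgl, stew_zero_left hm hgm] at this
  exact this.symm

namespace TimeSep

variable {P : TimeSep X} {v₁ v₂ v₃ : X} {S₁₂ S₂₃ S₁₃ : Set X}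

/-- Reversal exchanges `b₁` and `b₃` and keeps `b₂`. A parameter `s` becomes `l - s`, which
`stew_rev` absorbs; for `b₂` the order of interpolation also has to be exchanged. -/
lemma TriBound.op (h : TriBound K P v₁ v₂ v₃ S₁₂ S₂₃ S₁₃) (h₁₂ : P.Side v₁ v₂ S₁₂)
    (h₂₃ : P.Side v₂ v₃ S₂₃) (h₁₃ : P.Side v₁ v₃ S₁₃) (p₁₂ : 0 < P.T v₁ v₂) (p₂₃ : 0 < P.T v₂ v₃)
    (g₁₂ : Good K (P.T v₁ v₂)) (g₂₃ : Good K (P.T v₂ v₃)) :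
    TriBound K P.op v₃ v₂ v₁ S₂₃ S₁₂ S₁₃ where
  b₁ a ha b hb d hd hg hf := by
    have e1 := h₂₃.add a ha
    have e2 := h₁₃.add b hb
    refine (h.b₃ b hb a ha d hd hg (hf.trans_eq ?_))
    show stew K (P.T v₂ v₃) (P.T a v₃) (md K (P.T b v₃))
      (stew K (P.T v₁ v₃) (P.T b v₃) (md K (P.T v₂ v₃)) (md K (P.T v₁ v₂))) = _
    rw [show P.T a v₃ = P.T v₂ v₃ - P.T v₂ a by linarith, stew_rev,
      show stew K (P.T v₁ v₃) (P.T b v₃) (md K (P.T v₂ v₃)) (md K (P.T v₁ v₂)) =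
        stew K (P.T v₁ v₃) (P.T v₁ v₃ - P.T v₁ b) (md K (P.T v₂ v₃)) (md K (P.T v₁ v₂)) by
          rw [← e2, add_sub_cancel_left], stew_rev]
  b₂ a ha b hb d hd hg hf := by
    have e1 := h₂₃.add a ha
    have e2 := h₁₂.add b hb
    refine h.b₂ b hb a ha d hd hg (hf.trans_eq ?_)
    show stew K (P.T v₁ v₂) (P.T b v₂) (md K (P.T v₂ a))
      (stew K (P.T v₂ v₃) (P.T a v₃) (md K (P.T v₁ v₃)) (md K (P.T v₁ v₂))) = _
    rw [show P.T b v₂ = P.T v₁ v₂ - P.T v₁ b by linarith, stew_rev,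
      show P.T a v₃ = P.T v₂ v₃ - P.T v₂ a by linarith, stew_rev,
      stew_comm_middle p₁₂ g₁₂ p₂₃ g₂₃]
  b₃ a ha b hb d hd hg hf := by
    have e1 := h₁₂.add b hb
    have e2 := h₁₃.add a ha
    refine (h.b₁ b hb a ha d hd hg (hf.trans_eq ?_))
    show stew K (P.T v₁ v₂) (P.T b v₂)
      (stew K (P.T v₁ v₃) (P.T a v₃) (md K (P.T v₂ v₃)) (md K (P.T v₁ v₂))) (md K (P.T v₁ a)) = _
    rw [show P.T b v₂ = P.T v₁ v₂ - P.T v₁ b by linarith, stew_rev,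
      show stew K (P.T v₁ v₃) (P.T a v₃) (md K (P.T v₂ v₃)) (md K (P.T v₁ v₂)) =
        stew K (P.T v₁ v₃) (P.T v₁ v₃ - P.T v₁ a) (md K (P.T v₂ v₃)) (md K (P.T v₁ v₂)) by
          rw [← e2, add_sub_cancel_left], stew_rev]

end TimeSep

/-- The hinge estimate at the first vertex. -/
lemma stew_first_le {l₁₂ l₂₃ l₁₃ s t : ℝ} (h₁₂ : 0 < l₁₂) (h₂₃ : 0 < l₂₃) (h : l₁₂ + l₂₃ ≤ l₁₃)
    (hg : Good K l₁₃) (hs : 0 ≤ s) (hs' : s ≤ l₁₂) (ht : 0 ≤ t) (ht' : t ≤ l₁₃) :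
    stew K l₁₂ s (md K t) (stew K l₁₃ t (md K l₁₂) (md K l₂₃)) ≤ md K (t - s) := by
  have h₁₃ : 0 < l₁₃ := by linarith
  have g₁₂ : Good K l₁₂ := hg.mono (by linarith)
  have e1 : md K l₂₃ ≤ md K (l₁₂ - l₁₃) := by
    rw [md_sub_comm]; exact md_le_md h₂₃.le (by linarith) (hg.mono (by linarith))
  calc _ ≤ stew K l₁₂ s (md K t) (stew K l₁₃ t (md K l₁₂) (md K (l₁₂ - l₁₃))) :=
        stew_le_stew hs hs' g₁₂ le_rfl (stew_le_stew ht ht' hg le_rfl e1)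
    _ = md K (t - s) := by
        rw [stew_line h₁₃ hg, md_sub_comm K l₁₂, stew_line h₁₂ g₁₂]

/-- The hinge estimate at the last vertex. -/
lemma stew_last_le {l₁₂ l₂₃ l₁₃ s t : ℝ} (h₁₂ : 0 < l₁₂) (h₂₃ : 0 < l₂₃) (h : l₁₂ + l₂₃ ≤ l₁₃)
    (hg : Good K l₁₃) (hs : 0 ≤ s) (hs' : s ≤ l₂₃) (ht : 0 ≤ t) (ht' : t ≤ l₁₃) :
    stew K l₂₃ s (stew K l₁₃ t (md K l₁₂) (md K l₂₃)) (md K (l₁₃ - t)) ≤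
      md K ((l₁₃ - t) - (l₂₃ - s)) := by
  have := stew_first_le (s := l₂₃ - s) (t := l₁₃ - t) h₂₃ h₁₂ (by linarith) hg (by linarith)
    (by linarith) (by linarith) (by linarith)
  rwa [stew_rev, stew_rev] at this

end LorentzModel

/-! ### From realizing curves to sides. -/

namespace LorentzianPreLengthSpace

open LorentzModel

variable {X : Type*} [EMetricSpace X] (L : LorentzianPreLengthSpace X) {U : Set X}

/-- The finite time separation on a set on which `τ` is finite. -/
noncomputable def timeSep (hU : L.FiniteContinuousOn U) : TimeSep X where
  U := U
  le := L.le
  T a b := (L.τ a b).toReal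
  nonneg _ _ := ENNReal.toReal_nonneg
  le_trans h h' := L.le_trans _ _ _ h h'
  le_of_pos h := L.le_of_ll _ _ ((L.τ_pos_iff _ _).1 (ENNReal.toReal_pos_iff.1 h).1)
  add_le ha hb hc h h' := by
    rw [← ENNReal.toReal_add (hU.1 _ ha _ hb) (hU.1 _ hb _ hc)]
    exact ENNReal.toReal_mono (hU.1 _ ha _ hc) (L.reverse_triangle _ _ _ h h')

variable {L}

lemma τ_eq_ofReal (hU : L.FiniteContinuousOn U) {a b : X} (ha : a ∈ U) (hb : b ∈ U) :
    L.τ a b = ENNReal.ofReal ((L.timeSep hU).T a b) :=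
  (ENNReal.ofReal_toReal (hU.1 a ha b hb)).symm

section Realizing

variable (hU : L.FiniteContinuousOn U) {γ : ℝ → X} {a b : ℝ} {x z : X}

lemma IsRealizing.le_of_le (h : L.IsRealizing U x z γ a b) {s t : ℝ} (has : a ≤ s) (hst : s ≤ t)
    (htb : t ≤ b) : L.le (γ s) (γ t) := by
  rcases hst.eq_or_lt with rfl | hst'
  · exact L.le_refl _
  · exact h.2.1.2 s ⟨has, hst.trans htb⟩ t ⟨has.trans hst, htb⟩ hst'

lemma IsRealizing.mem (h : L.IsRealizing U x z γ a b) {s : ℝ} (has : a ≤ s) (hsb : s ≤ b) :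
    γ s ∈ U := h.2.2.2.2.2 s ⟨has, hsb⟩

lemma T_self {c : X} (hc : c ∈ U) : (L.timeSep hU).T c c = 0 := by
  have h1 := (L.timeSep hU).add_le hc hc hc (L.le_refl c) (L.le_refl c)
  have h2 := (L.timeSep hU).nonneg c c
  linarith

/-- The length is an infimum over partitions, so the partition with the single interior parameter
`s` bounds it. With two interior parameters the same gives `four`; no finer partitions are needed.
-/
lemma IsRealizing.three (h : L.IsRealizing U x z γ a b) {s : ℝ} (has : a < s) (hsb : s < b) :
    (L.timeSep hU).T x z ≤ (L.timeSep hU).T x (γ s) + (L.timeSep hU).T (γ s) z := by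
  have hab := h.1
  have hx : x ∈ U := h.2.2.1 ▸ h.mem le_rfl hab.le
  have hz : z ∈ U := h.2.2.2.1 ▸ h.mem hab.le le_rfl
  have hs : γ s ∈ U := h.mem has.le hsb.le
  have h1 : L.τ x z ≤ L.τ x (γ s) + L.τ (γ s) z := by
    rw [← h.2.2.2.2.1, length]
    refine iInf_le_of_le 1 (iInf_le_of_le ![a, s, b] (iInf_le_of_le ?_ (iInf_le_of_le rfl
      (iInf_le_of_le rfl ?_))))
    · rw [Fin.strictMono_iff_lt_succ]
      intro i; fin_cases i
      · exact has
      · exact hsb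
    · rw [Fin.sum_univ_two]
      simp [h.2.2.1, h.2.2.2.1]
  show (L.τ x z).toReal ≤ (L.τ x (γ s)).toReal + (L.τ (γ s) z).toReal
  rw [← ENNReal.toReal_add (hU.1 _ hx _ hs) (hU.1 _ hs _ hz)]
  exact ENNReal.toReal_mono (ENNReal.add_ne_top.2 ⟨hU.1 _ hx _ hs, hU.1 _ hs _ hz⟩) h1

lemma IsRealizing.four (h : L.IsRealizing U x z γ a b) {s t : ℝ} (has : a < s) (hst : s < t)
    (htb : t < b) : (L.timeSep hU).T x z ≤
      (L.timeSep hU).T x (γ s) + (L.timeSep hU).T (γ s) (γ t) + (L.timeSep hU).T (γ t) z := by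
  have hab := h.1
  have hx : x ∈ U := h.2.2.1 ▸ h.mem le_rfl hab.le
  have hz : z ∈ U := h.2.2.2.1 ▸ h.mem hab.le le_rfl
  have hs : γ s ∈ U := h.mem has.le (hst.trans htb).le
  have ht : γ t ∈ U := h.mem (has.trans hst).le htb.le
  have h1 : L.τ x z ≤ L.τ x (γ s) + L.τ (γ s) (γ t) + L.τ (γ t) z := by
    rw [← h.2.2.2.2.1, length]
    refine iInf_le_of_le 2 (iInf_le_of_le ![a, s, t, b] (iInf_le_of_le ?_ (iInf_le_of_le rfl
      (iInf_le_of_le rfl ?_))))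
    · rw [Fin.strictMono_iff_lt_succ]
      intro i; fin_cases i
      · exact has
      · exact hst
      · exact htb
    · rw [Fin.sum_univ_three]
      simp [h.2.2.1, h.2.2.2.1]
  have n1 := hU.1 _ hx _ hs
  have n2 := hU.1 _ hs _ ht
  have n3 := hU.1 _ ht _ hz
  show (L.τ x z).toReal ≤ (L.τ x (γ s)).toReal + (L.τ (γ s) (γ t)).toReal + (L.τ (γ t) z).toReal
  rw [← ENNReal.toReal_add n1 n2, ← ENNReal.toReal_add (ENNReal.add_ne_top.2 ⟨n1, n2⟩) n3]
  exact ENNReal.toReal_mono (ENNReal.add_ne_top.2 ⟨ENNReal.add_ne_top.2 ⟨n1, n2⟩, n3⟩) h1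

/-- Along a realizing curve, the time separation is the difference of that from the start. -/
lemma IsRealizing.T_eq (h : L.IsRealizing U x z γ a b) {s t : ℝ} (has : a ≤ s) (hst : s ≤ t)
    (htb : t ≤ b) : (L.timeSep hU).T (γ s) (γ t) =
      (L.timeSep hU).T x (γ t) - (L.timeSep hU).T x (γ s) := by
  have hab := h.1
  have hx : x ∈ U := h.2.2.1 ▸ h.mem le_rfl hab.le
  have hz : z ∈ U := h.2.2.2.1 ▸ h.mem hab.le le_rfl
  have hs : γ s ∈ U := h.mem has (hst.trans htb)
  have ht : γ t ∈ U := h.mem (has.trans hst) htb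
  have lxs : L.le x (γ s) := h.2.2.1 ▸ h.le_of_le le_rfl has (hst.trans htb)
  have lst := h.le_of_le has hst htb
  have ltz : L.le (γ t) z := h.2.2.2.1 ▸ h.le_of_le (has.trans hst) htb le_rfl
  have r1 := (L.timeSep hU).add_le hx hs ht lxs lst
  have r2 := (L.timeSep hU).add_le hx ht hz (L.le_trans _ _ _ lxs lst) ltz
  rcases has.eq_or_lt with rfl | has
  · rw [h.2.2.1, T_self hU hx, sub_zero]
  rcases hst.eq_or_lt with rfl | hst
  · rw [T_self hU hs, sub_self]
  rcases htb.eq_or_lt with rfl | htb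
  · have := h.three hU has hst
    rw [h.2.2.2.1] at r1 ⊢
    linarith
  · have := h.four hU has hst htb
    linarith

/-- Continuity of `τ` on `U × U` enters only here; it yields, by the intermediate value theorem,
points of a side at every prescribed time separation from its start. -/
lemma IsRealizing.continuousOn (h : L.IsRealizing U x z γ a b) :
    ContinuousOn (fun t => (L.timeSep hU).T x (γ t)) (Set.Icc a b) := by
  have hx : x ∈ U := h.2.2.1 ▸ h.mem le_rfl h.1.le
  have h1 : ContinuousOn γ (Set.Icc a b) := h.2.1.1.continuousOn
  have h2 : ContinuousOn (fun t => L.τ x (γ t)) (Set.Icc a b) :=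
    hU.2.comp (f := fun t => (x, γ t)) (continuousOn_const.prodMk h1)
      fun t ht => ⟨hx, h.mem ht.1 ht.2⟩
  exact ENNReal.continuousOn_toReal.comp h2 fun t ht => hU.1 _ hx _ (h.mem ht.1 ht.2)

lemma IsRealizing.side (h : L.IsRealizing U x z γ a b) {s t : ℝ} (has : a ≤ s) (hst : s ≤ t)
    (htb : t ≤ b) : (L.timeSep hU).Side (γ s) (γ t) (γ '' Set.Icc s t) where
  sub := by rintro _ ⟨u, hu, rfl⟩; exact h.mem (has.trans hu.1) (hu.2.trans htb)
  left_mem := ⟨s, ⟨le_rfl, hst⟩, rfl⟩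
  right_mem := ⟨t, ⟨hst, le_rfl⟩, rfl⟩
  le_left := by rintro _ ⟨u, hu, rfl⟩; exact h.le_of_le has hu.1 (hu.2.trans htb)
  le_right := by rintro _ ⟨u, hu, rfl⟩; exact h.le_of_le (has.trans hu.1) hu.2 htb
  add := by
    rintro _ ⟨u, hu, rfl⟩
    rw [h.T_eq hU has hu.1 (hu.2.trans htb), h.T_eq hU (has.trans hu.1) hu.2 htb,
      h.T_eq hU has hst htb]
    ring
  diff := by
    rintro _ ⟨u, hu, rfl⟩ _ ⟨v, hv, rfl⟩ huv
    rw [h.T_eq hU has hu.1 (hu.2.trans htb), h.T_eq hU has hv.1 (hv.2.trans htb)] at huv ⊢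
    rcases le_total u v with huv' | huv'
    · rw [h.T_eq hU (has.trans hu.1) huv' (hv.2.trans htb)]; linarith
    · have := h.T_eq hU (has.trans hv.1) huv' (hu.2.trans htb)
      have := (L.timeSep hU).nonneg (γ v) (γ u)
      linarith
  surj := by
    intro r hr hr'
    rw [h.T_eq hU has hst htb] at hr'
    obtain ⟨u, hu, hu'⟩ := intermediate_value_Icc hst
      ((h.continuousOn hU).mono (Set.Icc_subset_Icc has htb))
      (show r + (L.timeSep hU).T x (γ s) ∈ Set.Icc _ _ from ⟨by linarith, by linarith⟩)
    refine ⟨_, ⟨u, hu, rfl⟩, ?_⟩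
    rw [h.T_eq hU has hu.1 (hu.2.trans htb)]
    simp only at hu'
    linarith

lemma IsSegment.side {S : Set X} (h : L.IsSegment U x z S) : (L.timeSep hU).Side x z S := by
  obtain ⟨γ, a, b, hγ, rfl⟩ := h
  have := hγ.side hU le_rfl hγ.1.le le_rfl
  rwa [hγ.2.2.1, hγ.2.2.2.1] at this

end Realizing

end LorentzianPreLengthSpace

/-! ### Alexandrov's lemma: consequences of the angle condition. -/

namespace LorentzModel

variable {X : Type*} {K : ℝ}

open Filter Topology

lemma continuous_stew (K l f g : ℝ) : Continuous fun s => stew K l s f g := by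
  have h1 := continuous_md K
  have h2 := continuous_sn K
  unfold stew
  fun_prop

lemma stew_line_add {l : ℝ} (hl : 0 < l) (hg : Good K l) (c s : ℝ) :
    stew K l s (md K c) (md K (c + l)) = md K (c + s) := by
  have := stew_line hl hg (-c) s
  rwa [md_neg, ← neg_add', md_neg, ← neg_add', md_neg] at this

lemma md_add_le_stew {l s c f g : ℝ} (hl : 0 < l) (hg : Good K l) (hs : 0 ≤ s) (hsl : s ≤ l)
    (hf : md K c ≤ f) (hf' : md K (c + l) ≤ g) : md K (c + s) ≤ stew K l s f g :=
  (stew_line_add hl hg c s).ge.trans (stew_le_stew hs hsl hg hf hf')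

lemma stew_le_md_add {l s c f g : ℝ} (hl : 0 < l) (hg : Good K l) (hs : 0 ≤ s) (hsl : s ≤ l)
    (hf : f ≤ md K c) (hf' : g ≤ md K (c + l)) : stew K l s f g ≤ md K (c + s) :=
  (stew_le_stew hs hsl hg hf hf').trans (stew_line_add hl hg c s).le

lemma md_sub_le_stew {l s c f g : ℝ} (hl : 0 < l) (hg : Good K l) (hs : 0 ≤ s) (hsl : s ≤ l)
    (hf : md K c ≤ f) (hf' : md K (c - l) ≤ g) : md K (c - s) ≤ stew K l s f g :=
  (stew_line hl hg c s).ge.trans (stew_le_stew hs hsl hg hf hf')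

lemma stew_le_md_sub {l s c f g : ℝ} (hl : 0 < l) (hg : Good K l) (hs : 0 ≤ s) (hsl : s ≤ l)
    (hf : f ≤ md K c) (hf' : g ≤ md K (c - l)) : stew K l s f g ≤ md K (c - s) :=
  (stew_le_stew hs hsl hg hf hf').trans (stew_line hl hg c s).le

/-- Stewart's formula for three points of a line, with the denominator cleared. -/
lemma md_sub_mul_sn (K c r ε : ℝ) :
    md K (c - r) * sn K (r + ε) = md K (c - r - ε) * sn K r + sn K ε * md K c -
      (sn K ε * md K r + sn K r * md K ε) := by
  rw [sub_sub, md_sub, md_sub, sn_add, md_add]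
  linear_combination -(sn K ε * (1 + K * md K c)) * sn_sq K r

/-- Hinges at a common vertex: sizes and the angle condition for adjacent triangles with vertices
`x, p, y` and `p, y, z`. -/
structure Sizes (K r m D A B : ℝ) : Prop where
  r_pos : 0 < r
  m_pos : 0 < m
  D_pos : 0 < D
  B_pos : 0 < B
  hA : r + D ≤ A
  hm : D + B ≤ m
  hl : A + B ≤ r + m
  good : Good K (r + m)
  angle : (md K A - md K (r + D)) * sn K m ≤ (md K (m - D) - md K B) * sn K r

namespace Sizes

variable {r m D A B : ℝ} (h : Sizes K r m D A B)

include h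

lemma A_pos : 0 < A := by linarith [h.r_pos, h.D_pos, h.hA]

lemma good_r : Good K r := h.good.mono (by linarith [h.m_pos])

lemma good_m : Good K m := h.good.mono (by linarith [h.r_pos])

lemma good_A : Good K A := h.good.mono (by linarith [h.B_pos, h.hl])

lemma good_B : Good K B := h.good.mono (by linarith [h.A_pos, h.hl])

lemma good_D : Good K D := h.good_A.mono (by linarith [h.r_pos, h.hA])

/-- Comparison with a degenerate triangle: `B` is replaced by its upper bound `m - D`, and Stewart's
formula along a line is exact. The next two lemmas work in the same way with other degenerate
triangles. -/
lemma stew_m_le {ε : ℝ} (hε : 0 ≤ ε) (hεm : ε ≤ m) :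
    stew K m ε (md K D) (md K B) ≤ md K (D - ε) := by
  refine stew_le_md_sub h.m_pos h.good_m hε hεm le_rfl ?_
  rw [md_sub_comm]
  exact md_le_md h.B_pos.le (by linarith [h.hm]) (h.good_m.mono (by linarith [h.D_pos]))

lemma stew_m_le' {ε : ℝ} (hε : 0 ≤ ε) (hεm : ε ≤ m) :
    stew K m ε (md K D) (md K B) ≤ md K (A - (r + ε)) := by
  rw [← sub_sub]
  have hA := h.hA
  have hl := h.hl
  have hD := h.D_pos
  refine stew_le_md_sub h.m_pos h.good_m hε hεm
    (md_le_md h.D_pos.le (by linarith) (h.good_A.mono (by linarith [h.r_pos]))) ?_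
  rw [sub_sub, md_sub_comm]
  exact md_le_md h.B_pos.le (by linarith) (h.good.mono (by linarith [h.A_pos]))

lemma stew_r_le {s : ℝ} (hs : 0 ≤ s) (hsr : s ≤ r) :
    stew K r s (md K A) (md K D) ≤ md K (r + m - B - s) := by
  have := h.D_pos
  have := h.B_pos
  refine stew_le_md_sub h.r_pos h.good_r hs hsr
    (md_le_md h.A_pos.le (by linarith [h.hl]) (h.good.mono (by linarith)))
    (md_le_md h.D_pos.le (by linarith [h.hm]) (h.good.mono (by linarith [h.r_pos])))

/-- By the law of cosines this compares angles at `x` with `[x, y]`: the angle of `p` is at most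
that of a point at distance `ε` beyond `p` whose value against `y` is taken from `T₂`. After
expansion it is the angle condition at `p` multiplied by `sn K ε / sn K m`. -/
lemma hinge_first {ε : ℝ} (hε : 0 ≤ ε) (hεm : ε ≤ m) :
    (md K (A - r) - md K D) * sn K (r + ε) ≤
      (md K (A - (r + ε)) - stew K m ε (md K D) (md K B)) * sn K r := by
  have hm := sn_pos h.m_pos h.good_m
  have h1 := md_sub_mul_sn K A r ε
  have h2 := md_sub_mul_sn K (r + D) r ε
  have h3 := stew_add_add K m ε (md K D) (md K (D - m)) 0 (md K B - md K (D - m))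
  rw [add_zero, add_sub_cancel, stew_line h.m_pos h.good_m, md_sub_comm K D m, mul_zero,
    zero_add] at h3
  rw [add_sub_cancel_left] at h2
  have h4 := mul_le_mul_of_nonneg_left h.angle
    (div_nonneg (sn_nonneg hε (h.good_m.mono hεm)) hm.le)
  have e1 : sn K ε / sn K m * ((md K A - md K (r + D)) * sn K m) =
    sn K ε * (md K A - md K (r + D)) := by field_simp
  have e2 : sn K ε / sn K m * ((md K (m - D) - md K B) * sn K r) =
    -(sn K ε * (md K B - md K (m - D)) / sn K m) * sn K r := by ring
  rw [e1, e2] at h4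
  rw [h3, ← sub_sub A]
  linarith

/-- The same comparison at `z`, for a point of `[x, p]` at distance `s` from `x` whose value against
`y` is taken from `T₁`; the factor is `sn K (r - s) / sn K r`. -/
lemma hinge_last {s : ℝ} (hs : 0 ≤ s) (hsr : s ≤ r) :
    (md K (B - m) - md K D) * sn K (m + (r - s)) ≤
      (md K (B - (m + (r - s))) - stew K r s (md K A) (md K D)) * sn K m := by
  have hr := sn_pos h.r_pos h.good_r
  have h1 := md_sub_mul_sn K B m (r - s)
  have h2 := md_sub_mul_sn K (m - D) m (r - s)
  have h3 := stew_add_add K r s (md K (r + D)) (md K (r + D - r)) (md K A - md K (r + D)) 0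
  rw [add_zero, add_sub_cancel, stew_line h.r_pos h.good_r, add_sub_cancel_left, mul_zero,
    add_zero] at h3
  rw [sub_sub_cancel_left, md_neg, ← neg_add', md_neg] at h2
  have h4 := mul_le_mul_of_nonneg_left h.angle
    (div_nonneg (sn_nonneg (sub_nonneg.2 hsr) (h.good_r.mono (by linarith))) hr.le)
  have e1 : sn K (r - s) / sn K r * ((md K A - md K (r + D)) * sn K m) =
    sn K (r - s) * (md K A - md K (r + D)) / sn K r * sn K m := by ring
  have e2 : sn K (r - s) / sn K r * ((md K (m - D) - md K B) * sn K r) =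
    sn K (r - s) * (md K (m - D) - md K B) := by field_simp
  rw [e1, e2] at h4
  rw [h3, ← sub_sub B, show r + D - s = D + (r - s) by ring]
  linarith

/-- With `md K (r + D)` and `md K (m - D)` as boundary values Stewart's formula gives exactly `md K
D`. By affinity the deviations of `md K A` and `md K B` contribute a multiple of the defect in the
angle condition. -/
lemma long_le_side : stew K (r + m) r (md K A) (md K B) ≤ md K D := by
  have hr := sn_pos h.r_pos h.good_r
  have hl := sn_pos (add_pos h.r_pos h.m_pos) h.good
  have h3 := stew_add_add K (r + m) r (md K (r + D)) (md K (r + D - (r + m)))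
    (md K A - md K (r + D)) (md K B - md K (m - D))
  rw [stew_line (add_pos h.r_pos h.m_pos) h.good, add_sub_cancel, add_sub_add_left_eq_sub,
    md_sub_comm K D m, add_sub_cancel, add_sub_cancel_left, add_sub_cancel_left] at h3
  rw [h3]
  have : (sn K m * (md K A - md K (r + D)) + sn K r * (md K B - md K (m - D))) / sn K (r + m) ≤ 0 :=
    div_nonpos_of_nonpos_of_nonneg (by linarith [h.angle]) hl.le
  linarith

/-- Restricted to `[0, r]`, the interpolation over `[0, r + m]` is the interpolation with its own
value at `r` as boundary value; that value is estimated by `long_le_side`. On the other part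
`long_le_last` does the same. -/
lemma long_le_first {s : ℝ} (hs : 0 ≤ s) (hsr : s ≤ r) :
    stew K (r + m) s (md K A) (md K B) ≤ stew K r s (md K A) (md K D) := by
  have hr := sn_pos h.r_pos h.good_r
  have hl := sn_pos (add_pos h.r_pos h.m_pos) h.good
  have e (t) := stew_add_add K (r + m) t (md K A) (md K (A - (r + m))) 0
    (md K B - md K (A - (r + m)))
  simp only [add_zero, add_sub_cancel, stew_line (add_pos h.r_pos h.m_pos) h.good, mul_zero,
    zero_add] at e
  refine le_trans ?_ (stew_le_stew hs hsr h.good_r le_rfl h.long_le_side)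
  have h3 := stew_add_add K r s (md K A) (md K (A - r)) 0
    (sn K r * (md K B - md K (A - (r + m))) / sn K (r + m))
  rw [add_zero, stew_line h.r_pos h.good_r, mul_zero, zero_add] at h3
  rw [e, e, h3]
  apply le_of_eq
  field_simp

lemma long_le_last {ε : ℝ} (hε : 0 ≤ ε) (hεm : ε ≤ m) :
    stew K (r + m) (r + ε) (md K A) (md K B) ≤ stew K m ε (md K D) (md K B) := by
  have hm := sn_pos h.m_pos h.good_m
  have hl := sn_pos (add_pos h.r_pos h.m_pos) h.good
  have e (t) := stew_add_add K (r + m) t (md K (B + (r + m))) (md K (B + (r + m) - (r + m)))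
    (md K A - md K (B + (r + m))) 0
  simp only [add_zero, add_sub_cancel, stew_line (add_pos h.r_pos h.m_pos) h.good, mul_zero] at e
  rw [add_sub_cancel_right] at e
  refine le_trans ?_ (stew_le_stew hε hεm h.good_m h.long_le_side le_rfl)
  have h3 := stew_add_add K m ε (md K (B + m)) (md K (B + m - m))
    (sn K m * (md K A - md K (B + (r + m))) / sn K (r + m)) 0
  rw [add_zero, stew_line h.m_pos h.good_m, mul_zero, add_zero, add_sub_cancel_right] at h3
  rw [e, e, add_sub_cancel_left, show B + (r + m) - r = B + m by ring, h3,
    show B + (r + m) - (r + ε) = B + m - ε by ring, show r + m - (r + ε) = m - ε by ring]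
  apply le_of_eq
  field_simp

end Sizes

lemma eventually_pos_of_hasDerivAt {φ : ℝ → ℝ} {c : ℝ} (h : HasDerivAt φ c 0) (h0 : φ 0 = 0)
    (hc : 0 < c) : ∀ᶠ t in 𝓝[>] 0, 0 < φ t := by
  have h1 := (hasDerivAt_iff_tendsto_slope_zero.1 h).mono_left
    (nhdsWithin_mono 0 fun t (ht : 0 < t) => ht.ne')
  filter_upwards [h1.eventually (lt_mem_nhds hc), self_mem_nhdsWithin] with t ht ht'
  rw [zero_add, h0, sub_zero, smul_eq_mul] at ht
  exact (pos_iff_pos_of_mul_pos ht).1 (inv_pos.2 ht')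

end LorentzModel

/-! ### The gluing data and the first variation at `p`. -/

namespace LorentzModel

variable {X : Type*} {K : ℝ}

open Filter Topology

/-- The data of the gluing lemma, with `p ≪ y`. -/
structure Glue (K : ℝ) (P : TimeSep X) (x y z p : X) (Sxy Syz Sxp Spz Spy : Set X) : Prop where
  xy : P.Side x y Sxy
  yz : P.Side y z Syz
  xp : P.Side x p Sxp
  pz : P.Side p z Spz
  py : P.Side p y Spy
  bound₁ : P.TriBound K x p y Sxp Spy Sxy
  bound₂ : P.TriBound K p y z Spy Syz Spz
  add : P.T x p + P.T p z = P.T x z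
  good : Good K (P.T x z)
  xp_pos : 0 < P.T x p
  pz_pos : 0 < P.T p z
  py_pos : 0 < P.T p y
  yz_pos : 0 < P.T y z

namespace TimeSep

variable {P : TimeSep X}

section Side

variable {u v : X} {S : Set X} (h : P.Side u v S)

include h

lemma Side.left_mem_U : u ∈ P.U := h.sub h.left_mem

lemma Side.right_mem_U : v ∈ P.U := h.sub h.right_mem

lemma Side.le : P.le u v := h.le_left v h.right_mem

lemma Side.T_left : P.T u u = 0 := by linarith [h.add u h.left_mem]

end Side

/-- Passing to the limit with intermediate points. -/
lemma le_T_of_tendsto {a b : X} (ha : a ∈ P.U) (hb : b ∈ P.U) {f : ℝ → ℝ} {σ d : ℝ} (hd : 0 < d)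
    (hg : Good K d) (hf : ContinuousAt f σ) (hfσ : md K d ≤ f σ) {l : Filter ℝ} [l.NeBot]
    (hl : l ≤ 𝓝 σ) (H : ∀ᶠ t in l, ∃ c ∈ P.U, P.le a c ∧
      ∀ e, 0 < e → Good K e → md K e ≤ f t → e ≤ P.T c b) : d ≤ P.T a b := by
  by_contra! hc
  -- No semicontinuity of `T` is needed: any `e` strictly between `T a b` and `d` is already
  -- attained from a nearby `c`, and `a ≤ c` carries it over to `a`.
  obtain ⟨e, he, hed⟩ := exists_between (max_lt hc hd)
  have he0 := (le_max_right _ _).trans_lt he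
  have h1 : ∀ᶠ t in l, md K e < f t :=
    (hf.mono_left hl).eventually (lt_mem_nhds ((md_lt_md he0.le hed hg).trans_le hfσ))
  obtain ⟨t, ht, c, hcU, hac, h2⟩ := (h1.and H).exists
  have h3 := h2 e he0 (hg.mono hed.le) ht.le
  have h4 := P.add_le ha hcU hb hac (P.le_of_pos (he0.trans_le h3))
  linarith [P.nonneg a c, (le_max_left _ _).trans_lt he]

lemma le_T_of_tendsto' {a b : X} (ha : a ∈ P.U) (hb : b ∈ P.U) {f : ℝ → ℝ} {σ d : ℝ} (hd : 0 < d)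
    (hg : Good K d) (hf : ContinuousAt f σ) (hfσ : md K d ≤ f σ) {l : Filter ℝ} [l.NeBot]
    (hl : l ≤ 𝓝 σ) (H : ∀ᶠ t in l, ∃ c ∈ P.U, P.le c b ∧
      ∀ e, 0 < e → Good K e → md K e ≤ f t → e ≤ P.T a c) : d ≤ P.T a b :=
  le_T_of_tendsto (P := P.op) hb ha hd hg hf hfσ hl H

end TimeSep

namespace Glue

variable {P : TimeSep X} {x y z p : X} {Sxy Syz Sxp Spz Spy : Set X}
  (h : Glue K P x y z p Sxy Syz Sxp Spz Spy)

include h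

lemma hA : P.T x p + P.T p y ≤ P.T x y :=
  P.add_le h.xp.left_mem_U h.xp.right_mem_U h.xy.right_mem_U h.xp.le h.py.le

lemma hm : P.T p y + P.T y z ≤ P.T p z :=
  P.add_le h.py.left_mem_U h.py.right_mem_U h.yz.right_mem_U h.py.le h.yz.le

lemma hl : P.T x y + P.T y z ≤ P.T x p + P.T p z :=
  (P.add_le h.xy.left_mem_U h.xy.right_mem_U h.yz.right_mem_U h.xy.le h.yz.le).trans h.add.ge

/-- The first variation formula at `p`. -/
lemma angle : (md K (P.T x y) - md K (P.T x p + P.T p y)) * sn K (P.T p z) ≤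
    (md K (P.T p z - P.T p y) - md K (P.T y z)) * sn K (P.T x p) := by
  have hA := h.hA
  have hm := h.hm
  have hl := h.hl
  have hr0 := h.xp_pos
  have hm0 := h.pz_pos
  have hD0 := h.py_pos
  have hB0 := h.yz_pos
  have hgl : Good K (P.T x p + P.T p z) := h.add ▸ h.good
  have bx := h.bound₁.b₂ x h.xp.left_mem
  have bz := fun c hc => h.bound₂.b₁ c hc z h.pz.right_mem
  rw [h.xp.T_left] at bx
  have sx := h.py.surj
  have ux := fun c (hc : c ∈ Spy) => P.add_le h.xp.left_mem_U (h.py.sub hc) h.pz.right_mem_U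
    (P.le_trans h.xp.le (h.py.le_left c hc)) (P.le_trans (h.py.le_right c hc) h.yz.le)
  rw [← h.add] at ux
  clear h
  generalize P.T x p = r at *
  generalize P.T p z = m at *
  generalize P.T p y = D at *
  generalize P.T x y = A at *
  generalize P.T y z = B at *
  have hgr : Good K r := hgl.mono (by linarith)
  have hgm : Good K m := hgl.mono (by linarith)
  have hgD : Good K D := hgl.mono (by linarith)
  rw [stew_zero hr0 hgr] at bx
  simp only [stew_self hm0 hgm] at bz
  have nr := sn_pos hr0 hgr
  have nm := sn_pos hm0 hgm
  have nD := sn_pos hD0 hgD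
  by_contra! hc
  -- By the law of cosines `k₁` and `k₂` are `cosh - 1` of the comparison angles at `p` in `T₁` and
  -- `T₂`; the claim is `k₁ ≤ k₂`.
  obtain ⟨k₁, hk₁⟩ : ∃ k, k = (md K A - md K (r + D)) / sn K r / sn K D := ⟨_, rfl⟩
  obtain ⟨k₂, hk₂⟩ : ∃ k, k = (md K (m - D) - md K B) / sn K m / sn K D := ⟨_, rfl⟩
  have hk : k₂ < k₁ := by
    rw [hk₁, hk₂]
    apply div_lt_div_of_pos_right _ nD
    rwa [div_lt_div_iff₀ nm nr]
  -- With `k₂ < q < q' < k₁`, for small `σ` the separation from `x` is at least `r + σ (1 + q')` and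
  -- that to `z` at least `m - σ (1 + q)`. Their sum exceeds `r + m`, against the reverse triangle
  -- inequality.
  obtain ⟨q, hq, hq'⟩ := exists_between hk
  obtain ⟨q', hq₁, hq₂⟩ := exists_between hq'
  have e1 (σ) : stew K D σ (md K r) (md K A) = md K (r + σ) + sn K σ * sn K r * k₁ := by
    have := stew_add_add K D σ (md K r) (md K (r + D)) 0 (md K A - md K (r + D))
    rw [add_zero, add_sub_cancel, stew_line_add hD0 hgD, mul_zero, zero_add] at this
    rw [this, hk₁]; field_simp
  have e2 (σ) : stew K D σ (md K m) (md K B) = md K (m - σ) - sn K σ * sn K m * k₂ := by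
    have := stew_add_add K D σ (md K m) (md K (m - D)) 0 (md K B - md K (m - D))
    rw [add_zero, add_sub_cancel, stew_line hD0 hgD, mul_zero, zero_add] at this
    rw [this, hk₂]; field_simp; ring
  have hid : HasDerivAt (fun t : ℝ => t) 1 0 := hasDerivAt_id' 0
  have d1 : HasDerivAt (fun t => md K (r + t) + sn K t * sn K r * k₁ - md K (r + t * (1 + q')))
      (sn K r * (k₁ - q')) 0 := by
    have a1 := (hasDerivAt_md K (r + 0)).comp (0 : ℝ) (hid.const_add r)
    have a2 := ((hasDerivAt_sn K 0).mul_const (sn K r)).mul_const k₁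
    have a3 := (hasDerivAt_md K (r + 0 * (1 + q'))).comp (0 : ℝ)
      ((hid.mul_const (1 + q')).const_add r)
    refine ((a1.add a2).sub a3).congr_deriv ?_
    simp; ring
  have d2 : HasDerivAt (fun t => md K (m - t) - sn K t * sn K m * k₂ - md K (m - t * (1 + q)))
      (sn K m * (q - k₂)) 0 := by
    have a1 := (hasDerivAt_md K (m - 0)).comp (0 : ℝ) (hid.const_sub m)
    have a2 := ((hasDerivAt_sn K 0).mul_const (sn K m)).mul_const k₂
    have a3 := (hasDerivAt_md K (m - 0 * (1 + q))).comp (0 : ℝ)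
      ((hid.mul_const (1 + q)).const_sub m)
    refine ((a1.sub a2).sub a3).congr_deriv ?_
    simp; ring
  have v1 := eventually_pos_of_hasDerivAt d1 (by simp) (mul_pos nr (by linarith))
  have v2 := eventually_pos_of_hasDerivAt d2 (by simp) (mul_pos nm (by linarith))
  have t1 : Tendsto (fun t : ℝ => r + t * (1 + q')) (𝓝[>] 0) (𝓝 r) := by
    have : Continuous fun t : ℝ => r + t * (1 + q') := by fun_prop
    simpa using this.continuousAt.tendsto.mono_left (nhdsWithin_le_nhds (a := (0 : ℝ)))
  have t2 : Tendsto (fun t : ℝ => m - t * (1 + q)) (𝓝[>] 0) (𝓝 m) := by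
    have : Continuous fun t : ℝ => m - t * (1 + q) := by fun_prop
    simpa using this.continuousAt.tendsto.mono_left (nhdsWithin_le_nhds (a := (0 : ℝ)))
  have := v1.and (v2.and ((t1.eventually (Ioo_mem_nhds hr0 (show r < r + m by linarith))).and
    ((t2.eventually (Ioo_mem_nhds hm0 (show m < r + m by linarith))).and
    (eventually_mem_nhdsWithin.and
    (nhdsWithin_le_nhds (Iio_mem_nhds (lt_min hD0 hm0)))))))
  obtain ⟨σ, f1, f2, f3, f4, f5, f6⟩ := this.exists
  have f5 : 0 < σ := f5
  obtain ⟨f6, f7⟩ := lt_min_iff.1 (show σ < min D m from f6)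
  obtain ⟨c, hcS, rfl⟩ := sx σ f5.le f6.le
  have g1 := bx c hcS _ f3.1 (hgl.mono f3.2.le) (by rw [e1]; linarith)
  have g2 := (bz c hcS _ f4.1 (hgl.mono f4.2.le) (by rw [e2]; linarith)).1 f7
  have g3 := ux c hcS
  nlinarith

lemma sizes : Sizes K (P.T x p) (P.T p z) (P.T p y) (P.T x y) (P.T y z) where
  r_pos := h.xp_pos
  m_pos := h.pz_pos
  D_pos := h.py_pos
  B_pos := h.yz_pos
  hA := h.hA
  hm := h.hm
  hl := h.hl
  good := h.add ▸ h.good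
  angle := h.angle

end Glue

end LorentzModel

/-! ### Reverse triangle inequality through a point of a side. -/

namespace LorentzModel

variable {X : Type*} {K : ℝ}

open Filter Topology

namespace TimeSep

variable {P : TimeSep X}

/-- Reverse triangle inequality through a point of a side, when the lower bounds for the two
distances are known along the whole side. -/
lemma Side.add_le_of_stew {p y a b : X} {S : Set X} (hS : P.Side p y S) (hD : 0 < P.T p y)
    (hgD : Good K (P.T p y)) (ha : a ∈ P.U) (hb : b ∈ P.U) {f g f' g' σ u v α β : ℝ}
    (Ha : ∀ c ∈ S, ∀ e, 0 < e → Good K e → md K e ≤ stew K (P.T p y) (P.T p c) f g →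
      α < P.T p c → e ≤ P.T a c)
    (Hb : ∀ c ∈ S, ∀ e, 0 < e → Good K e → md K e ≤ stew K (P.T p y) (P.T p c) f' g' →
      P.T p c < β → e ≤ P.T c b)
    (hσ : 0 ≤ σ) (hσD : σ ≤ P.T p y) (hu : 0 ≤ u) (hv : 0 ≤ v) (huv : 0 < u + v)
    (hg : Good K (u + v)) (hfu : md K u ≤ stew K (P.T p y) σ f g)
    (hfv : md K v ≤ stew K (P.T p y) σ f' g') (hα : α + u ≤ σ) (hβ : σ + v ≤ β)
    (hu0 : u = 0 → md K σ ≤ f ∧ md K (P.T p y - σ) ≤ g)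
    (hv0 : v = 0 → md K σ ≤ f' ∧ md K (P.T p y - σ) ≤ g')
    (hy : u = 0 → σ = P.T p y → P.le a y) (hp : v = 0 → σ = 0 → P.le p b) :
    u + v ≤ P.T a b := by
  -- If `u = 0`, the bound at the crossing point does not relate it to `a`. Points at parameter `t >
  -- σ` do follow `a`, since `hu0` gives the lower bound `t - σ`, and `t` tends to `σ`; at the end
  -- of the side `hy` supplies the relation. The case `v = 0` is symmetric.
  rcases hu.eq_or_lt with rfl | hu'
  · rw [zero_add] at huv hg ⊢
    rcases hσD.eq_or_lt with rfl | hσD'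
    · have h1 := hy rfl rfl
      have h2 := Hb y hS.right_mem v huv hg hfv (by linarith)
      have h3 := P.add_le ha hS.right_mem_U hb h1 (P.le_of_pos (huv.trans_le h2))
      linarith [P.nonneg a y]
    · obtain ⟨h1, h2⟩ := hu0 rfl
      refine le_T_of_tendsto ha hb huv hg (continuous_stew K (P.T p y) f' g').continuousAt hfv
        (nhdsWithin_le_nhds (s := Set.Ioi σ)) ?_
      filter_upwards [self_mem_nhdsWithin, nhdsWithin_le_nhds (Iio_mem_nhds hσD'),
        nhdsWithin_le_nhds (Iio_mem_nhds (show σ < β by linarith))] with t ht ht' ht''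
      have ht : σ < t := ht
      have ht' : t < P.T p y := ht'
      obtain ⟨c, hc, rfl⟩ := hS.surj t (by linarith) ht'.le
      refine ⟨c, hS.sub hc, P.le_of_pos ((sub_pos.2 ht).trans_le (Ha c hc _ (sub_pos.2 ht)
        (hgD.mono (by linarith)) ?_ (by linarith))), fun e he hge hle => Hb c hc e he hge hle ht''⟩
      rw [md_sub_comm]
      exact md_sub_le_stew hD hgD (by linarith) ht'.le h1 (by rwa [md_sub_comm])
  rcases hv.eq_or_lt with rfl | hv'
  · rw [add_zero] at huv hg ⊢
    rcases hσ.eq_or_lt with rfl | hσ'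
    · have h1 := hp rfl rfl
      have h2 := Ha p hS.left_mem u huv hg (by rwa [hS.T_left]) (by rw [hS.T_left]; linarith)
      have h3 := P.add_le ha hS.left_mem_U hb (P.le_of_pos (huv.trans_le h2)) h1
      linarith [P.nonneg p b]
    · obtain ⟨h1, h2⟩ := hv0 rfl
      refine le_T_of_tendsto' ha hb huv hg (continuous_stew K (P.T p y) f g).continuousAt hfu
        (nhdsWithin_le_nhds (s := Set.Iio σ)) ?_
      filter_upwards [self_mem_nhdsWithin, nhdsWithin_le_nhds (Ioi_mem_nhds hσ'),
        nhdsWithin_le_nhds (Ioi_mem_nhds (show α < σ by linarith))] with t ht ht' ht''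
      have ht : t < σ := ht
      have ht' : 0 < t := ht'
      obtain ⟨c, hc, rfl⟩ := hS.surj t ht'.le (by linarith)
      refine ⟨c, hS.sub hc, P.le_of_pos ((sub_pos.2 ht).trans_le (Hb c hc _ (sub_pos.2 ht)
        (hgD.mono (by linarith)) ?_ (by linarith))), fun e he hge hle => Ha c hc e he hge hle ht''⟩
      exact md_sub_le_stew hD hgD ht'.le (by linarith) h1 (by rwa [md_sub_comm])
  · obtain ⟨c, hc, rfl⟩ := hS.surj σ hσ hσD
    have h1 := Ha c hc u hu' (hg.mono (by linarith)) hfu (by linarith)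
    have h2 := Hb c hc v hv' (hg.mono (by linarith)) hfv (by linarith)
    have h3 := P.add_le ha (hS.sub hc) hb (P.le_of_pos (hu'.trans_le h1))
      (P.le_of_pos (hv'.trans_le h2))
    linarith

open QPt

/-- The case of a model segment leaving through `[o, p]`. Comparing values of `F` from `o` gives `sa
+ u ≤ s ≤ sq - d + u`. The first inequality is the order needed for `Ha`; the second lets the linear
bound `Hb` suffice for the far piece. -/
lemma Side.le_T_of_isPt {x p a b : X} {S : Set X} (hS : P.Side x p S) (hr : 0 < P.T x p)
    (ha : a ∈ P.U) (hb : b ∈ P.U) {s sa sq d u : ℝ} {o p' a' q c : QPt K} (hd : 0 < d)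
    (hgq : Good K sq) (hop : F o p' = md K (P.T x p)) (hoa : F o a' = md K sa)
    (hoq : F o q = md K sq) (haq : F a' q = md K d) (hu : 0 ≤ u) (hud : u ≤ d)
    (hc : IsPt a' q d u c) (hc' : IsPt o p' (P.T x p) s c) (hs : 0 ≤ s) (hsr : s < P.T x p)
    (hsa : 0 ≤ sa) (hsad : sa + d ≤ sq) (hrq : P.T x p ≤ sq)
    (Ha : ∀ e ∈ S, ∀ t, 0 < t → Good K t →
      md K t ≤ stew K (P.T x p) (P.T x e) (md K sa) (F a' p') → sa < P.T x e → t ≤ P.T a e)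
    (Hb : ∀ e ∈ S, sq - P.T x e ≤ P.T e b) : d ≤ P.T a b := by
  have hgr : Good K (P.T x p) := hgq.mono hrq
  have hgd : Good K d := hgq.mono (by linarith)
  have e1 := hc o
  rw [hc'.F_left hr hgr hop, hoa, hoq] at e1
  have i1 : sa + u ≤ s := le_of_md_le hs (hgq.mono (by linarith)) <| by
    rw [e1]
    exact md_add_le_stew hd hgd hu hud le_rfl (md_le_md (by linarith) hsad hgq)
  have i2 : s ≤ sq - d + u := le_of_md_le (by linarith) (hgr.mono hsr.le) <| by
    rw [e1]
    exact stew_le_md_add hd hgd hu hud (md_le_md hsa (by linarith) (hgq.mono (by linarith)))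
      (by rw [sub_add_cancel])
  have key := hS.add_le_of_stew (K := K) (f := md K sa) (g := F a' p') (f' := md K sq)
    (g' := md K (sq - P.T x p)) (σ := s) (u := u) (v := d - u) (α := sa) (β := sq) hr hgr ha hb Ha
    ?_ hs hsr.le hu (by linarith) (by linarith) (by rwa [add_sub_cancel]) ?_ ?_ i1 (by linarith)
    ?_ ?_ ?_ ?_
  · rwa [add_sub_cancel] at key
  · intro e he t ht hgt hle _
    rw [stew_line hr hgr] at hle
    have h1 := hS.add e he
    have h2 := P.nonneg e p
    exact (le_of_md_le (by linarith) hgt hle).trans (Hb e he)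
  · have h1 := hc' a'
    rw [hc.F_left hd hgd haq, F_comm, hoa] at h1
    exact h1.le
  · rw [stew_line hr hgr]
    exact md_le_md (by linarith) (by linarith) (hgq.mono (by linarith))
  · rintro rfl
    have h1 := hc o
    have h2 := hc p'
    rw [stew_zero hd hgd] at h1 h2
    rw [hc'.F_left hr hgr hop, hoa] at h1
    rw [hc'.F_right hr hgr hop, F_comm] at h2
    exact ⟨h1.le, h2.le⟩
  -- A far piece of length zero would put `q`, at distance `sq ≥ T x p` from `o`, at parameter `s <
  -- T x p`.
  · intro hv
    have h1 := hc o
    rw [show u = d by linarith, stew_self hd hgd, hc'.F_left hr hgr hop, hoq] at h1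
    have := eq_of_md_eq hs (hr.le.trans hrq) (hgr.mono hsr.le) hgq h1
    linarith
  · intro _ h
    linarith
  · intro hv
    have h1 := hc o
    rw [show u = d by linarith, stew_self hd hgd, hc'.F_left hr hgr hop, hoq] at h1
    have := eq_of_md_eq hs (hr.le.trans hrq) (hgr.mono hsr.le) hgq h1
    linarith

end TimeSep

end LorentzModel

/-! ### Points of `[x, y]` against points of `[p, z]`. -/

namespace LorentzModel

variable {X : Type*} {K : ℝ}

namespace QPt

/-- The common endpoint `p` is assigned to `[p, y]`, so that `s < r` is strict in the second
alternative. -/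
lemma exists_isPt_or {o y p c : QPt K} {r D : ℝ} (hr : 0 < r) (hgr : Good K r) (hD : 0 < D)
    (hgD : Good K D) (h : (∃ σ, 0 ≤ σ ∧ σ ≤ D ∧ IsPt p y D σ c) ∨
      ∃ s, 0 ≤ s ∧ s ≤ r ∧ IsPt o p r s c) :
    (∃ σ, 0 ≤ σ ∧ σ ≤ D ∧ IsPt p y D σ c) ∨ ∃ s, 0 ≤ s ∧ s < r ∧ IsPt o p r s c := by
  rcases h with h | ⟨s, hs, hsr, h⟩
  · exact Or.inl h
  rcases hsr.eq_or_lt with rfl | hsr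
  · refine Or.inl ⟨0, le_rfl, hD.le, fun x => ?_⟩
    rw [h, stew_self hr hgr, stew_zero hD hgD]
  · exact Or.inr ⟨s, hs, hsr, h⟩

end QPt

open QPt

namespace Glue

variable {P : TimeSep X} {x y z p : X} {Sxy Syz Sxp Spz Spy : Set X}
  (h : Glue K P x y z p Sxy Syz Sxp Spz Spy)

include h

lemma T_x {q : X} (hq : q ∈ Spz) : P.T x q = P.T x p + P.T p q := by
  have hp := h.xp.right_mem_U
  have h1 := P.add_le h.xp.left_mem_U hp (h.pz.sub hq) h.xp.le (h.pz.le_left q hq)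
  have h2 := P.add_le h.xp.left_mem_U (h.pz.sub hq) h.pz.right_mem_U
    (P.le_trans h.xp.le (h.pz.le_left q hq)) (h.pz.le_right q hq)
  linarith [h.add, h.pz.add q hq]

lemma T_z {e : X} (he : e ∈ Sxp) : P.T e z = P.T e p + P.T p z := by
  have hp := h.xp.right_mem_U
  have h1 := P.add_le (h.xp.sub he) hp h.pz.right_mem_U (h.xp.le_right e he) h.pz.le
  have h2 := P.add_le h.xp.left_mem_U (h.xp.sub he) h.pz.right_mem_U (h.xp.le_left e he)
    (P.le_trans (h.xp.le_right e he) h.pz.le)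
  linarith [h.add, h.xp.add e he]

lemma xy_py {a : X} (ha : a ∈ Sxy) {c : X} (hc : c ∈ Spy) {d : ℝ} (hd : 0 < d) (hg : Good K d)
    (hle : md K d ≤ stew K (P.T p y) (P.T p c)
      (stew K (P.T x y) (P.T x a) (md K (P.T x p)) (md K (P.T p y)))
      (md K (P.T x y - P.T x a))) :
    (P.T p y - (P.T x y - P.T x a) < P.T p c → d ≤ P.T a c) ∧
      (P.T p c < P.T p y - (P.T x y - P.T x a) → d ≤ P.T c a) := by
  have h1 := h.xy.add a ha
  have h2 := h.py.add c hc
  have := h.bound₁.b₃ a ha c hc d hd hg (by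
    rwa [show P.T a y = P.T x y - P.T x a by linarith])
  exact ⟨fun h' => this.1 (by linarith), fun h' => this.2 (by linarith)⟩

/-- Seen from `x`, the model of `q` lies beyond the triangle `T₁`, so the segment from `a` leaves
`T₁` through `[p, y]` or `[x, p]`. On `[p, y]` the first piece is controlled by `T₁` and the second
by `T₂`. -/
lemma xy_pz_forward {a : X} (ha : a ∈ Sxy) {q : X} (hq : q ∈ Spz) {d : ℝ} (hd : 0 < d)
    (hg : Good K d) (hdeq : md K d = stew K (P.T x y) (P.T x a) (md K (P.T x p + P.T p q))
      (stew K (P.T p z) (P.T p q) (md K (P.T p y)) (md K (P.T y z))))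
    (hlt : P.T x a + d ≤ P.T x p + P.T p q) : d ≤ P.T a q := by
  have hs := h.sizes
  have hr0 := hs.r_pos
  have hD0 := hs.D_pos
  have hgr := hs.good_r
  have hgD := hs.good_D
  have hA := hs.hA
  have e1 := h.xy.add a ha
  have e2 := h.pz.add q hq
  have n1 := P.nonneg x a
  have n2 := P.nonneg a y
  have n3 := P.nonneg p q
  have n4 := P.nonneg q z
  have hgq : Good K (P.T x p + P.T p q) := hs.good.mono (by linarith)
  obtain ⟨o, y', p', q', a', c, u, hoy, hop, hpy, hoq, hqy, hpq, haI, haq, hu, hud, hc, hdisj⟩ :=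
    exists_hinge (sy := P.T x y) (r := P.T x p) (D := P.T p y) (sq := P.T x p + P.T p q)
      (sa := P.T x a) hs.A_pos hs.good_A hr0 hgr hD0 hgD
      (md_le_md hD0.le (by linarith) (hs.good_A.mono (by linarith))) (by linarith) hgq
      (hs.stew_m_le' n3 (by linarith)) (hs.hinge_first n3 (by linarith)) n1 (by linarith) hd hg hdeq
  have hoa := haI.F_left hs.A_pos hs.good_A hoy
  have hya := haI.F_right hs.A_pos hs.good_A hoy
  have hpa : F a' p' = stew K (P.T x y) (P.T x a) (md K (P.T x p)) (md K (P.T p y)) := by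
    rw [F_comm, haI, F_comm, hop, hpy]
  rw [add_sub_cancel_left] at hpq
  rcases exists_isPt_or hr0 hgr hD0 hgD hdisj with ⟨σ, hσ, hσD, hc'⟩ | ⟨s, hs0, hsr, hc'⟩
  · have hoc := hc o
    rw [hc', hop, hoy, hoa, hoq] at hoc
    -- `i1` and `i2` estimate the value of `F` from `o` at the crossing point in two ways; they
    -- place it after `a` and before `q`, which are the order conditions in the two curvature
    -- bounds.
    have i1 : P.T x p + σ ≤ P.T x p + P.T p q - d + u := by
      refine le_of_md_le (by linarith) (hs.good_A.mono (by linarith))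
        ((md_add_le_stew hD0 hgD hσ hσD le_rfl (md_le_md (by linarith) hA hs.good_A)).trans ?_)
      rw [hoc]
      exact stew_le_md_add hd hg hu hud (md_le_md n1 (by linarith) (hgq.mono (by linarith)))
        (by rw [sub_add_cancel])
    have i2 : P.T x a + u ≤ P.T x y - P.T p y + σ := by
      refine le_of_md_le (by linarith) (hgq.mono (by linarith))
        ((md_add_le_stew hd hg hu hud le_rfl (md_le_md (by linarith) hlt hgq)).trans ?_)
      rw [← hoc]
      exact stew_le_md_add hD0 hgD hσ hσD
        (md_le_md hr0.le (by linarith) (hs.good_A.mono (by linarith))) (by rw [sub_add_cancel])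
    have key := h.py.add_le_of_stew (K := K)
      (f := F a' p') (g := md K (P.T x y - P.T x a)) (f' := md K (P.T p q))
      (g' := stew K (P.T p z) (P.T p q) (md K (P.T p y)) (md K (P.T y z)))
      (σ := σ) (u := u) (v := d - u) (α := P.T p y - (P.T x y - P.T x a)) (β := P.T p q)
      hD0 hgD (h.xy.sub ha) (h.pz.sub hq)
      (fun c hc e he hge hle => (h.xy_py ha hc he hge (by rwa [← hpa])).1)
      (fun c hc e he hge hle => (h.bound₂.b₁ c hc q hq e he hge hle).1) hσ hσD hu (by linarith)
      (by linarith) (by rwa [add_sub_cancel]) ?_ ?_ (by linarith) (by linarith) ?_ ?_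
      (fun _ _ => h.xy.le_right a ha) (fun _ _ => h.pz.le_left q hq)
    · rwa [add_sub_cancel] at key
    · rw [← hc.F_left hd hg haq, hc', F_comm a' y', hya]
    · rw [← hc.F_right hd hg haq, hc', F_comm, hqy]
      exact stew_le_stew hσ hσD hgD hpq le_rfl
    · rintro rfl
      have h1 := hc p'
      have h2 := hc y'
      rw [stew_zero hd hg] at h1 h2
      rw [hc'.F_left hD0 hgD hpy, F_comm] at h1
      rw [hc'.F_right hD0 hgD hpy, hya] at h2
      exact ⟨h1.le, h2.le⟩
    · intro hv
      have h1 := hc p'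
      have h2 := hc y'
      rw [show u = d by linarith, stew_self hd hg] at h1 h2
      rw [hc'.F_left hD0 hgD hpy] at h1
      rw [hc'.F_right hD0 hgD hpy, F_comm, hqy] at h2
      exact ⟨h1.le.trans hpq, h2.le⟩
  · refine h.xp.le_T_of_isPt hr0 (h.xy.sub ha) (h.pz.sub hq) hd hgq hop hoa hoq haq hu hud hc hc'
      hs0 hsr n1 hlt (by linarith) (fun e he t ht hgt hle => (h.bound₁.b₁ e he a ha t ht hgt
        (by rwa [← hpa])).2) fun e he => ?_
    have h1 := h.xp.add e he
    have h2 := P.add_le (h.xp.sub he) h.xp.right_mem_U (h.pz.sub hq) (h.xp.le_right e he)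
      (h.pz.le_left q hq)
    linarith

/-- Here `q` comes first. The figure is that of the forward case, but an exit through `[x, p]` is
impossible: it would lie at distance at least `T x p` from `x`. -/
lemma xy_pz_backward {a : X} (ha : a ∈ Sxy) {q : X} (hq : q ∈ Spz) {d : ℝ} (hd : 0 < d)
    (hg : Good K d) (hdeq : md K d = stew K (P.T x y) (P.T x a) (md K (P.T x p + P.T p q))
      (stew K (P.T p z) (P.T p q) (md K (P.T p y)) (md K (P.T y z))))
    (hlt : P.T x p + P.T p q + d ≤ P.T x a) : d ≤ P.T q a := by
  have hs := h.sizes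
  have hr0 := hs.r_pos
  have hD0 := hs.D_pos
  have hgr := hs.good_r
  have hgD := hs.good_D
  have hA := hs.hA
  have e1 := h.xy.add a ha
  have e2 := h.pz.add q hq
  have n1 := P.nonneg x a
  have n2 := P.nonneg a y
  have n3 := P.nonneg p q
  have n4 := P.nonneg q z
  have hgq : Good K (P.T x p + P.T p q) := hs.good.mono (by linarith)
  obtain ⟨o, y', p', q', a', c, u, hoy, hop, hpy, hoq, hqy, hpq, haI, haq, hu, hud, hc, hdisj⟩ :=
    exists_hinge (sy := P.T x y) (r := P.T x p) (D := P.T p y) (sq := P.T x p + P.T p q)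
      (sa := P.T x a) hs.A_pos hs.good_A hr0 hgr hD0 hgD
      (md_le_md hD0.le (by linarith) (hs.good_A.mono (by linarith))) (by linarith) hgq
      (hs.stew_m_le' n3 (by linarith)) (hs.hinge_first n3 (by linarith)) n1 (by linarith) hd hg hdeq
  have hoa := haI.F_left hs.A_pos hs.good_A hoy
  have hya := haI.F_right hs.A_pos hs.good_A hoy
  have hpa : F a' p' = stew K (P.T x y) (P.T x a) (md K (P.T x p)) (md K (P.T p y)) := by
    rw [F_comm, haI, F_comm, hop, hpy]
  rw [add_sub_cancel_left] at hpq
  have hgα : Good K (P.T x y - P.T x a + d) := hs.good_A.mono (by linarith)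
  -- The reverse triangle inequality from `q` through `a` to `y` in the model: were this value
  -- smaller, Stewart's formula along `[o, y]` would force `F` of `a` and `q` below `md K d`.
  have hyq : md K (P.T x y - P.T x a + d) ≤ F y' q' := by
    by_contra! hlt'
    have h1 : stew K (P.T x y) (P.T x a) (md K (P.T x p + P.T p q)) (F y' q') <
        stew K (P.T x y) (P.T x a) (md K (P.T x a - d)) (md K (P.T x a - d - P.T x y)) := by
      refine (stew_le_stew (f' := md K (P.T x a - d)) n1 (by linarith) hs.good_A
        (md_le_md (by linarith) (by linarith) (hs.good_A.mono (by linarith))) le_rfl).trans_lt ?_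
      rw [← sub_pos, show P.T x a - d - P.T x y = -(P.T x y - P.T x a + d) by ring, md_neg]
      have n5 := sn_pos (show 0 < P.T x a by linarith) (hs.good_A.mono (by linarith))
      have n6 := sn_pos hs.A_pos hs.good_A
      rw [show stew K (P.T x y) (P.T x a) (md K (P.T x a - d)) (md K (P.T x y - P.T x a + d)) -
        stew K (P.T x y) (P.T x a) (md K (P.T x a - d)) (F y' q') =
        sn K (P.T x a) * (md K (P.T x y - P.T x a + d) - F y' q') / sn K (P.T x y) by
          unfold stew; ring]
      have := sub_pos.2 hlt'
      positivity
    rw [stew_line hs.A_pos hs.good_A, F_comm, hqy, ← hdeq, sub_sub_cancel_left, md_neg] at h1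
    exact lt_irrefl _ h1
  -- Otherwise the bound for `T₂` would put `q` after `y`, with `T x q` too large.
  have hεD : P.T p q ≤ P.T p y := by
    by_contra! hlt'
    have h1 := (h.bound₂.b₁ y h.py.right_mem q hq _ (show 0 < P.T x y - P.T x a + d by linarith)
      hgα (by rwa [stew_self hD0 hgD, ← hqy, F_comm])).1 hlt'
    have h2 := P.add_le h.xy.left_mem_U h.xy.right_mem_U (h.pz.sub hq) h.xy.le
      (P.le_of_pos (by linarith))
    rw [h.T_x hq] at h2
    linarith
  have hyq' : F y' q' ≤ md K (P.T p y - P.T p q) := by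
    rw [F_comm, hqy]; exact hs.stew_m_le n3 (by linarith)
  have i0 : P.T x y - P.T x a + d ≤ P.T p y - P.T p q :=
    le_of_md_le (by linarith) hgα (hyq.trans hyq')
  rcases exists_isPt_or hr0 hgr hD0 hgD hdisj with ⟨σ, hσ, hσD, hc'⟩ | ⟨s, hs0, hsr, hc'⟩
  · have hyc := hc y'
    rw [hc'.F_right hD0 hgD hpy, hya] at hyc
    have i1 : P.T p y - σ ≤ P.T p y - P.T p q - d + u := by
      refine le_of_md_le (by linarith) (hgD.mono (by linarith)) ?_
      rw [hyc]
      exact stew_le_md_add hd hg hu hud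
        (md_le_md (by linarith) (by linarith) (hgD.mono (by linarith))) (by rwa [sub_add_cancel])
    have i2 : P.T x y - P.T x a + u ≤ P.T p y - σ := by
      refine le_of_md_le (by linarith) (hgα.mono (by linarith)) ?_
      rw [hyc]
      exact md_add_le_stew hd hg hu hud le_rfl hyq
    have key := h.py.add_le_of_stew (K := K)
      (f' := F a' p') (g' := md K (P.T x y - P.T x a)) (f := md K (P.T p q))
      (g := stew K (P.T p z) (P.T p q) (md K (P.T p y)) (md K (P.T y z)))
      (σ := σ) (u := d - u) (v := u) (β := P.T p y - (P.T x y - P.T x a)) (α := P.T p q)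
      hD0 hgD (h.pz.sub hq) (h.xy.sub ha)
      (fun c hc e he hge hle => (h.bound₂.b₁ c hc q hq e he hge hle).2)
      (fun c hc e he hge hle => (h.xy_py ha hc he hge (by rwa [← hpa])).2)
      hσ hσD (by linarith) hu
      (by linarith) (by rwa [sub_add_cancel]) ?_ ?_ (by linarith) (by linarith) ?_ ?_
      (fun _ _ => by linarith) (fun _ _ => by linarith)
    · rwa [sub_add_cancel] at key
    · rw [← hc.F_right hd hg haq, hc', F_comm, hqy]
      exact stew_le_stew hσ hσD hgD hpq le_rfl
    · rw [← hc.F_left hd hg haq, hc', F_comm a' y', hya]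
    · intro hv
      have h1 := hc p'
      have h2 := hc y'
      rw [show u = d by linarith, stew_self hd hg] at h1 h2
      rw [hc'.F_left hD0 hgD hpy] at h1
      rw [hc'.F_right hD0 hgD hpy, F_comm, hqy] at h2
      exact ⟨h1.le.trans hpq, h2.le⟩
    · rintro rfl
      have h1 := hc p'
      have h2 := hc y'
      rw [stew_zero hd hg] at h1 h2
      rw [hc'.F_left hD0 hgD hpy, F_comm] at h1
      rw [hc'.F_right hD0 hgD hpy, hya] at h2
      exact ⟨h1.le, h2.le⟩
  · have hoc := hc o
    rw [hc'.F_left hr0 hgr hop, hoa, hoq] at hoc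
    have := le_of_md_le (K := K) (s := P.T x p + P.T p q + d - u) (t := s) hs0
      (hs.good_A.mono (by linarith)) (by
        rw [hoc]
        exact md_sub_le_stew hd hg hu hud
          (md_le_md (by linarith) hlt (hs.good_A.mono (by linarith))) (by rw [add_sub_cancel_right]))
    linarith

end Glue

end LorentzModel

/-! ### Points of `[x, p]` against points of `[y, z]`. -/

namespace LorentzModel

variable {X : Type*} {K : ℝ}

open QPt

namespace Glue

variable {P : TimeSep X} {x y z p : X} {Sxy Syz Sxp Spz Spy : Set X}
  (h : Glue K P x y z p Sxy Syz Sxp Spz Spy)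

include h

/-- The comparison value is at most `md K` of the difference of distances from `x`, so it equals `md
K d'` for some `d' ≥ d` obeying the size conditions of the exact versions. -/
lemma xy_pz {a : X} (ha : a ∈ Sxy) {q : X} (hq : q ∈ Spz) {d : ℝ} (hd : 0 < d)
    (hg : Good K d) (hle : md K d ≤ stew K (P.T x y) (P.T x a) (md K (P.T x p + P.T p q))
      (stew K (P.T p z) (P.T p q) (md K (P.T p y)) (md K (P.T y z)))) :
    (P.T x a < P.T x p + P.T p q → d ≤ P.T a q) ∧
      (P.T x p + P.T p q < P.T x a → d ≤ P.T q a) := by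
  have hs := h.sizes
  have hr0 := hs.r_pos
  have e1 := h.xy.add a ha
  have e2 := h.pz.add q hq
  have n1 := P.nonneg x a
  have n2 := P.nonneg a y
  have n3 := P.nonneg p q
  have n4 := P.nonneg q z
  have hl := hs.hl
  have hB := hs.B_pos
  have hv : stew K (P.T x y) (P.T x a) (md K (P.T x p + P.T p q))
      (stew K (P.T p z) (P.T p q) (md K (P.T p y)) (md K (P.T y z))) ≤
        md K |P.T x p + P.T p q - P.T x a| := by
    rw [md_abs]
    refine stew_le_md_sub hs.A_pos hs.good_A n1 (by linarith) le_rfl ?_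
    rw [md_sub_comm]
    exact hs.stew_m_le' n3 (by linarith)
  obtain ⟨d', h0, h1, h2⟩ := exists_md_eq (abs_nonneg _) ((md_nonneg K d).trans hle) hv
  have hgl : Good K |P.T x p + P.T p q - P.T x a| :=
    hs.good.mono (abs_le.2 ⟨by linarith, by linarith⟩)
  have hdd : d ≤ d' := le_of_md_le h0 hg (by rwa [h2])
  refine ⟨fun hlt => hdd.trans ?_, fun hlt => hdd.trans ?_⟩
  · rw [abs_of_pos (by linarith)] at h1
    exact h.xy_pz_forward ha hq (by linarith) (hgl.mono (h1.trans (le_abs_self _))) h2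
      (by linarith)
  · rw [abs_of_neg (by linarith)] at h1
    exact h.xy_pz_backward ha hq (by linarith) (hgl.mono (h1.trans (neg_le_abs _))) h2
      (by linarith)

/-- The hinge now sits at `z`, with `e` beyond `p`; the model segment starts at `b` and runs into
the past. -/
lemma xp_yz_of_eq {e : X} (he : e ∈ Sxp) {b : X} (hb : b ∈ Syz) {d : ℝ} (hd : 0 < d)
    (hg : Good K d) (hdeq : md K d = stew K (P.T y z) (P.T y b)
      (stew K (P.T x p) (P.T x e) (md K (P.T x y)) (md K (P.T p y)))
      (md K (P.T p z + (P.T x p - P.T x e))))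
    (hlt : P.T b z + d ≤ P.T p z + (P.T x p - P.T x e)) : d ≤ P.T e b := by
  have hs := h.sizes
  have hr0 := hs.r_pos
  have hm0 := hs.m_pos
  have hD0 := hs.D_pos
  have hgm := hs.good_m
  have hgr := hs.good_r
  have hgD := hs.good_D
  have hgB := hs.good_B
  have hA := hs.hA
  have hm := hs.hm
  have e1 := h.xp.add e he
  have e2 := h.yz.add b hb
  have n1 := P.nonneg x e
  have n2 := P.nonneg e p
  have n3 := P.nonneg y b
  have n4 := P.nonneg b z
  have hgq : Good K (P.T p z + (P.T x p - P.T x e)) := hs.good.mono (by linarith)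
  rw [show P.T y b = P.T y z - P.T b z by linarith, stew_rev] at hdeq
  obtain ⟨o, y', p', q', a', c, u, hoy, hop, hpy, hoq, hqy, hpq, haI, haq, hu, hud, hc, hdisj⟩ :=
    exists_hinge (sy := P.T y z) (r := P.T p z) (D := P.T p y)
      (sq := P.T p z + (P.T x p - P.T x e))
      (sa := P.T b z) hs.B_pos hs.good_B hm0 hgm hD0 hgD
      (by
        rw [md_sub_comm]
        exact md_le_md hD0.le (by linarith) (hgm.mono (by linarith [hs.B_pos])))
      (by linarith) hgq
      (by
        rw [md_sub_comm, show P.T p z + (P.T x p - P.T x e) - P.T y z =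
          P.T x p + P.T p z - P.T y z - P.T x e by ring]
        exact hs.stew_r_le n1 (by linarith))
      (hs.hinge_last n1 (by linarith)) n4 (by linarith) hd hg hdeq
  have hoa := haI.F_left hs.B_pos hs.good_B hoy
  have hya := haI.F_right hs.B_pos hs.good_B hoy
  have hpa : F p' a' = stew K (P.T y z) (P.T b z) (md K (P.T p z)) (md K (P.T p y)) := by
    rw [haI, F_comm, hop, hpy]
  rw [add_sub_cancel_left] at hpq
  have leb (e') (hl : P.le e' y) : P.le e' b := P.le_trans hl (h.yz.le_left b hb)
  rcases exists_isPt_or hm0 hgm hD0 hgD hdisj with ⟨σ, hσ, hσD, hc'⟩ | ⟨s, hs0, hsr, hc'⟩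
  · obtain ⟨c₁, hc₁, rfl⟩ := h.py.surj σ hσ hσD
    have e3 := h.py.add c₁ hc₁
    -- Every point of `[p, y]` is causally between `e` and `b`, so pieces of length zero need no
    -- limit here.
    have hlec : P.le e c₁ := P.le_trans (h.xp.le_right e he) (h.py.le_left c₁ hc₁)
    have hlcb : P.le c₁ b := leb c₁ (h.py.le_right c₁ hc₁)
    have h1 : u ≤ P.T c₁ b := by
      rcases hu.eq_or_lt with rfl | hu
      · exact P.nonneg _ _
      refine h.bound₂.b₂ c₁ hc₁ b hb u hu (hg.mono hud) ?_
      rw [← hc.F_left hd hg haq, F_comm, haI, show P.T y b = P.T y z - P.T b z by linarith,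
        stew_rev, F_comm c y', hc'.F_right hD0 hgD hpy, F_comm, hc', hop, hoy,
        show P.T p y - P.T p c₁ = P.T c₁ y by linarith]
    have h2 : d - u ≤ P.T e c₁ := by
      rcases (sub_nonneg.2 hud).eq_or_lt with hv | hv
      · rw [← hv]; exact P.nonneg _ _
      refine h.bound₁.b₂ e he c₁ hc₁ _ hv (hg.mono (by linarith)) ?_
      rw [← hc.F_right hd hg haq, hc', hqy, F_comm]
      exact stew_le_stew hσ hσD hgD (by rwa [show P.T e p = P.T x p - P.T x e by linarith]) le_rfl
    have := P.add_le (h.xp.sub he) (h.py.sub hc₁) (h.yz.sub hb) hlec hlcb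
    linarith
  · have hS := h.pz.op
    have := hS.le_T_of_isPt (a := b) (b := e) hm0 (h.yz.sub hb) (h.xp.sub he) hd hgq hop hoa hoq
      haq hu hud hc hc' hs0 hsr n4 hlt
      (show P.T p z ≤ P.T p z + (P.T x p - P.T x e) by linarith) ?_ ?_
    · exact this
    · intro e' he' t ht hgt hle hlt'
      have e3 := h.pz.add e' he'
      refine (h.bound₂.b₃ e' he' b hb t ht hgt ?_).1 hlt'
      refine hle.trans_eq ?_
      show stew K (P.T p z) (P.T e' z) (md K (P.T b z)) (F a' p') = _
      rw [F_comm, hpa, stew_comm_first hm0 hgm hs.B_pos hgB]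
      rw [show P.T y b = P.T y z - P.T b z by linarith, stew_rev,
        show P.T e' z = P.T p z - P.T p e' by linarith, stew_rev]
    · intro e' he'
      have e3 := h.pz.add e' he'
      have := P.add_le (h.xp.sub he) h.xp.right_mem_U (h.pz.sub he') (h.xp.le_right e he)
        (h.pz.le_left e' he')
      show P.T p z + (P.T x p - P.T x e) - P.T e' z ≤ P.T e e'
      linarith

lemma xp_yz {e : X} (he : e ∈ Sxp) {b : X} (hb : b ∈ Syz) {d : ℝ} (hd : 0 < d)
    (hg : Good K d) (hle : md K d ≤ stew K (P.T y z) (P.T y b)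
      (stew K (P.T x p) (P.T x e) (md K (P.T x y)) (md K (P.T p y)))
      (md K (P.T p z + (P.T x p - P.T x e)))) : d ≤ P.T e b := by
  have hs := h.sizes
  have hm := hs.hm
  have hD := hs.D_pos
  have e1 := h.xp.add e he
  have e2 := h.yz.add b hb
  have n1 := P.nonneg x e
  have n2 := P.nonneg e p
  have n3 := P.nonneg y b
  have n4 := P.nonneg b z
  have hv := stew_le_md_add (c := P.T x p + P.T p z - P.T y z - P.T x e) hs.B_pos hs.good_B
    (P.nonneg y b) (by linarith) (hs.stew_r_le n1 (by linarith))
    (show md K (P.T p z + (P.T x p - P.T x e)) ≤ _ from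
      le_of_eq (by congr 1; ring))
  obtain ⟨d', h0, h1, h2⟩ := exists_md_eq (by linarith) ((md_nonneg K d).trans hle) hv
  have hdd : d ≤ d' := le_of_md_le h0 hg (by rwa [h2])
  exact hdd.trans (h.xp_yz_of_eq he hb (by linarith) (hs.good.mono (by linarith)) h2 (by linarith))

end Glue

end LorentzModel

/-! ### Points of `[x, y]` against points of `[y, z]`, and the gluing lemma for `p ≪ y`. -/

namespace LorentzModel

variable {X : Type*} {K : ℝ}

open QPt

namespace Glue

variable {P : TimeSep X} {x y z p : X} {Sxy Syz Sxp Spz Spy : Set X}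
  (h : Glue K P x y z p Sxy Syz Sxp Spz Spy)

include h

/-- The comparison triangle of `T₁` is laid over that of `T₃` along `[x, y]`. The segment from `a`
to `b` crosses `[p, y]`, where `T₁` and `T₂` apply, or `[x, p]`, where `T₁` and `xp_yz` apply. Since
`F p' z' ≤ md K (P.T p z)`, the values against `p'` in this figure do not exceed those in `T₂`. -/
lemma xy_yz_of_eq {a : X} (ha : a ∈ Sxy) {b : X} (hb : b ∈ Syz) {d : ℝ} (hd : 0 < d)
    (hg : Good K d) (hay : P.T x a < P.T x y) (hyb : 0 < P.T y b)
    (hdeq : md K d = stew K (P.T x y) (P.T x a) (stew K (P.T y z) (P.T y b) (md K (P.T x y))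
      (md K (P.T x p + P.T p z))) (md K (P.T y b)))
    (hlt : P.T x a + d ≤ P.T x p + P.T p z - P.T y z + P.T y b) : d ≤ P.T a b := by
  have hs := h.sizes
  have hr0 := hs.r_pos
  have hm0 := hs.m_pos
  have hD0 := hs.D_pos
  have hB0 := hs.B_pos
  have hA0 := hs.A_pos
  have hgm := hs.good_m
  have hgr := hs.good_r
  have hgD := hs.good_D
  have hgB := hs.good_B
  have hgA := hs.good_A
  have hA := hs.hA
  have hm := hs.hm
  have hl := hs.hl
  have e1 := h.xy.add a ha
  have e2 := h.yz.add b hb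
  have n1 := P.nonneg x a
  have n2 := P.nonneg b z
  obtain ⟨o, y', p', z', a', b', c, u, hoy, hop, hpy, hoz, hyz, hpz, haI, hbI, hab, hu, hud, hc,
    hdisj⟩ := exists_overlay (A := P.T x y) (B := P.T y z) (r := P.T x p)
      (l := P.T x p + P.T p z) (D := P.T p y) (sa := P.T x a) (t := P.T y b) hs.A_pos hs.B_pos hr0
      (by linarith) hD0 hgD (md_le_md hD0.le (by linarith) (hgA.mono (by linarith)))
      -- The angle hypothesis is `hinge_first` at `ε = P.T p z`, where the far point is `z` itself.
      hl hs.good (by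
        have := hs.hinge_first hm0.le le_rfl
        rwa [stew_self hm0 hgm, md_sub_comm K (P.T x y) (P.T x p + P.T p z)] at this)
      n1 hay.le hyb (by linarith) hd hg hdeq
  rw [add_sub_cancel_left] at hpz
  have hoa := haI.F_left hA0 hgA hoy
  have hya := haI.F_right hA0 hgA hoy
  have hyb' := hbI.F_left hB0 hgB hyz
  have hpa : F a' p' = stew K (P.T x y) (P.T x a) (md K (P.T x p)) (md K (P.T p y)) := by
    rw [F_comm, haI, F_comm, hop, hpy]
  have hob : F o b' = stew K (P.T y z) (P.T y b) (md K (P.T x y)) (md K (P.T x p + P.T p z)) := by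
    rw [hbI, hoy, hoz]
  have hpb : F p' b' ≤ stew K (P.T y z) (P.T y b) (md K (P.T p y)) (md K (P.T p z)) := by
    rw [hbI, hpy]
    exact stew_le_stew hyb.le (by linarith) hgB le_rfl hpz
  have hob1 : md K (P.T x y + P.T y b) ≤ F o b' := by
    rw [hob]
    exact md_add_le_stew hB0 hgB hyb.le (by linarith) le_rfl (md_le_md (by linarith) hl hs.good)
  have hgt : Good K (P.T x y + P.T y b) := hs.good.mono (by linarith)
  have hd1 : P.T x y + P.T y b - P.T x a ≤ d := by
    refine le_of_md_le hd.le (hgt.mono (by linarith)) ?_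
    rw [hdeq, ← hob]
    exact md_sub_le_stew hA0 hgA n1 hay.le hob1 (by rw [add_sub_cancel_left])
  -- The reverse triangle inequality for `o, a', b'`, by contradiction through Stewart's formula
  -- along `[o, y]`; `hd1` supplies the estimate at the endpoint `y`.
  have hob2 : md K (P.T x a + d) ≤ F o b' := by
    by_contra! hlt'
    have h1 : stew K (P.T x y) (P.T x a) (F o b') (md K (P.T y b)) <
        stew K (P.T x y) (P.T x a) (md K (P.T x a + d)) (md K (P.T x a + d - P.T x y)) := by
      refine lt_of_lt_of_le ?_ (stew_le_stew n1 hay.le hgA le_rfl (md_le_md (s := P.T y b) hyb.le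
        (by linarith) (hs.good.mono (by linarith))))
      rw [← sub_pos]
      have n5 := sn_pos (sub_pos.2 hay) (hgA.mono (by linarith))
      have n6 := sn_pos hA0 hgA
      rw [show stew K (P.T x y) (P.T x a) (md K (P.T x a + d)) (md K (P.T y b)) -
        stew K (P.T x y) (P.T x a) (F o b') (md K (P.T y b)) =
        sn K (P.T x y - P.T x a) * (md K (P.T x a + d) - F o b') / sn K (P.T x y) by
          unfold stew; ring]
      have := sub_pos.2 hlt'
      positivity
    rw [stew_line hA0 hgA, add_sub_cancel_left, hob, ← hdeq] at h1
    exact lt_irrefl _ h1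
  have hgad : Good K (P.T x a + d) := hs.good.mono (by linarith)
  have leb (e) (hl : P.le e y) : P.le e b := P.le_trans hl (h.yz.le_left b hb)
  have hoc1 : md K (P.T x a + u) ≤ F o c := by
    rw [hc, hoa]
    exact md_add_le_stew hd hg hu hud le_rfl hob2
  rcases exists_isPt_or hr0 hgr hD0 hgD hdisj with ⟨σ, hσ, hσD, hc'⟩ | ⟨s, hs0, hsr, hc'⟩
  · have i2 : P.T x a + u ≤ P.T x y - P.T p y + σ := by
      refine le_of_md_le (by linarith) (hgad.mono (by linarith)) (hoc1.trans ?_)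
      rw [hc', hop, hoy]
      exact stew_le_md_add hD0 hgD hσ hσD
        (md_le_md hr0.le (by linarith) (hgA.mono (by linarith))) (by rw [sub_add_cancel])
    have key := h.py.add_le_of_stew (K := K)
      (f := F a' p') (g := md K (P.T x y - P.T x a))
      (f' := stew K (P.T y z) (P.T y b) (md K (P.T p y)) (md K (P.T p z)))
      (g' := md K (P.T y b))
      (σ := σ) (u := u) (v := d - u) (α := P.T p y - (P.T x y - P.T x a)) (β := σ + (d - u))
      hD0 hgD (h.xy.sub ha) (h.yz.sub hb)
      (fun c hc e he hge hle => (h.xy_py ha hc he hge (by rwa [← hpa])).1)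
      (fun c hc e he hge hle _ => h.bound₂.b₂ c hc b hb e he hge (by
        have e3 := h.py.add c hc
        rwa [show P.T c y = P.T p y - P.T p c by linarith, stew_comm_middle hD0 hgD hB0 hgB]))
      hσ hσD hu (by linarith)
      (by linarith) (by rwa [add_sub_cancel]) ?_ ?_ (by linarith) le_rfl ?_ ?_
      (fun _ _ => h.xy.le_right a ha) (fun _ _ => leb p h.py.le)
    · rwa [add_sub_cancel] at key
    · rw [← hc.F_left hd hg hab, hc', F_comm a' y', hya]
    · rw [← hc.F_right hd hg hab, hc', F_comm, F_comm b' y', hyb']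
      exact stew_le_stew hσ hσD hgD hpb le_rfl
    · rintro rfl
      have h1 := hc p'
      have h2 := hc y'
      rw [stew_zero hd hg] at h1 h2
      rw [hc'.F_left hD0 hgD hpy, F_comm] at h1
      rw [hc'.F_right hD0 hgD hpy, hya] at h2
      exact ⟨h1.le, h2.le⟩
    · intro hv
      have h1 := hc p'
      have h2 := hc y'
      rw [show u = d by linarith, stew_self hd hg] at h1 h2
      rw [hc'.F_left hD0 hgD hpy] at h1
      rw [hc'.F_right hD0 hgD hpy, hyb'] at h2
      exact ⟨h1.le.trans hpb, h2.le⟩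
  · rw [hc'.F_left hr0 hgr hop] at hoc1
    have i2 : P.T x a + u ≤ s := le_of_md_le hs0 (hgad.mono (by linarith)) hoc1
    have key := h.xp.add_le_of_stew (K := K)
      (f := md K (P.T x a)) (g := F a' p')
      (f' := F o b')
      (g' := stew K (P.T y z) (P.T y b) (md K (P.T p y)) (md K (P.T p z)))
      (σ := s) (u := u) (v := d - u) (α := P.T x a) (β := s + (d - u))
      hr0 hgr (h.xy.sub ha) (h.yz.sub hb)
      (fun e he t ht hgt hle => (h.bound₁.b₁ e he a ha t ht hgt (by rwa [← hpa])).2)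
      (fun e he t ht hgt hle _ => h.xp_yz he hb ht hgt (by
        refine hle.trans_eq ?_
        rw [hob, stew_comm hB0 hgB hr0 hgr, show P.T p z + (P.T x p - P.T x e) =
          P.T x p + P.T p z - P.T x e by ring, ← stew_line hr0 hgr (P.T x p + P.T p z),
          add_sub_cancel_left]))
      hs0 hsr.le hu (by linarith)
      (by linarith) (by rwa [add_sub_cancel]) ?_ ?_ (by linarith) le_rfl ?_ ?_
      (fun _ _ => by linarith) (fun _ _ => leb x h.xy.le)
    · rwa [add_sub_cancel] at key
    · rw [← hc.F_left hd hg hab, hc', F_comm a' o, hoa]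
    · rw [← hc.F_right hd hg hab, hc', F_comm, F_comm b' p']
      exact stew_le_stew hs0 hsr.le hgr le_rfl hpb
    · rintro rfl
      have h1 := hc p'
      have h2 := hc o
      rw [stew_zero hd hg] at h1 h2
      rw [hc'.F_right hr0 hgr hop, F_comm] at h1
      rw [hc'.F_left hr0 hgr hop, hoa] at h2
      exact ⟨h2.le, h1.le⟩
    · intro hv
      have h1 := hc p'
      have h2 := hc o
      rw [show u = d by linarith, stew_self hd hg] at h1 h2
      rw [hc'.F_right hr0 hgr hop] at h1
      rw [hc'.F_left hr0 hgr hop] at h2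
      exact ⟨h2.le, h1.le.trans hpb⟩

lemma xy_yz {a : X} (ha : a ∈ Sxy) {b : X} (hb : b ∈ Syz) {d : ℝ} (hd : 0 < d)
    (hg : Good K d) (hle : md K d ≤ stew K (P.T y z) (P.T y b) (md K (P.T a y))
      (stew K (P.T x y) (P.T x a) (md K (P.T x z)) (md K (P.T y z)))) : d ≤ P.T a b := by
  have hs := h.sizes
  have hB0 := hs.B_pos
  have hA0 := hs.A_pos
  have hgB := hs.good_B
  have hgA := hs.good_A
  have hl := hs.hl
  have e1 := h.xy.add a ha
  have e2 := h.yz.add b hb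
  have n1 := P.nonneg x a
  have n2 := P.nonneg b z
  have n3 := P.nonneg a y
  have n4 := P.nonneg y b
  have hay := h.xy.le_right a ha
  have hyb := h.yz.le_left b hb
  have hrt := P.add_le (h.xy.sub ha) h.xy.right_mem_U (h.yz.sub hb) hay hyb
  -- If `a` or `b` has time separation zero from `y`, the comparison value is `md K` of the other
  -- distance, and the reverse triangle inequality suffices.
  rcases n4.eq_or_lt with n4' | n4'
  · rw [← n4', stew_zero hB0 hgB] at hle
    linarith [le_of_md_le n3 hg hle]
  rcases n3.eq_or_lt with n3' | n3'
  · rw [← n3', show P.T x a = P.T x y by linarith, stew_self hA0 hgA, md_zero, stew_zero_left hB0 hgB] at hle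
    linarith [le_of_md_le n4 hg hle]
  rw [show P.T a y = P.T x y - P.T x a by linarith, stew_comm_middle hA0 hgA hB0 hgB,
    ← h.add] at hle
  have hv := stew_le_md_sub (c := P.T x p + P.T p z - P.T y z + P.T y b) hA0 hgA n1 (by linarith)
    (stew_le_md_add (c := P.T x p + P.T p z - P.T y z) hB0 hgB n4 (by linarith)
      (md_le_md hA0.le (by linarith) (hs.good.mono (by linarith)))
      (show md K (P.T x p + P.T p z) ≤ _ by rw [sub_add_cancel]))
    (md_le_md n4 (show P.T y b ≤ _ by linarith) (hs.good.mono (by linarith)))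
  obtain ⟨d', h0, h1, h2⟩ := exists_md_eq (by linarith) ((md_nonneg K d).trans hle) hv
  have hdd : d ≤ d' := le_of_md_le h0 hg (by rwa [h2])
  exact hdd.trans (h.xy_yz_of_eq ha hb (by linarith) (hs.good.mono (by linarith)) (by linarith) n4'
    h2 (by linarith))

/-- The gluing lemma in numerical form. -/
theorem triBound : P.TriBound K x y z Sxy Syz (Sxp ∪ Spz) where
  b₁ a ha b hb d hd hg hle := by
    have hs := h.sizes
    have e1 := h.xy.add a ha
    have n1 := P.nonneg a y
    rw [← h.add] at hle
    rcases hb with hb | hb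
    · have e2 := h.xp.add b hb
      have n2 := P.nonneg b p
      have := h.bound₁.b₁ b hb a ha d hd hg (by
        rw [← stew_comm_first hs.A_pos hs.good_A hs.r_pos hs.good_r]
        exact hle.trans (stew_le_stew (P.nonneg x a) (by linarith) hs.good_A le_rfl
          (hs.long_le_first (P.nonneg x b) (by linarith))))
      exact ⟨this.2, this.1⟩
    · have e2 := h.pz.add b hb
      have n2 := P.nonneg b z
      rw [h.T_x hb] at hle ⊢
      exact h.xy_pz ha hb hd hg (hle.trans (stew_le_stew (P.nonneg x a) (by linarith) hs.good_A
        le_rfl (hs.long_le_last (P.nonneg p b) (by linarith))))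
  b₂ a ha b hb d hd hg hle := h.xy_yz ha hb hd hg hle
  b₃ a ha b hb d hd hg hle := by
    have hs := h.sizes
    have e1 := h.yz.add b hb
    have n1 := P.nonneg b z
    rw [← h.add] at hle
    rcases ha with ha | ha
    · have e2 := h.xp.add a ha
      have n2 := P.nonneg a p
      -- Since `a ≤ y ≤ b`, the point `b` cannot be farther from `z` than `a`; the second order is
      -- vacuous.
      have hay : P.le a y := P.le_trans (h.xp.le_right a ha) h.py.le
      have hab := P.add_le (h.xp.sub ha) (h.yz.sub hb) h.yz.right_mem_U
        (P.le_trans hay (h.yz.le_left b hb)) (h.yz.le_right b hb)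
      refine ⟨fun _ => h.xp_yz ha hb hd hg (hle.trans ?_), fun hlt => ?_⟩
      · rw [h.T_z ha, show P.T a p + P.T p z = P.T p z + (P.T x p - P.T x a) by linarith]
        exact stew_le_stew (P.nonneg y b) (by linarith) hs.good_B
          (hs.long_le_first (P.nonneg x a) (by linarith)) le_rfl
      · linarith [P.nonneg a b]
    · have e2 := h.pz.add a ha
      have n2 := P.nonneg a z
      refine h.bound₂.b₃ a ha b hb d hd hg (hle.trans ?_)
      rw [h.T_x ha]
      exact stew_le_stew (P.nonneg y b) (by linarith) hs.good_B
        (hs.long_le_last (P.nonneg p a) (by linarith)) le_rfl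

end Glue

end LorentzModel

/-! ### The case `y ≪ p` by time reversal. -/

namespace LorentzModel

/-- The gluing lemma in numerical form, with `y ≪ p`. -/
theorem triBound_of_ll {X : Type*} {K : ℝ} {P : TimeSep X} {x y z p : X}
    {Sxy Syz Sxp Spz Syp : Set X} (hxy : P.Side x y Sxy) (hyz : P.Side y z Syz)
    (hxp : P.Side x p Sxp) (hpz : P.Side p z Spz) (hyp : P.Side y p Syp)
    (hxz : P.Side x z (Sxp ∪ Spz))
    (h₁ : P.TriBound K x y p Sxy Syp Sxp) (h₂ : P.TriBound K y p z Syp Spz Syz)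
    (hadd : P.T x p + P.T p z = P.T x z) (hg : Good K (P.T x z)) (pxy : 0 < P.T x y)
    (pyz : 0 < P.T y z) (pyp : 0 < P.T y p) (ppz : 0 < P.T p z) :
    P.TriBound K x y z Sxy Syz (Sxp ∪ Spz) := by
  have i1 := P.add_le hxy.left_mem_U hxy.right_mem_U hxp.right_mem_U hxy.le hyp.le
  have i2 := P.add_le hyz.left_mem_U hpz.left_mem_U hyz.right_mem_U hyp.le hpz.le
  have i3 := P.add_le hxy.left_mem_U hxy.right_mem_U hyz.right_mem_U hxy.le hyz.le
  -- In reversed time `p` precedes `y`, `x` and `z` change places, and so do `T₁` and `T₂`.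
  have : Glue K P.op z y x p Syz Sxy Spz Sxp Syp :=
    { xy := hyz.op
      yz := hxy.op
      xp := hpz.op
      pz := hxp.op
      py := hyp.op
      bound₁ := h₂.op hyp hpz hyz pyp ppz (hg.mono (by linarith)) (hg.mono (by linarith))
      bound₂ := h₁.op hxy hyp hxp pxy pyp (hg.mono (by linarith)) (hg.mono (by linarith))
      add := (add_comm _ _).trans hadd
      good := hg
      xp_pos := ppz
      pz_pos := show 0 < P.T x p by linarith
      py_pos := pyp
      yz_pos := pxy }
  have := this.triBound.op hyz.op hxy.op (Set.union_comm Spz Sxp ▸ hxz.op) pyz pxy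
    (hg.mono (show P.T y z ≤ _ by linarith)) (hg.mono (show P.T x y ≤ _ by linarith))
  rwa [Set.union_comm] at this

end LorentzModel

/-! ### Translation between comparison triangles and the numerical bound. -/

namespace LorentzianPreLengthSpace

open LorentzModel ModelSpace

variable {X : Type*} [EMetricSpace X] {L : LorentzianPreLengthSpace X} {U : Set X} {K : ℝ}

/-- A triangle with distance realizing sides, obeying the size bounds, and a comparison triangle
of it. -/
structure Comparison (hU : L.FiniteContinuousOn U) (T : Triangle X) (M : ModelTriangle K) :
    Prop where
  s₁₂ : (L.timeSep hU).Side T.v₁ T.v₂ T.s₁₂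
  s₂₃ : (L.timeSep hU).Side T.v₂ T.v₃ T.s₂₃
  s₁₃ : (L.timeSep hU).Side T.v₁ T.v₃ T.s₁₃
  p₁₂ : 0 < (L.timeSep hU).T T.v₁ T.v₂
  p₂₃ : 0 < (L.timeSep hU).T T.v₂ T.v₃
  good : Good K ((L.timeSep hU).T T.v₁ T.v₃)
  cmp : L.IsComparisonTriangle T M

lemma le_T_of_τ_le (hU : L.FiniteContinuousOn U) {a b : X} (ha : a ∈ U) (hb : b ∈ U)
    {a' b' : ModelSpace K} (h : a'.τ b' ≤ L.τ a b) (hll : a'.ll b') (hn : Near a' b') {d : ℝ}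
    (hg : Good K d) (hd : md K d ≤ F a' b') : d ≤ (L.timeSep hU).T a b := by
  obtain ⟨d', h0, -, h1, h2⟩ := exists_τ_eq_of_ll hll hn
  rw [h1, τ_eq_ofReal hU ha hb, ENNReal.ofReal_le_ofReal_iff ((L.timeSep hU).nonneg _ _)] at h
  exact (le_of_md_le h0.le hg (by rwa [h2])).trans h

namespace Comparison

variable {hU : L.FiniteContinuousOn U} {T : Triangle X} {M : ModelTriangle K}
  (h : Comparison hU T M)

include h

lemma add_le : (L.timeSep hU).T T.v₁ T.v₂ + (L.timeSep hU).T T.v₂ T.v₃ ≤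
    (L.timeSep hU).T T.v₁ T.v₃ :=
  (L.timeSep hU).add_le h.s₁₂.left_mem_U h.s₁₂.right_mem_U h.s₂₃.right_mem_U h.s₁₂.le h.s₂₃.le

lemma p₁₃ : 0 < (L.timeSep hU).T T.v₁ T.v₃ := by linarith [h.add_le, h.p₁₂, h.p₂₃]

lemma good₁₂ : Good K ((L.timeSep hU).T T.v₁ T.v₂) :=
  h.good.mono (by linarith [h.add_le, h.p₂₃])

lemma good₂₃ : Good K ((L.timeSep hU).T T.v₂ T.v₃) :=
  h.good.mono (by linarith [h.add_le, h.p₁₂])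

lemma τ₁₂ : M.v₁.τ M.v₂ = ENNReal.ofReal ((L.timeSep hU).T T.v₁ T.v₂) :=
  h.cmp.1.trans (τ_eq_ofReal hU h.s₁₂.left_mem_U h.s₁₂.right_mem_U)

lemma τ₂₃ : M.v₂.τ M.v₃ = ENNReal.ofReal ((L.timeSep hU).T T.v₂ T.v₃) :=
  h.cmp.2.1.trans (τ_eq_ofReal hU h.s₂₃.left_mem_U h.s₂₃.right_mem_U)

lemma τ₁₃ : M.v₁.τ M.v₃ = ENNReal.ofReal ((L.timeSep hU).T T.v₁ T.v₃) :=
  h.cmp.2.2.trans (τ_eq_ofReal hU h.s₁₃.left_mem_U h.s₁₃.right_mem_U)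

lemma of₁₂ : M.v₁.ll M.v₂ ∧ Near M.v₁ M.v₂ ∧
    M.v₁.F M.v₂ = md K ((L.timeSep hU).T T.v₁ T.v₂) :=
  of_τ_eq h.p₁₂ h.good₁₂ h.τ₁₂

lemma of₂₃ : M.v₂.ll M.v₃ ∧ Near M.v₂ M.v₃ ∧
    M.v₂.F M.v₃ = md K ((L.timeSep hU).T T.v₂ T.v₃) :=
  of_τ_eq h.p₂₃ h.good₂₃ h.τ₂₃

lemma of₁₃ : M.v₁.ll M.v₃ ∧ Near M.v₁ M.v₃ ∧
    M.v₁.F M.v₃ = md K ((L.timeSep hU).T T.v₁ T.v₃) :=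
  of_τ_eq h.p₁₃ h.good h.τ₁₃

lemma exists₁₂ {a : X} (ha : a ∈ T.s₁₂) : ∃ a' ∈ M.v₁.segment M.v₂,
    M.v₁.τ a' = ENNReal.ofReal ((L.timeSep hU).T T.v₁ a) ∧ L.IsComparisonPoint T M a a' := by
  have e := h.s₁₂.add a ha
  have n := (L.timeSep hU).nonneg a T.v₂
  obtain ⟨w, hw, hw'⟩ := exists_mem_segment h.p₁₂ h.good₁₂ h.τ₁₂
    ((L.timeSep hU).nonneg T.v₁ a) (by linarith)
  exact ⟨w, hw, hw', Or.inl ⟨ha, hw, hw'.trans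
    (τ_eq_ofReal hU h.s₁₂.left_mem_U (h.s₁₂.sub ha)).symm⟩⟩

lemma exists₂₃ {a : X} (ha : a ∈ T.s₂₃) : ∃ a' ∈ M.v₂.segment M.v₃,
    M.v₂.τ a' = ENNReal.ofReal ((L.timeSep hU).T T.v₂ a) ∧ L.IsComparisonPoint T M a a' := by
  have e := h.s₂₃.add a ha
  have n := (L.timeSep hU).nonneg a T.v₃
  obtain ⟨w, hw, hw'⟩ := exists_mem_segment h.p₂₃ h.good₂₃ h.τ₂₃
    ((L.timeSep hU).nonneg T.v₂ a) (by linarith)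
  exact ⟨w, hw, hw', Or.inr (Or.inl ⟨ha, hw, hw'.trans
    (τ_eq_ofReal hU h.s₂₃.left_mem_U (h.s₂₃.sub ha)).symm⟩)⟩

lemma exists₁₃ {a : X} (ha : a ∈ T.s₁₃) : ∃ a' ∈ M.v₁.segment M.v₃,
    M.v₁.τ a' = ENNReal.ofReal ((L.timeSep hU).T T.v₁ a) ∧ L.IsComparisonPoint T M a a' := by
  have e := h.s₁₃.add a ha
  have n := (L.timeSep hU).nonneg a T.v₃
  obtain ⟨w, hw, hw'⟩ := exists_mem_segment h.p₁₃ h.good h.τ₁₃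
    ((L.timeSep hU).nonneg T.v₁ a) (by linarith)
  exact ⟨w, hw, hw', Or.inr (Or.inr ⟨ha, hw, hw'.trans
    (τ_eq_ofReal hU h.s₁₃.left_mem_U (h.s₁₃.sub ha)).symm⟩)⟩

lemma isPt₁₂ {s : ℝ} (hs : 0 ≤ s) {a : ModelSpace K} (ha : a ∈ M.v₁.segment M.v₂)
    (ha' : M.v₁.τ a = ENNReal.ofReal s) :
    QPt.IsPt M.v₁.emb M.v₂.emb ((L.timeSep hU).T T.v₁ T.v₂) s a.emb :=
  (segment_isPt h.p₁₂ h.good₁₂ hs h.τ₁₂ ha ha').2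

lemma isPt₂₃ {s : ℝ} (hs : 0 ≤ s) {a : ModelSpace K} (ha : a ∈ M.v₂.segment M.v₃)
    (ha' : M.v₂.τ a = ENNReal.ofReal s) :
    QPt.IsPt M.v₂.emb M.v₃.emb ((L.timeSep hU).T T.v₂ T.v₃) s a.emb :=
  (segment_isPt h.p₂₃ h.good₂₃ hs h.τ₂₃ ha ha').2

lemma isPt₁₃ {s : ℝ} (hs : 0 ≤ s) {a : ModelSpace K} (ha : a ∈ M.v₁.segment M.v₃)
    (ha' : M.v₁.τ a = ENNReal.ofReal s) :
    QPt.IsPt M.v₁.emb M.v₃.emb ((L.timeSep hU).T T.v₁ T.v₃) s a.emb :=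
  (segment_isPt h.p₁₃ h.good hs h.τ₁₃ ha ha').2

section F

variable {s t : ℝ} (hs : 0 ≤ s) (ht : 0 ≤ t) {a b : ModelSpace K}

include hs ht

/-- Stewart's formula along one side and then along the other; this and the next two lemmas produce
the expressions in the three fields of `TriBound`. -/
lemma F₁₂₁₃ (ha : a ∈ M.v₁.segment M.v₂) (ha' : M.v₁.τ a = ENNReal.ofReal s)
    (hb : b ∈ M.v₁.segment M.v₃) (hb' : M.v₁.τ b = ENNReal.ofReal t) :
    F a b = stew K ((L.timeSep hU).T T.v₁ T.v₂) s (md K t)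
      (stew K ((L.timeSep hU).T T.v₁ T.v₃) t (md K ((L.timeSep hU).T T.v₁ T.v₂))
        (md K ((L.timeSep hU).T T.v₂ T.v₃))) := by
  have h1 := h.isPt₁₂ hs ha ha'
  have h2 := h.isPt₁₃ ht hb hb'
  have h3 : M.v₁.emb.F M.v₃.emb = _ := h.of₁₃.2.2
  have h4 : M.v₁.emb.F M.v₂.emb = _ := h.of₁₂.2.2
  have h5 : M.v₂.emb.F M.v₃.emb = _ := h.of₂₃.2.2
  rw [F_comm, F, h1, QPt.F_comm, h2.F_left h.p₁₃ h.good h3, QPt.F_comm, h2,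
    QPt.F_comm M.v₂.emb M.v₁.emb, h4, h5]

lemma F₁₂₂₃ (ha : a ∈ M.v₁.segment M.v₂) (ha' : M.v₁.τ a = ENNReal.ofReal s)
    (hb : b ∈ M.v₂.segment M.v₃) (hb' : M.v₂.τ b = ENNReal.ofReal t) :
    F a b = stew K ((L.timeSep hU).T T.v₂ T.v₃) t (md K ((L.timeSep hU).T T.v₁ T.v₂ - s))
      (stew K ((L.timeSep hU).T T.v₁ T.v₂) s (md K ((L.timeSep hU).T T.v₁ T.v₃))
        (md K ((L.timeSep hU).T T.v₂ T.v₃))) := by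
  have h1 := h.isPt₁₂ hs ha ha'
  have h2 := h.isPt₂₃ ht hb hb'
  have h3 : M.v₁.emb.F M.v₃.emb = _ := h.of₁₃.2.2
  have h4 : M.v₁.emb.F M.v₂.emb = _ := h.of₁₂.2.2
  have h5 : M.v₂.emb.F M.v₃.emb = _ := h.of₂₃.2.2
  rw [F, h2, QPt.F_comm, h1.F_right h.p₁₂ h.good₁₂ h4, QPt.F_comm, h1, QPt.F_comm, h3,
    QPt.F_comm, h5]

lemma F₁₃₂₃ (ha : a ∈ M.v₁.segment M.v₃) (ha' : M.v₁.τ a = ENNReal.ofReal s)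
    (hb : b ∈ M.v₂.segment M.v₃) (hb' : M.v₂.τ b = ENNReal.ofReal t) :
    F a b = stew K ((L.timeSep hU).T T.v₂ T.v₃) t
      (stew K ((L.timeSep hU).T T.v₁ T.v₃) s (md K ((L.timeSep hU).T T.v₁ T.v₂))
        (md K ((L.timeSep hU).T T.v₂ T.v₃))) (md K ((L.timeSep hU).T T.v₁ T.v₃ - s)) := by
  have h1 := h.isPt₁₃ hs ha ha'
  have h2 := h.isPt₂₃ ht hb hb'
  have h3 : M.v₁.emb.F M.v₃.emb = _ := h.of₁₃.2.2
  have h4 : M.v₁.emb.F M.v₂.emb = _ := h.of₁₂.2.2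
  have h5 : M.v₂.emb.F M.v₃.emb = _ := h.of₂₃.2.2
  rw [F, h2, QPt.F_comm, h1, QPt.F_comm, h4, h5, QPt.F_comm, h1.F_right h.p₁₃ h.good h3]

end F

end Comparison

end LorentzianPreLengthSpace

namespace LorentzianPreLengthSpace

open LorentzModel ModelSpace

variable {X : Type*} [EMetricSpace X] {L : LorentzianPreLengthSpace X} {U : Set X} {K : ℝ}

lemma lt_of_ll_of_F {u v w : ModelSpace K} (huv : u.le v) (hvw : v.ll w) (hn : Near u w)
    {s t : ℝ} (ht : 0 ≤ t) (hgs : Good K s) (hv : F u v = md K s)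
    (hw : F u w = md K t) (hst : s ≠ t) : s < t := by
  have h1 := F_mono_right huv (ModelSpace.le_of_ll hvw) hn
  rw [hv, hw] at h1
  exact lt_of_le_of_ne (le_of_md_le ht hgs h1) hst

namespace Comparison

variable {hU : L.FiniteContinuousOn U} {T : Triangle X} {M : ModelTriangle K}
  (h : Comparison hU T M)

include h

/-- A value of at least `md K d > 0` makes the comparison points timelike related in some order. For
sides meeting at `v₁` or `v₃`, distances from that vertex fix the order, because `F` is monotone
along causal relations; then the given bound applies. -/
theorem triBound (hb : L.UpperBound T M) :
    (L.timeSep hU).TriBound K T.v₁ T.v₂ T.v₃ T.s₁₂ T.s₂₃ T.s₁₃ := by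
  obtain ⟨l₁₂, -, f₁₂⟩ := h.of₁₂
  obtain ⟨l₂₃, -, f₂₃⟩ := h.of₂₃
  obtain ⟨l₁₃, n₁₃, f₁₃⟩ := h.of₁₃
  have hl := h.add_le
  have hp := h.p₁₂
  have hp' := h.p₂₃
  refine ⟨fun a ha b hb' d hd hg hle => ?_, fun a ha b hb' d hd hg hle => ?_,
    fun a ha b hb' d hd hg hle => ?_⟩
  · obtain ⟨a', ma, ta, ca⟩ := h.exists₁₂ ha
    obtain ⟨b', mb, tb, cb⟩ := h.exists₁₃ hb'
    have hs := (L.timeSep hU).nonneg T.v₁ a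
    have ht := (L.timeSep hU).nonneg T.v₁ b
    have ea := h.s₁₂.add a ha
    have eb := h.s₁₃.add b hb'
    have ea' := (L.timeSep hU).nonneg a T.v₂
    have eb' := (L.timeSep hU).nonneg b T.v₃
    rw [← h.F₁₂₁₃ hs ht ma ta mb tb] at hle
    have la := ModelSpace.le_trans ma.2.1 (ModelSpace.le_of_ll l₂₃)
    have fa : F M.v₁ a' = _ := (h.isPt₁₂ hs ma ta).F_left h.p₁₂ h.good₁₂ f₁₂
    have fb : F M.v₁ b' = _ := (h.isPt₁₃ ht mb tb).F_left h.p₁₃ h.good f₁₃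
    have hll := (n₁₃.close ma.1 la mb.1 mb.2.1).ll_or_ll ((md_pos hd hg).trans_le hle)
    refine ⟨fun hlt => ?_, fun hlt => ?_⟩
    · rcases hll with hll | hll
      · exact le_T_of_τ_le hU (h.s₁₂.sub ha) (h.s₁₃.sub hb') (hb a b a' b' ca cb) hll
          (n₁₃.mono ma.1 mb.2.1) hg hle
      · have := lt_of_ll_of_F mb.1 hll (n₁₃.mono (ModelSpace.le_refl _) la) hs
          (h.good.mono (by linarith)) fb fa hlt.ne'
        exact absurd this (not_lt.2 hlt.le)
    · rcases hll with hll | hll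
      · have := lt_of_ll_of_F ma.1 hll (n₁₃.mono (ModelSpace.le_refl _) mb.2.1) ht
          (h.good.mono (by linarith)) fa fb hlt.ne'
        exact absurd this (not_lt.2 hlt.le)
      · exact le_T_of_τ_le hU (h.s₁₃.sub hb') (h.s₁₂.sub ha) (hb b a b' a' cb ca) hll
          (n₁₃.mono mb.1 la) hg (by rwa [F_comm])
  · obtain ⟨a', ma, ta, ca⟩ := h.exists₁₂ ha
    obtain ⟨b', mb, tb, cb⟩ := h.exists₂₃ hb'
    have hs := (L.timeSep hU).nonneg T.v₁ a
    have ht := (L.timeSep hU).nonneg T.v₂ b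
    have ea := h.s₁₂.add a ha
    rw [show (L.timeSep hU).T a T.v₂ = (L.timeSep hU).T T.v₁ T.v₂ - (L.timeSep hU).T T.v₁ a by
      linarith, ← h.F₁₂₂₃ hs ht ma ta mb tb] at hle
    have la := ModelSpace.le_trans ma.2.1 (ModelSpace.le_of_ll l₂₃)
    have lb := ModelSpace.le_trans (ModelSpace.le_of_ll l₁₂) mb.1
    have lab := ModelSpace.le_trans ma.2.1 mb.1
    have hll := (n₁₃.close ma.1 la lb mb.2.1).ll_or_ll ((md_pos hd hg).trans_le hle)
    exact le_T_of_τ_le hU (h.s₁₂.sub ha) (h.s₂₃.sub hb') (hb a b a' b' ca cb)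
      (hll.resolve_right (not_ll_of_le lab)) (n₁₃.mono ma.1 mb.2.1) hg hle
  · obtain ⟨a', ma, ta, ca⟩ := h.exists₁₃ ha
    obtain ⟨b', mb, tb, cb⟩ := h.exists₂₃ hb'
    have hs := (L.timeSep hU).nonneg T.v₁ a
    have ht := (L.timeSep hU).nonneg T.v₂ b
    have ea := h.s₁₃.add a ha
    have eb := h.s₂₃.add b hb'
    have ea' := (L.timeSep hU).nonneg a T.v₃
    have eb' := (L.timeSep hU).nonneg b T.v₃
    have fa : F M.v₃ a' = _ := (h.isPt₁₃ hs ma ta).F_right h.p₁₃ h.good f₁₃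
    have fb : F M.v₃ b' = _ := (h.isPt₂₃ ht mb tb).F_right h.p₂₃ h.good₂₃ f₂₃
    rw [F_comm, show (L.timeSep hU).T T.v₁ T.v₃ - (L.timeSep hU).T T.v₁ a =
      (L.timeSep hU).T a T.v₃ by linarith] at fa
    rw [F_comm, show (L.timeSep hU).T T.v₂ T.v₃ - (L.timeSep hU).T T.v₂ b =
      (L.timeSep hU).T b T.v₃ by linarith] at fb
    rw [show (L.timeSep hU).T a T.v₃ = (L.timeSep hU).T T.v₁ T.v₃ - (L.timeSep hU).T T.v₁ a by
      linarith, ← h.F₁₃₂₃ hs ht ma ta mb tb] at hle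
    have lb := ModelSpace.le_trans (ModelSpace.le_of_ll l₁₂) mb.1
    have hll := (n₁₃.close ma.1 ma.2.1 lb mb.2.1).ll_or_ll ((md_pos hd hg).trans_le hle)
    refine ⟨fun hlt => ?_, fun hlt => ?_⟩
    · rcases hll with hll | hll
      · exact le_T_of_τ_le hU (h.s₁₃.sub ha) (h.s₂₃.sub hb') (hb a b a' b' ca cb) hll
          (n₁₃.mono ma.1 mb.2.1) hg hle
      · have := F_mono_left (ModelSpace.le_of_ll hll) ma.2.1 (n₁₃.mono lb (ModelSpace.le_refl _))
        rw [fa, fb] at this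
        exact absurd this (not_le.2 (md_lt_md eb' hlt (h.good.mono (by linarith))))
    · rcases hll with hll | hll
      · have := F_mono_left (ModelSpace.le_of_ll hll) mb.2.1 (n₁₃.mono ma.1 (ModelSpace.le_refl _))
        rw [fa, fb] at this
        exact absurd this (not_le.2 (md_lt_md ea' hlt (h.good₂₃.mono (by linarith))))
      · exact le_T_of_τ_le hU (h.s₂₃.sub hb') (h.s₁₃.sub ha) (hb b a b' a' cb ca) hll
          (n₁₃.mono lb ma.2.1) hg (by rwa [F_comm])

end Comparison

/-- For two points of one side no curvature is involved: the model value is the difference of the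
distances from the start, and a realizing curve attains at least that. -/
lemma τ_le_of_side {hU : L.FiniteContinuousOn U} {u v a b : X} {S : Set X}
    (hS : (L.timeSep hU).Side u v S) (hp : 0 < (L.timeSep hU).T u v)
    (hg : Good K ((L.timeSep hU).T u v)) {u' v' a' b' : ModelSpace K}
    (hτ : u'.τ v' = ENNReal.ofReal ((L.timeSep hU).T u v)) (ha : a ∈ S) (hb : b ∈ S)
    (ha' : a' ∈ u'.segment v') (hb' : b' ∈ u'.segment v')
    (ta : u'.τ a' = L.τ u a) (tb : u'.τ b' = L.τ u b) (hll : a'.ll b') : a'.τ b' ≤ L.τ a b := by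
  obtain ⟨-, hn, hF⟩ := of_τ_eq hp hg hτ
  have hs := (L.timeSep hU).nonneg u a
  have ht := (L.timeSep hU).nonneg u b
  have es := (L.timeSep hU).nonneg a v
  have et := (L.timeSep hU).nonneg b v
  have ea := hS.add a ha
  have eb := hS.add b hb
  rw [τ_eq_ofReal hU hS.left_mem_U (hS.sub ha)] at ta
  rw [τ_eq_ofReal hU hS.left_mem_U (hS.sub hb)] at tb
  have ia := (segment_isPt hp hg hs hτ ha' ta).2
  have ib := (segment_isPt hp hg ht hτ hb' tb).2
  have fa : F u' a' = _ := ia.F_left hp hg hF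
  have fb : F u' b' = _ := ib.F_left hp hg hF
  have fab : F a' b' = md K ((L.timeSep hU).T u b - (L.timeSep hU).T u a) := by
    have fb' : F v' b' = _ := ib.F_right hp hg hF
    rw [F_comm, F, ia, QPt.F_comm, QPt.F_comm b'.emb]
    change stew K _ _ (F u' b') (F v' b') = _
    rw [fb, fb', md_sub_comm, stew_line hp hg]
  obtain ⟨d, hd, hgd, e1, e2⟩ := exists_τ_eq_of_ll hll (hn.mono ha'.1 hb'.2.1)
  have hne : (L.timeSep hU).T u a ≠ (L.timeSep hU).T u b := fun he => by
    rw [fab, he, sub_self, md_zero] at e2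
    exact (md_pos hd hgd).ne' e2
  have hlt := lt_of_ll_of_F ha'.1 hll (hn.mono (ModelSpace.le_refl _) hb'.2.1) ht
    (hg.mono (by linarith)) fa fb hne
  rw [e1, τ_eq_ofReal hU (hS.sub ha) (hS.sub hb)]
  refine ENNReal.ofReal_le_ofReal ((le_of_md_le (by linarith) hgd ?_).trans (hS.diff a ha b hb hlt))
  rw [e2, fab]

namespace Comparison

variable {hU : L.FiniteContinuousOn U} {T : Triangle X} {M : ModelTriangle K}
  (h : Comparison hU T M)

include h

/-- Only pairs with `a' ≪ b'` matter, and monotonicity of `F` turns this relation into the order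
condition of the numerical bound. Equal distances from the common vertex cannot occur: by
`stew_first_le` and `stew_last_le` the value of `F` would be at most zero. -/
theorem upperBound
    (hb : (L.timeSep hU).TriBound K T.v₁ T.v₂ T.v₃ T.s₁₂ T.s₂₃ T.s₁₃) : L.UpperBound T M := by
  obtain ⟨l₁₂, -, f₁₂⟩ := h.of₁₂
  obtain ⟨l₂₃, -, f₂₃⟩ := h.of₂₃
  obtain ⟨l₁₃, n₁₃, f₁₃⟩ := h.of₁₃
  have hl := h.add_le
  have nn := (L.timeSep hU).nonneg
  intro a b a' b' ca cb
  by_cases hll : a'.ll b'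
  swap
  · rw [τ_of_not_ll hll]; exact zero_le
  have red (ha : a ∈ U) (hb : b ∈ U) (hn : Near a' b') (H : ∀ d, 0 < d → Good K d →
      md K d = F a' b' → d ≤ (L.timeSep hU).T a b) : a'.τ b' ≤ L.τ a b := by
    obtain ⟨d, hd, hg, e1, e2⟩ := exists_τ_eq_of_ll hll hn
    rw [e1, τ_eq_ofReal hU ha hb]
    exact ENNReal.ofReal_le_ofReal (H d hd hg e2)
  rcases ca with ⟨ha, ma, ta⟩ | ⟨ha, ma, ta⟩ | ⟨ha, ma, ta⟩ <;>
    rcases cb with ⟨hb', mb, tb⟩ | ⟨hb', mb, tb⟩ | ⟨hb', mb, tb⟩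
  · exact τ_le_of_side h.s₁₂ h.p₁₂ h.good₁₂ h.τ₁₂ ha hb' ma mb ta tb hll
  · rw [τ_eq_ofReal hU h.s₁₂.left_mem_U (h.s₁₂.sub ha)] at ta
    rw [τ_eq_ofReal hU h.s₂₃.left_mem_U (h.s₂₃.sub hb')] at tb
    refine red (h.s₁₂.sub ha) (h.s₂₃.sub hb') (n₁₃.mono ma.1 mb.2.1) fun d hd hg e => ?_
    refine hb.b₂ a ha b hb' d hd hg ?_
    rw [e, h.F₁₂₂₃ (nn _ _) (nn _ _) ma ta mb tb, ← h.s₁₂.add a ha, add_sub_cancel_left]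
  · rw [τ_eq_ofReal hU h.s₁₂.left_mem_U (h.s₁₂.sub ha)] at ta
    rw [τ_eq_ofReal hU h.s₁₃.left_mem_U (h.s₁₃.sub hb')] at tb
    have ea := h.s₁₂.add a ha
    have eb := h.s₁₃.add b hb'
    have ea' := nn a T.v₂
    have eb' := nn b T.v₃
    refine red (h.s₁₂.sub ha) (h.s₁₃.sub hb') (n₁₃.mono ma.1 mb.2.1) fun d hd hg e => ?_
    have fa : F M.v₁ a' = _ := (h.isPt₁₂ (nn _ _) ma ta).F_left h.p₁₂ h.good₁₂ f₁₂
    have fb : F M.v₁ b' = _ := (h.isPt₁₃ (nn _ _) mb tb).F_left h.p₁₃ h.good f₁₃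
    rw [h.F₁₂₁₃ (nn _ _) (nn _ _) ma ta mb tb] at e
    refine (hb.b₁ a ha b hb' d hd hg e.le).1 (lt_of_ll_of_F ma.1 hll
      (n₁₃.mono (ModelSpace.le_refl _) mb.2.1) (nn _ _)
      (h.good₁₂.mono (by linarith)) fa fb fun he => ?_)
    have := stew_first_le (K := K) h.p₁₂ h.p₂₃ hl h.good (nn T.v₁ a) (by linarith) (nn T.v₁ b)
      (by linarith)
    rw [← e, he, sub_self, md_zero] at this
    exact absurd this (not_le.2 (md_pos hd hg))
  · exact absurd hll (not_ll_of_le (ModelSpace.le_trans mb.2.1 ma.1))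
  · exact τ_le_of_side h.s₂₃ h.p₂₃ h.good₂₃ h.τ₂₃ ha hb' ma mb ta tb hll
  · rw [τ_eq_ofReal hU h.s₂₃.left_mem_U (h.s₂₃.sub ha)] at ta
    rw [τ_eq_ofReal hU h.s₁₃.left_mem_U (h.s₁₃.sub hb')] at tb
    have ea := h.s₂₃.add a ha
    have eb := h.s₁₃.add b hb'
    have ea' := nn a T.v₃
    have eb' := nn b T.v₃
    have la := ModelSpace.le_trans (ModelSpace.le_of_ll l₁₂) ma.1
    refine red (h.s₂₃.sub ha) (h.s₁₃.sub hb') (n₁₃.mono la mb.2.1) fun d hd hg e => ?_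
    have fb : F M.v₃ b' = _ := (h.isPt₁₃ (nn _ _) mb tb).F_right h.p₁₃ h.good f₁₃
    have fa : F M.v₃ a' = _ := (h.isPt₂₃ (nn _ _) ma ta).F_right h.p₂₃ h.good₂₃ f₂₃
    rw [F_comm, ← eb, add_sub_cancel_left] at fb
    rw [F_comm, ← ea, add_sub_cancel_left] at fa
    have hm := F_mono_left (ModelSpace.le_of_ll hll) mb.2.1 (n₁₃.mono la (ModelSpace.le_refl _))
    rw [fa, fb] at hm
    have hle := le_of_md_le ea' (h.good.mono (by linarith [nn T.v₁ b])) hm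
    rw [F_comm, h.F₁₃₂₃ (nn _ _) (nn _ _) mb tb ma ta] at e
    refine (hb.b₃ b hb' a ha d hd hg (by rw [e, ← eb, add_sub_cancel_left])).2
      (lt_of_le_of_ne hle fun he => ?_)
    have := stew_last_le (K := K) h.p₁₂ h.p₂₃ hl h.good (nn T.v₂ a) (by linarith) (nn T.v₁ b)
      (by linarith)
    rw [← e, show (L.timeSep hU).T T.v₁ T.v₃ - (L.timeSep hU).T T.v₁ b -
      ((L.timeSep hU).T T.v₂ T.v₃ - (L.timeSep hU).T T.v₂ a) = 0 by linarith, md_zero] at this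
    exact absurd this (not_le.2 (md_pos hd hg))
  · rw [τ_eq_ofReal hU h.s₁₃.left_mem_U (h.s₁₃.sub ha)] at ta
    rw [τ_eq_ofReal hU h.s₁₂.left_mem_U (h.s₁₂.sub hb')] at tb
    have ea := h.s₁₃.add a ha
    have eb := h.s₁₂.add b hb'
    have ea' := nn a T.v₃
    have eb' := nn b T.v₂
    have lb := ModelSpace.le_trans mb.2.1 (ModelSpace.le_of_ll l₂₃)
    refine red (h.s₁₃.sub ha) (h.s₁₂.sub hb') (n₁₃.mono ma.1 lb) fun d hd hg e => ?_
    have fb : F M.v₁ b' = _ := (h.isPt₁₂ (nn _ _) mb tb).F_left h.p₁₂ h.good₁₂ f₁₂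
    have fa : F M.v₁ a' = _ := (h.isPt₁₃ (nn _ _) ma ta).F_left h.p₁₃ h.good f₁₃
    rw [F_comm, h.F₁₂₁₃ (nn _ _) (nn _ _) mb tb ma ta] at e
    refine (hb.b₁ b hb' a ha d hd hg e.le).2 (lt_of_ll_of_F ma.1 hll
      (n₁₃.mono (ModelSpace.le_refl _) lb) (nn _ _)
      (h.good.mono (by linarith)) fa fb fun he => ?_)
    have := stew_first_le (K := K) h.p₁₂ h.p₂₃ hl h.good (nn T.v₁ b) (by linarith) (nn T.v₁ a)
      (by linarith)
    rw [← e, he, sub_self, md_zero] at this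
    exact absurd this (not_le.2 (md_pos hd hg))
  · rw [τ_eq_ofReal hU h.s₁₃.left_mem_U (h.s₁₃.sub ha)] at ta
    rw [τ_eq_ofReal hU h.s₂₃.left_mem_U (h.s₂₃.sub hb')] at tb
    have ea := h.s₁₃.add a ha
    have eb := h.s₂₃.add b hb'
    have ea' := nn a T.v₃
    have eb' := nn b T.v₃
    refine red (h.s₁₃.sub ha) (h.s₂₃.sub hb') (n₁₃.mono ma.1 mb.2.1) fun d hd hg e => ?_
    have fa : F M.v₃ a' = _ := (h.isPt₁₃ (nn _ _) ma ta).F_right h.p₁₃ h.good f₁₃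
    have fb : F M.v₃ b' = _ := (h.isPt₂₃ (nn _ _) mb tb).F_right h.p₂₃ h.good₂₃ f₂₃
    rw [F_comm, ← eb, add_sub_cancel_left] at fb
    rw [F_comm, ← ea, add_sub_cancel_left] at fa
    have hm := F_mono_left (ModelSpace.le_of_ll hll) mb.2.1 (n₁₃.mono ma.1 (ModelSpace.le_refl _))
    rw [fa, fb] at hm
    have hle := le_of_md_le ea' (h.good₂₃.mono (by linarith [nn T.v₂ b])) hm
    rw [h.F₁₃₂₃ (nn _ _) (nn _ _) ma ta mb tb] at e
    refine (hb.b₃ a ha b hb' d hd hg (by rw [e, ← ea, add_sub_cancel_left])).1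
      (lt_of_le_of_ne hle fun he => ?_)
    have := stew_last_le (K := K) h.p₁₂ h.p₂₃ hl h.good (nn T.v₂ b) (by linarith) (nn T.v₁ a)
      (by linarith)
    rw [← e, show (L.timeSep hU).T T.v₁ T.v₃ - (L.timeSep hU).T T.v₁ a -
      ((L.timeSep hU).T T.v₂ T.v₃ - (L.timeSep hU).T T.v₂ b) = 0 by linarith, md_zero] at this
    exact absurd this (not_le.2 (md_pos hd hg))
  · exact τ_le_of_side h.s₁₃ h.p₁₃ h.good h.τ₁₃ ha hb' ma mb ta tb hll

end Comparison

end LorentzianPreLengthSpace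

/-! ### The theorem. -/

namespace LorentzianPreLengthSpace

open LorentzModel

variable {X : Type*} [EMetricSpace X] {L : LorentzianPreLengthSpace X} {U : Set X} {K : ℝ}

lemma T_pos (hU : L.FiniteContinuousOn U) {a b : X} (ha : a ∈ U) (hb : b ∈ U) (h : L.ll a b) :
    0 < (L.timeSep hU).T a b :=
  ENNReal.toReal_pos ((L.τ_pos_iff a b).2 h).ne' (hU.1 a ha b hb)

lemma SatisfiesSizeBounds.good (hU : L.FiniteContinuousOn U) {T : Triangle X}
    (h : L.SatisfiesSizeBounds K T) : Good K ((L.timeSep hU).T T.v₁ T.v₃) := fun hK => by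
  have h1 := h hK
  exact (ENNReal.lt_ofReal_iff_toReal_lt h1.ne_top).1 h1

end LorentzianPreLengthSpace

theorem mainTheorem3 {X : Type*} [EMetricSpace X] (L : LorentzianPreLengthSpace X)
    (U : Set X) (hUfin : L.FiniteContinuousOn U) (hUcurve : L.HasRealizingCurves U)
    (K : ℝ) (T₃ : Triangle X) (hT₃ : L.IsTimelikeTriangle U T₃)
    (hsize : L.SatisfiesSizeBounds K T₃)
    (p : X) (T₁ T₂ : Triangle X) (hsub : L.IsSubdivision U T₃ p T₁ T₂)
    (M₁ M₂ : ModelTriangle K)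
    (hM₁ : L.IsComparisonTriangle T₁ M₁) (hM₂ : L.IsComparisonTriangle T₂ M₂)
    (hbound₁ : L.UpperBound T₁ M₁) (hbound₂ : L.UpperBound T₂ M₂) :
    (∃ M₃ : ModelTriangle K, L.IsComparisonTriangle T₃ M₃) ∧
      ∀ M₃ : ModelTriangle K, L.IsComparisonTriangle T₃ M₃ → L.UpperBound T₃ M₃ := by
  obtain ⟨hxy, hyz, gxy, gyz, gxz⟩ := hT₃
  have hg := hsize.good hUfin
  have sxy := gxy.side hUfin
  have syz := gyz.side hUfin
  have sxz := gxz.side hUfin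
  have pxy := LorentzianPreLengthSpace.T_pos hUfin sxy.left_mem_U sxy.right_mem_U hxy
  have pyz := LorentzianPreLengthSpace.T_pos hUfin syz.left_mem_U syz.right_mem_U hyz
  have hl := (L.timeSep hUfin).add_le sxy.left_mem_U sxy.right_mem_U syz.right_mem_U sxy.le syz.le
  refine ⟨?_, fun M₃ hM₃ => ?_⟩
  -- Existence needs only the reverse triangle inequality for the side lengths and the size bound,
  -- not the curvature bounds.
  · obtain ⟨u, v, w, e1, e2, e3⟩ := ModelSpace.exists_triangle pxy pyz hl hg
    exact ⟨⟨u, v, w⟩, e1.trans (LorentzianPreLengthSpace.τ_eq_ofReal hUfin sxy.left_mem_U sxy.right_mem_U).symm,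
      e2.trans (LorentzianPreLengthSpace.τ_eq_ofReal hUfin syz.left_mem_U syz.right_mem_U).symm,
      e3.trans (LorentzianPreLengthSpace.τ_eq_ofReal hUfin sxz.left_mem_U sxz.right_mem_U).symm⟩
  refine LorentzianPreLengthSpace.Comparison.upperBound ⟨sxy, syz, sxz, pxy, pyz, hg, hM₃⟩ ?_
  obtain ⟨γ, a, b, s, S, hγ, hS, hs, rfl, hxp, hpz, hcase⟩ := hsub
  have sxp := hγ.side hUfin le_rfl hs.1 hs.2
  have spz := hγ.side hUfin hs.1 hs.2 le_rfl
  rw [hγ.2.2.1] at sxp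
  rw [hγ.2.2.2.1] at spz
  have hun : T₃.s₁₃ = γ '' Set.Icc a s ∪ γ '' Set.Icc s b := by
    rw [hS, ← Set.image_union, Set.Icc_union_Icc_eq_Icc hs.1 hs.2]
  have hadd := sxz.add (γ s) (hS ▸ ⟨s, hs, rfl⟩)
  have pxp := LorentzianPreLengthSpace.T_pos hUfin sxp.left_mem_U sxp.right_mem_U hxp
  have ppz := LorentzianPreLengthSpace.T_pos hUfin spz.left_mem_U spz.right_mem_U hpz
  rw [hun] at sxz ⊢
  rcases hcase with ⟨hpy, gS, rfl, rfl⟩ | ⟨hyp, gS, rfl, rfl⟩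
  · have sS := gS.side hUfin
    have ppy := LorentzianPreLengthSpace.T_pos hUfin sS.left_mem_U sS.right_mem_U hpy
    have i1 := (L.timeSep hUfin).add_le sS.left_mem_U sS.right_mem_U syz.right_mem_U sS.le syz.le
    have b₁ := (show LorentzianPreLengthSpace.Comparison hUfin ⟨T₃.v₁, γ s, T₃.v₂, γ '' Set.Icc a s, S, T₃.s₁₂⟩ M₁ from
      ⟨sxp, sS, sxy, pxp, ppy, hg.mono (by linarith), hM₁⟩).triBound hbound₁
    have b₂ := (show LorentzianPreLengthSpace.Comparison hUfin ⟨γ s, T₃.v₂, T₃.v₃, S, T₃.s₂₃, γ '' Set.Icc s b⟩ M₂ from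
      ⟨sS, syz, spz, ppy, pyz, hg.mono (by linarith), hM₂⟩).triBound hbound₂
    exact LorentzModel.Glue.triBound ⟨sxy, syz, sxp, spz, sS, b₁, b₂, hadd, hg, pxp, ppz, ppy, pyz⟩
  · have sS := gS.side hUfin
    have pyp := LorentzianPreLengthSpace.T_pos hUfin sS.left_mem_U sS.right_mem_U hyp
    have b₁ := (show LorentzianPreLengthSpace.Comparison hUfin ⟨T₃.v₁, T₃.v₂, γ s, T₃.s₁₂, S, γ '' Set.Icc a s⟩ M₁ from
      ⟨sxy, sS, sxp, pxy, pyp, hg.mono (by linarith), hM₁⟩).triBound hbound₁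
    have b₂ := (show LorentzianPreLengthSpace.Comparison hUfin ⟨T₃.v₂, γ s, T₃.v₃, S, γ '' Set.Icc s b, T₃.s₂₃⟩ M₂ from
      ⟨sS, spz, syz, pyp, ppz, hg.mono (by linarith), hM₂⟩).triBound hbound₂
    exact LorentzModel.triBound_of_ll sxy syz sxp spz sS sxz b₁ b₂ hadd hg pxy pyz pyp ppz
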